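/- **Problem.** Let $P(x)=\frac1n\sum_{\tau=1}^n f^{(\tau)}(x)+\psi(x)$ on $\mathbb R^d$, $f^{(\tau)}=\frac1m\sum_{i=1}^m f_i^{(\tau)}$, $n,m\ge1$, $N=nm$. Each $f_i^{(\tau)}$ is convex and $L$-smooth, each $f^{(\tau)}$ is $\bar L$-smooth, $\frac1n\sum_\tau f^{(\tau)}$ is $L_f$-smooth, and $\psi$ is $\lambda$-strongly convex ($\lambda>0$) and $\ell$-smooth with $\ell\le\Lambda\lambda$ (so $\Lambda=1$ for $\psi=\frac\lambda2\|\cdot\|^2$). $Q,Q_1$ are randomized maps with $\mathbb E\|x-Q(x)\|^2\le(1-\delta)\|x\|^2$ and $\mathbb E\|x-Q_1(x)\|^2\le(1-\delta_1)\|x\|^2$ for all $x$, where $\delta,\delta_1\in(0,1]$. Write $P^*=\min P$. **Outer loop (Catalyst).** Let $\kappa\ge0$, $q=\lambda/(\lambda+\kappa)$, $0<\rho_0<\sqrt q$, $\alpha_0=\sqrt q$, $P(x^0)>P^*$, $y^{-1}=y^0=x^0$ and $\epsilon_k=\frac29(P(x^0)-P^*)(1-\rho_0)^k$. For $k\ge1$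 let $G_k(x)=P(x)+\frac\kappa2\|x-y^{k-1}\|^2$ with minimizer $x^*_{(k)}$ and minimum $G_k^*$. The $k$-th inner run produces $x^k$, and then $y^k=x^k+\beta_k(x^k-x^{k-1})$, where $\alpha_k>0$ solves $\alpha_k^2=(1-\alpha_k)\alpha_{k-1}^2+q\alpha_k$ and $\beta_k=\frac{\alpha_{k-1}(1-\alpha_{k-1})}{\alpha_{k-1}^2+\alpha_k}$. **Inner loop (EC-LSVRG).** Put $g_i^{(\tau)}=f_i^{(\tau)}+\psi+\frac\kappa2\|\cdot-y^{k-1}\|^2$ and $g^{(\tau)}=\frac1m\sum_i g_i^{(\tau)}$. With fresh independent randomness in each iteration, node $\tau$ samples $i^\tau$ uniformly from $\{1,\dots,m\}$ and sets $v_\tau=\nabla g_{i^\tau}^{(\tau)}(x^K)-\nabla g_{i^\tau}^{(\tau)}(w^K)+\nabla g^{(\tau)}(w^K)-h_\tau^K$, $s_\tau=Q(\eta v_\tau+e_\tau^K)$, $e_\tau^{K+1}=e_\tau^K+\eta v_\tau-s_\tau$, $h_\tau^{K+1}=h_\tau^K+Q_1(\nabla g^{(\tau)}(w^K)-h_\tau^K)$;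 then $x^{K+1}=x^K-\frac1n\sum_\tau(s_\tau+\eta h_\tau^K)$, and $w^{K+1}=x^K$ with probability $p$, $w^{K+1}=w^K$ otherwise. A subscript $(k)$ marks the variables of the $k$-th run. Let $A_f=L_f+\ell+\kappa$, $\bar A=\bar L+\ell+\kappa$, $A=L+\ell+\kappa$, let $e^K=\frac1n\sum_\tau e^K_\tau$, and let $$\Phi_{3,(k)}^K=\|x^K-e^K-x^*_{(k)}\|^2+\tfrac{12A_f\eta}{n\delta}\sum_\tau\|e_\tau^K\|^2+\tfrac{192(1-\delta)A_f\eta^3}{\delta^2\delta_1n}\sum_\tau\|h_\tau^K-\nabla g^{(\tau)}(w^K)\|^2+\tilde\eta\,(G_k(w^K)-G_k^*),$$ $$\tilde\eta=\tfrac4{3p}\Big(\tfrac{48(1-\delta)A_f\eta^3}{\delta}\big(\tfrac{4\bar A}\delta+A+\tfrac{16\bar Ap}{\delta\delta_1}(1+\tfrac{2p}{\delta_1})\big)+\tfrac{4A\eta^2}{n}\Big).$$ The $k$-th run stops after $T_k=\inf\{K\ge1:\ \Phi_{3,(k)}^K+G_k(x_{(k)}^K)-G_k^*\le\epsilon_k\}$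 iterations and outputs $x^k=x_{(k)}^{T_k}$, $h_{\tau,(k)}^{T_k}$ and $e_{\tau,(k)}^{T_k}$. **Warm start.** $x_{(k)}^0=w_{(k)}^0=x^{k-1}$; $e_{\tau,(k)}^0$ is $0$ or $e_{\tau,(k-1)}^{T_{k-1}}$; $h_{\tau,(k)}^0$ is $h_{\tau,(k-1)}^{T_{k-1}}$ or $h_{\tau,(k-1)}^{T_{k-1}}+\kappa(y^{k-2}-y^{k-1})$ (either option may be taken in each outer iteration). For $k=1$ the previous $e_\tau$ is $0$ and the previous $h_\tau$ is an arbitrary vector $h_\tau^0$. **Parameters.** $p\le 1$ and $c_1\delta_1\le p\le c_2\delta_1$; $c\le\eta S\le c_0$, where $S=A_f+\frac An+\frac{\sqrt{(1-\delta)A_f\bar A}}\delta+\frac{\sqrt{(1-\delta)A_fA}}{\sqrt\delta}$. **Claim.** For all $\Lambda$ and $c_1,c_2>0$ there is $c_0>0$ such that for every $c>0$ there is $C>0$ ($c_0,C$ depend on nothing else) for which, in the above setting, the following holds. Let $$B=\tfrac1\delta+\tfrac1{\delta_1}+\tfrac{\sqrt{(1-\delta)(L_f+\lambda+\kappa)(\bar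 L+\lambda+\kappa)}}{\delta(\lambda+\kappa)}+\tfrac{L_f}{\lambda+\kappa}+\tfrac{L}{n(\lambda+\kappa)}+\tfrac{\sqrt{(1-\delta)(L_f+\lambda+\kappa)(L+\lambda+\kappa)}}{\sqrt\delta(\lambda+\kappa)}.$$ 1. For every $k\ge1$, $\ \mathbb E[T_k]\le C\,B\,\log M_k$, where for $k\ge 2$ $$M_k=2+\tfrac1\delta+\tfrac1{\delta_1}+\lambda+\tfrac1\lambda+\kappa+L_f+N+\tfrac1{\sqrt q-\rho_0}+(\bar L-nL_f)_++(L-NL_f)_+,$$ and $M_1$ has the additional summand $\frac{1}{P(x^0)-P^*}\cdot\frac1n\sum_\tau\|h_\tau^0-\nabla f^{(\tau)}(x^0)-\nabla\psi(x^0)\|^2$. (The positive parts vanish for the smallest smoothness constants.) 2. Let a vector compressed by $Q$ (by $Q_1$) cost $r_Q\ge 0$ ($r_{Q_1}\ge0$) to communicate. One of each is sent per node and inner iteration, and nothing is sent to initialize an outer iteration (the initial $h^0_\tau$ apart). For every $\epsilon>0$ there is a $k\le1+\frac1{\rho_0}\max\{0,\log\frac{C(P(x^0)-P^*)}{(\sqrt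 q-\rho_0)^2\epsilon}\}$ such that $P(x^k)-P^*\le\epsilon$ almost surely and the expected communication cost of the first $k$ outer iterations is at most $(r_Q+r_{Q_1})\,C\,B\,\log(M_1)\,k$. In particular the cost of an uncompressed vector does not enter; for $\rho_0$ of order $\sqrt q$, $\frac1{\rho_0}$ is of order $\sqrt{(\lambda+\kappa)/\lambda}$. -/

import Mathlib

open MeasureTheory ProbabilityTheory
open scoped ENNReal

noncomputable section

namespace ECCatalyst

/-- The Euclidean space `ℝ^d`. -/
abbrev Vec (d : ℕ) := EuclideanSpace ℝ (Fin d)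

/-- `F` is `L`-smooth: differentiable with `L`-Lipschitz gradient. -/
def IsSmooth {d : ℕ} (L : ℝ) (F : Vec d → ℝ) : Prop :=
  Differentiable ℝ F ∧ ∀ x y, ‖gradient F x - gradient F y‖ ≤ L * ‖x - y‖

/-- A randomized map on `ℝ^d` is a measurable map `Q` of a random seed (with law `μ`) and a vector;
it is a contraction compressor with parameter `δ ∈ (0, 1]` if
`E‖x - Q(x)‖² ≤ (1 - δ)‖x‖²` for every `x`. -/
structure IsContractionCompressor {d : ℕ} {S : Type*} [MeasurableSpace S] (μ : Measure S)
    (δ : ℝ) (Q : S → Vec d → Vec d) : Prop where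
  pos : 0 < δ
  le_one : δ ≤ 1
  measurable : Measurable (Function.uncurry Q)
  contraction : ∀ x, ∫⁻ s, ENNReal.ofReal (‖x - Q s x‖ ^ 2) ∂μ ≤ ENNReal.ofReal ((1 - δ) * ‖x‖ ^ 2)

/-- The average of finitely many vectors. -/
def mean {n : ℕ} {V : Type*} [AddCommGroup V] [Module ℝ V] (v : Fin n → V) : V :=
  (1 / (n : ℝ)) • ∑ i, v i

/-- A chosen minimizer of `F` (the minimizer, when `F` is strongly convex and continuous). -/
def argmin {d : ℕ} (F : Vec d → ℝ) : Vec d :=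
  Classical.epsilon fun x => ∀ y, F x ≤ F y

/-! ### EC-LSVRG without regularizer -/

/-- The randomness used in one iteration: the seeds of the calls of `Q` and of `Q₁` on every node,
the sampled index on every node, and the coin `u`. -/
abbrev Sample (n m : ℕ) (S S₁ : Type*) :=
  (Fin n → S) × (Fin n → S₁) × (Fin n → Fin m) × Bool

/-- The law of the randomness of one iteration: all components are independent, the indices are
uniform, and `u = 1` with probability `p`. -/
def sampleLaw (n m : ℕ) {S S₁ : Type*} [MeasurableSpace S] [MeasurableSpace S₁]
    (μ : Measure S) (μ₁ : Measure S₁) (p : ℝ) : Measure (Sample n m S S₁) :=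
  (Measure.pi fun _ => μ).prod ((Measure.pi fun _ => μ₁).prod
    ((Measure.pi fun _ => uniformOn Set.univ).prod
      (ENNReal.ofReal p • Measure.dirac true + ENNReal.ofReal (1 - p) • Measure.dirac false)))

/-- The iterate `x`, the reference point `w`, the errors `e_τ` and the learned vectors `h_τ`. -/
structure InnerState (d n : ℕ) where
  x : Vec d
  w : Vec d
  e : Fin n → Vec d
  h : Fin n → Vec d

/-- One iteration of EC-LSVRG for `(1/n) ∑_τ (1/m) ∑_i F τ i` with stepsize `η`. -/
def ecLsvrgStep {d n m : ℕ} {S S₁ : Type*} (F : Fin n → Fin m → Vec d → ℝ)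
    (Q : S → Vec d → Vec d) (Q₁ : S₁ → Vec d → Vec d) (η : ℝ)
    (r : Sample n m S S₁) (s : InnerState d n) : InnerState d n :=
  let g : Fin n → Vec d := fun τ =>
    gradient (F τ (r.2.2.1 τ)) s.x - gradient (F τ (r.2.2.1 τ)) s.w
      + gradient (mean (F τ)) s.w - s.h τ
  let y : Fin n → Vec d := fun τ => Q (r.1 τ) (η • g τ + s.e τ)
  let z : Fin n → Vec d := fun τ => Q₁ (r.2.1 τ) (gradient (mean (F τ)) s.w - s.h τ)
  { x := s.x - (mean y + η • mean s.h)
    w := if r.2.2.2 then s.x else s.w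
    e := fun τ => s.e τ + η • g τ - y τ
    h := fun τ => s.h τ + z τ }

/-! ### Catalyst with EC-LSVRG as inner method -/

/-- The data of a run: component functions `f τ i`, regularizer `ψ`, compressors, constants and
parameters, and the initial vectors. `carryE k` tells whether the errors are carried over to outer
iteration `k + 1` (otherwise they are reset to `0`), `shiftH k` whether the vectors `h_τ` are
shifted there. -/
structure Run (d n m : ℕ) (S S₁ : Type*) where
  f : Fin n → Fin m → Vec d → ℝ
  ψ : Vec d → ℝ
  Q : S → Vec d → Vec d
  Q₁ : S₁ → Vec d → Vec d
  /-- smoothness constant of the average of all `f τ i` -/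
  Lf : ℝ
  /-- smoothness constant of each local average `f^(τ)` -/
  Lbar : ℝ
  /-- smoothness constant of each `f τ i` -/
  L : ℝ
  /-- strong convexity constant of `ψ` -/
  lam : ℝ
  /-- smoothness constant of `ψ` -/
  ell : ℝ
  /-- parameter of `Q` -/
  δ : ℝ
  /-- parameter of `Q₁` -/
  δ₁ : ℝ
  /-- Catalyst parameter `κ` -/
  kap : ℝ
  /-- Catalyst parameter `ρ₀` -/
  ρ : ℝ
  /-- stepsize of EC-LSVRG -/
  η : ℝ
  /-- probability of updating the reference point in EC-LSVRG -/
  p : ℝ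
  x0 : Vec d
  h0 : Fin n → Vec d
  carryE : ℕ → Bool
  shiftH : ℕ → Bool

/-- The variables kept between outer iterations: after outer iteration `k` these are `x^k`, `y^k`,
`y^{k-1}` and the final `e_τ`, `h_τ` of that iteration. -/
structure OuterState (d n : ℕ) where
  x : Vec d
  y : Vec d
  yPrev : Vec d
  e : Fin n → Vec d
  h : Fin n → Vec d

namespace Run

variable {d n m : ℕ} {S S₁ : Type*} (D : Run d n m S S₁)

/-- The objective `P = (1/n) ∑_τ (1/m) ∑_i f τ i + ψ`. -/
def P (x : Vec d) : ℝ := mean (fun τ => mean (D.f τ)) x + D.ψ x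

/-- The initial gap `P(x⁰) - P*`. -/
def gap : ℝ := D.P D.x0 - ⨅ x, D.P x

/-- `q = λ / (λ + κ)`. -/
def q : ℝ := D.lam / (D.lam + D.kap)

/-- `α₀ = √q`, and `α_{k+1}` is the positive root of `α² = (1 - α) α_k² + q α`. -/
def α : ℕ → ℝ
  | 0 => √D.q
  | k + 1 => ((D.q - α k ^ 2) + √((D.q - α k ^ 2) ^ 2 + 4 * α k ^ 2)) / 2

/-- `β_{k+1} = α_k (1 - α_k) / (α_k² + α_{k+1})`, indexed by `k`. -/
def β (k : ℕ) : ℝ := D.α k * (1 - D.α k) / (D.α k ^ 2 + D.α (k + 1))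

/-- The accuracy `ε_k` demanded in outer iteration `k`. -/
def ε (k : ℕ) : ℝ := 2 / 9 * D.gap * (1 - D.ρ) ^ k

/-- The components of the subproblem with prox-center `y`: both `ψ` and `(κ/2)‖· - y‖²` are moved
into each `f τ i`. -/
def comp (y : Vec d) (τ : Fin n) (i : Fin m) (x : Vec d) : ℝ :=
  D.f τ i x + D.ψ x + D.kap / 2 * ‖x - y‖ ^ 2

/-- The subproblem objective `G = P + (κ/2)‖· - y‖²`. -/
def G (y : Vec d) (x : Vec d) : ℝ := D.P x + D.kap / 2 * ‖x - y‖ ^ 2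

/-- The minimum `G*`. -/
def Gstar (y : Vec d) : ℝ := ⨅ x, D.G y x

/-- Smoothness constant of the objective `G` of the subproblem. -/
def AF : ℝ := D.Lf + D.ell + D.kap

/-- Smoothness constant of the local averages of the subproblem. -/
def Abar : ℝ := D.Lbar + D.ell + D.kap

/-- Smoothness constant of the components of the subproblem. -/
def AL : ℝ := D.L + D.ell + D.kap

/-- The coefficient of `G(w) - G*` in the potential. -/
def ηTilde : ℝ :=
  4 / (3 * D.p) *
    (48 * (1 - D.δ) * D.AF * D.η ^ 3 / D.δ *
        (4 * D.Abar / D.δ + D.AL + 16 * D.Abar * D.p / (D.δ * D.δ₁) * (1 + 2 * D.p / D.δ₁))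
      + 4 * D.AL * D.η ^ 2 / n)

/-- The potential `Φ₃` of EC-LSVRG for the subproblem with prox-center `y`. -/
def Φ₃ (y : Vec d) (s : InnerState d n) : ℝ :=
  ‖s.x - mean s.e - argmin (D.G y)‖ ^ 2
    + 12 * D.AF * D.η / (n * D.δ) * ∑ τ, ‖s.e τ‖ ^ 2
    + 192 * (1 - D.δ) * D.AF * D.η ^ 3 / (D.δ ^ 2 * D.δ₁ * n) *
        ∑ τ, ‖s.h τ - gradient (mean (D.comp y τ)) s.w‖ ^ 2
    + D.ηTilde * (D.G y s.w - D.Gstar y)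

/-- The state before the first outer iteration; `y^{-1} = y^0 = x^0`. -/
def outerInit : OuterState d n where
  x := D.x0
  y := D.x0
  yPrev := D.x0
  e := fun _ => 0
  h := D.h0

/-- The initialization of EC-LSVRG in outer iteration `k + 1`. -/
def innerInit (k : ℕ) (o : OuterState d n) : InnerState d n where
  x := o.x
  w := o.x
  e := if D.carryE k then o.e else fun _ => 0
  h := if D.shiftH k then fun τ => o.h τ + D.kap • (o.yPrev - o.y) else o.h

/-- The state after `K` iterations of EC-LSVRG in outer iteration `k + 1`, driven by `r`. -/
def inner (k : ℕ) (o : OuterState d n) (r : ℕ → Sample n m S S₁) : ℕ → InnerState d n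
  | 0 => D.innerInit k o
  | K + 1 => ecLsvrgStep (D.comp o.y) D.Q D.Q₁ D.η (r K) (inner k o r K)

/-- The number of inner iterations of outer iteration `k + 1`:
`inf {K ≥ 1 : Φ₃^K + G(x^K) - G* ≤ ε_{k+1}}`, which is `⊤` if there is no such `K`. -/
def stopTime (k : ℕ) (o : OuterState d n) (r : ℕ → Sample n m S S₁) : ℕ∞ :=
  sInf ((fun K : ℕ => (K : ℕ∞)) '' {K : ℕ | 1 ≤ K ∧
    D.Φ₃ o.y (D.inner k o r K) + D.G o.y (D.inner k o r K).x - D.Gstar o.y ≤ D.ε (k + 1)})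

/-- Outer iteration `k + 1` of Catalyst. -/
def outerStep (k : ℕ) (o : OuterState d n) (r : ℕ → Sample n m S S₁) : OuterState d n :=
  let s := D.inner k o r (D.stopTime k o r).toNat
  { x := s.x
    y := s.x + D.β k • (s.x - o.x)
    yPrev := o.y
    e := s.e
    h := s.h }

/-- The state after `k` outer iterations; `r k` drives outer iteration `k + 1`. -/
def outer (r : ℕ → ℕ → Sample n m S S₁) : ℕ → OuterState d n
  | 0 => D.outerInit
  | k + 1 => D.outerStep k (outer r k) (r k)

/-- The number `T_{k+1}` of inner iterations in outer iteration `k + 1`. -/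
def T (r : ℕ → ℕ → Sample n m S S₁) (k : ℕ) : ℕ∞ :=
  D.stopTime k (D.outer r k) (r k)

/-- Communication (per node) during the first `k` outer iterations, if a vector compressed by `Q`
costs `rQ` and one compressed by `Q₁` costs `rQ₁`. One vector of each kind is sent in every inner
iteration; the initialization of an outer iteration only uses vectors that are already available
where they are needed, so nothing is sent there. -/
def commCost (rQ rQ₁ : ℝ) (r : ℕ → ℕ → Sample n m S S₁) (k : ℕ) : ℝ≥0∞ :=
  ∑ j ∈ Finset.range k, ENNReal.ofReal (rQ + rQ₁) * (D.T r j : ℝ≥0∞)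

/-! ### Quantities in the statement -/

/-- Convexity, smoothness and strong convexity assumptions on the objective. -/
structure PrimalAssumption : Prop where
  convex : ∀ τ i, ConvexOn ℝ Set.univ (D.f τ i)
  smooth_comp : ∀ τ i, IsSmooth D.L (D.f τ i)
  smooth_local : ∀ τ, IsSmooth D.Lbar (mean (D.f τ))
  smooth_avg : IsSmooth D.Lf (mean fun τ => mean (D.f τ))
  lam_pos : 0 < D.lam
  strong : StrongConvexOn Set.univ D.lam D.ψ
  smooth_reg : IsSmooth D.ell D.ψ

/-- The inverse of the order of the stepsize of EC-LSVRG for the subproblem. -/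
def stepScale : ℝ :=
  D.AF + D.AL / n + √((1 - D.δ) * D.AF * D.Abar) / D.δ + √((1 - D.δ) * D.AF * D.AL) / √D.δ

/-- The bound on the expected number of inner iterations, without constants and logarithms. -/
def bound : ℝ :=
  1 / D.δ + 1 / D.δ₁
    + √((1 - D.δ) * (D.Lf + D.lam + D.kap) * (D.Lbar + D.lam + D.kap)) / (D.δ * (D.lam + D.kap))
    + D.Lf / (D.lam + D.kap) + D.L / (n * (D.lam + D.kap))
    + √((1 - D.δ) * (D.Lf + D.lam + D.kap) * (D.L + D.lam + D.kap)) / (√D.δ * (D.lam + D.kap))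

/-- `(1/n) ∑_τ ‖h_τ⁰ - ∇f^(τ)(x⁰) - ∇ψ(x⁰)‖²`. -/
def initErr : ℝ :=
  mean fun τ => ‖D.h0 τ - gradient (mean (D.f τ)) D.x0 - gradient D.ψ D.x0‖ ^ 2

/-- The argument of the hidden logarithm for outer iteration `k + 1`. The two `max` terms vanish if
`Lbar ≤ n Lf` and `L ≤ n m Lf`, as holds for the smallest smoothness constants; the last term
occurs only in the first outer iteration and vanishes if `h_τ⁰` is the local gradient at `x⁰`. -/
def logArg (k : ℕ) : ℝ :=
  2 + 1 / D.δ + 1 / D.δ₁ + D.lam + 1 / D.lam + D.kap + D.Lf + n * m + 1 / (√D.q - D.ρ)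
    + max 0 (D.Lbar - n * D.Lf) + max 0 (D.L - n * m * D.Lf)
    + if k = 0 then D.initErr / D.gap else 0

end Run

end ECCatalyst

end

noncomputable section

namespace ECCatalyst

variable {d : ℕ}

/-! ### Smooth and convex functions -/

/-! Inner loop. The errors `e_τ` record exactly what compression withholds, so the virtual iterate
`x - mean e` performs an uncompressed LSVRG step (`potential_step_eq`). Its expected squared
distance to the minimizer contracts by strong convexity, up to three perturbations: the size of the
errors, the sampling variance, and, through the compressed messages, the distance of `h_τ` from the
local gradients at `w`. The other terms of the potential pay for these: the error term contracts by
compression with `Q`, the learning term by compression with `Q₁`, and the gap at `w` by the coin.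
The suboptimality gained at `x` covers what is left. With the chosen weights, one iteration
multiplies the expected potential by at most `1 - r` (`Subproblem.lintegral_potential_step_le_mul`),
where `r` is of the order of the inverse of `bound` (`Run.Valid.rate_le`).

Outer loop. Since `α₀ = √q`, all `α_k` equal `√q`, and the method is an inexact accelerated proximal
point method. For the Lyapunov function consisting of the gap of `P` and `λ/2` times a squared
distance, an accuracy `e` costs an additive `e` and a cross term `2 √e √V` (`accelerated_step_le`).
Taking square roots makes this a linear recursion (`accelerated_rate`). The resulting rate
`Run.Valid.outer_rate` is deterministic: it holds on every path on which the runs stop.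

Warm start. The stopping rule bounds the whole potential, not only the gap, so the final errors and
learned vectors of a run are controlled as well. Together with the outer rate this bounds the
initial potential of the next run by `R ^ 23` times its target accuracy, on every such path
(`Run.Valid.warm_start_le`). Here `R` is a constant multiple of `logArg`, and every power of `R`
ends up inside the logarithm.

Counting. The potential controls the gap at `x` up to `R ^ 7`, so a run that has not stopped after
`K` iterations has potential above `ε / R ^ 7`. Summing these events and inserting the geometric
decay bounds the expected length by `1 + K₀ + 1/r`, with `K₀` of order `log R / r`
(`Run.Valid.stopTime_le`, `Run.Valid.lintegral_T_le_of_ae`). The inner trajectory is defined for all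
`K`, also beyond the stopping time, so no optional stopping is needed; it suffices that the fresh
sample is independent of the current state (`Run.Valid.indepFun_states`). A finite expectation makes
the run stop almost surely, which feeds the induction over outer iterations. -/

theorem IsSmooth.hasGradientAt {L : ℝ} {F : Vec d → ℝ} (hF : IsSmooth L F) (x : Vec d) :
    HasGradientAt F (gradient F x) x := (hF.1 x).hasGradientAt

theorem hasDerivAt_line {F : Vec d → ℝ} (hF : Differentiable ℝ F) (x v : Vec d) (t : ℝ) :
    HasDerivAt (fun t : ℝ => F (x + t • v)) (inner ℝ (gradient F (x + t • v)) v) t := by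
  have h1 : HasFDerivAt F (fderiv ℝ F (x + t • v)) (x + t • v) := (hF _).hasFDerivAt
  have h2 : HasDerivAt (fun t : ℝ => x + t • v) v t := by
    simpa using ((hasDerivAt_id t).smul_const v).const_add x
  have := h1.comp_hasDerivAt t h2
  rwa [← inner_gradient_left] at this

theorem IsSmooth.le_quadratic {L : ℝ} {F : Vec d → ℝ} (hF : IsSmooth L F) (x y : Vec d) :
    F y ≤ F x + inner ℝ (gradient F x) (y - x) + L / 2 * ‖y - x‖ ^ 2 := by
  set v := y - x with hv
  let φ : ℝ → ℝ := fun t => F (x + t • v) - (t * inner ℝ (gradient F x) v + L * ‖v‖ ^ 2 * (t ^ 2 / 2))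
  have hd : ∀ t, HasDerivAt φ (inner ℝ (gradient F (x + t • v)) v
      - (inner ℝ (gradient F x) v + L * ‖v‖ ^ 2 * t)) t := by
    intro t
    refine (hasDerivAt_line hF.1 x v t).sub (HasDerivAt.add ?_ ?_)
    · simpa using (hasDerivAt_id t).mul_const (inner ℝ (gradient F x) v)
    · have := ((hasDerivAt_pow 2 t).div_const 2).const_mul (L * ‖v‖ ^ 2)
      exact this.congr_deriv (by norm_num)
  have hanti : AntitoneOn φ (Set.Icc 0 1) := by
    refine antitoneOn_of_deriv_nonpos (convex_Icc 0 1)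
      (fun t _ => (hd t).continuousAt.continuousWithinAt)
      (fun t _ => (hd t).differentiableAt.differentiableWithinAt) ?_
    intro t ht
    rw [interior_Icc] at ht
    rw [(hd t).deriv]
    have h1 : inner ℝ (gradient F (x + t • v) - gradient F x) v ≤ L * ‖v‖ ^ 2 * t := by
      calc _ ≤ ‖gradient F (x + t • v) - gradient F x‖ * ‖v‖ := real_inner_le_norm _ _
        _ ≤ L * ‖x + t • v - x‖ * ‖v‖ := by gcongr; exact hF.2 _ _
        _ = L * ‖v‖ ^ 2 * t := by
          rw [add_sub_cancel_left, norm_smul, Real.norm_of_nonneg ht.1.le]; ring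
    rw [inner_sub_left] at h1
    linarith
  have := hanti (Set.left_mem_Icc.2 zero_le_one) (Set.right_mem_Icc.2 zero_le_one) zero_le_one
  simp only [φ, hv, one_smul, add_sub_cancel, zero_smul, add_zero] at this
  linarith

theorem ConvexOn.gradient_le {F : Vec d → ℝ} (hc : ConvexOn ℝ Set.univ F)
    (hF : Differentiable ℝ F) (x y : Vec d) :
    F x + inner ℝ (gradient F x) (y - x) ≤ F y := by
  have hc' : ConvexOn ℝ Set.univ (fun t : ℝ => F (x + t • (y - x))) := by
    have := hc.comp_affineMap (AffineMap.lineMap x y : ℝ →ᵃ[ℝ] Vec d)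
    simpa [Function.comp_def, AffineMap.lineMap_apply, add_comm] using this
  have := hc'.le_slope_of_hasDerivAt (Set.mem_univ 0) (Set.mem_univ 1) one_pos
    (hasDerivAt_line hF x (y - x) 0)
  simp [slope_def_field, -inner_gradient_left] at this
  linarith

/-- Cocoercivity of the gradient of a smooth convex function. -/
theorem IsSmooth.gradient_sub_sq_le {L : ℝ} {F : Vec d → ℝ} (hF : IsSmooth L F) (hL : 0 < L)
    (hc : ConvexOn ℝ Set.univ F) (x y : Vec d) :
    ‖gradient F x - gradient F y‖ ^ 2
      ≤ 2 * L * (F x - F y - inner ℝ (gradient F y) (x - y)) := by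
  set g := gradient F x - gradient F y with hg
  -- The test point is a step of length `1/L` from `x` along the difference of the gradients:
  -- smoothness at `x` bounds its value from above, convexity at `y` from below.
  have h1 := hF.le_quadratic x (x - L⁻¹ • g)
  have h2 := ConvexOn.gradient_le hc hF.1 y (x - L⁻¹ • g)
  have h3 : inner ℝ (gradient F x) g - inner ℝ (gradient F y) g = ‖g‖ ^ 2 := by
    rw [← inner_sub_left, ← hg, real_inner_self_eq_norm_sq]
  have e1 : x - L⁻¹ • g - x = -(L⁻¹ • g) := by abel
  have e2 : x - L⁻¹ • g - y = (x - y) - L⁻¹ • g := by abel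
  rw [e1, norm_neg, norm_smul, inner_neg_right, inner_smul_right,
    Real.norm_of_nonneg (inv_nonneg.2 hL.le)] at h1
  rw [e2, inner_sub_right, inner_smul_right] at h2
  have h4 : L⁻¹ * ‖g‖ ^ 2 ≤ F x - F y - inner ℝ (gradient F y) (x - y)
      + L / 2 * (L⁻¹ * ‖g‖) ^ 2 := by
    rw [← h3]; linarith
  have h5 : L / 2 * (L⁻¹ * ‖g‖) ^ 2 = L⁻¹ * ‖g‖ ^ 2 / 2 := by field_simp
  rw [h5] at h4
  have h6 : L⁻¹ * ‖g‖ ^ 2 / 2 ≤ F x - F y - inner ℝ (gradient F y) (x - y) := by linarith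
  have h7 : ‖g‖ ^ 2 = 2 * L * (L⁻¹ * ‖g‖ ^ 2 / 2) := by field_simp
  rw [h7]
  gcongr

theorem hasGradientAt_half_normSq (κ : ℝ) (y x : Vec d) :
    HasGradientAt (fun x => κ / 2 * ‖x - y‖ ^ 2) (κ • (x - y)) x := by
  rw [hasGradientAt_iff_hasFDerivAt]
  have h := (((hasFDerivAt_id (𝕜 := ℝ) x).sub_const y).norm_sq).const_mul (κ / 2)
  refine h.congr_fderiv ?_
  ext v
  simp
  ring

/-! ### Gradients of sums, and the calculus of `mean` -/

theorem HasGradientAt.add {F H : Vec d → ℝ} {a b x : Vec d} (h1 : HasGradientAt F a x)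
    (h2 : HasGradientAt H b x) : HasGradientAt (fun x => F x + H x) (a + b) x := by
  rw [hasGradientAt_iff_hasFDerivAt] at *
  simpa using h1.fun_add h2

theorem mean_apply {ι : Type*} {n : ℕ} {V : Type*} [AddCommGroup V] [Module ℝ V]
    (v : Fin n → ι → V) (x : ι) : mean v x = mean (fun i => v i x) := by
  simp [mean]

theorem mean_real {n : ℕ} (v : Fin n → ℝ) : mean v = (∑ i, v i) / n := by
  simp [mean, div_eq_inv_mul]

theorem HasGradientAt.mean {n : ℕ} {F : Fin n → Vec d → ℝ} {a : Fin n → Vec d} {x : Vec d}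
    (h : ∀ i, HasGradientAt (F i) (a i) x) : HasGradientAt (mean F) (mean a) x := by
  have e : ECCatalyst.mean F = fun x => (1 / (n : ℝ)) * ∑ i, F i x := by
    ext x; simp [ECCatalyst.mean]
  rw [e]
  simp only [hasGradientAt_iff_hasFDerivAt] at *
  have := (HasFDerivAt.fun_sum (u := Finset.univ) fun i _ => h i).const_mul (1 / (n : ℝ))
  simpa [ECCatalyst.mean] using this

theorem mean_const {n : ℕ} (hn : 0 < n) {V : Type*} [AddCommGroup V] [Module ℝ V] (v : V) :
    mean (fun _ : Fin n => v) = v := by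
  have : (n : ℝ) ≠ 0 := by positivity
  simp [mean, ← Nat.cast_smul_eq_nsmul ℝ, smul_smul, this]

theorem mean_add {n : ℕ} {V : Type*} [AddCommGroup V] [Module ℝ V] (u v : Fin n → V) :
    mean (fun i => u i + v i) = mean u + mean v := by
  simp [mean, Finset.sum_add_distrib]

theorem mean_sub {n : ℕ} {V : Type*} [AddCommGroup V] [Module ℝ V] (u v : Fin n → V) :
    mean (fun i => u i - v i) = mean u - mean v := by
  simp [mean, Finset.sum_sub_distrib, smul_sub]

theorem mean_smul {n : ℕ} {V : Type*} [AddCommGroup V] [Module ℝ V] (c : ℝ) (u : Fin n → V) :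
    mean (fun i => c • u i) = c • mean u := by
  simp only [mean, ← Finset.smul_sum, smul_comm c]

theorem mean_mul {n : ℕ} (c : ℝ) (u : Fin n → ℝ) : mean (fun i => c * u i) = c * mean u :=
  mean_smul c u

theorem mean_le {n : ℕ} {u v : Fin n → ℝ} (h : ∀ i, u i ≤ v i) : mean u ≤ mean v := by
  simp only [mean_real]
  gcongr
  exact h _

theorem mean_nonneg {n : ℕ} {u : Fin n → ℝ} (h : ∀ i, 0 ≤ u i) : 0 ≤ mean u := by
  rw [mean_real]
  exact div_nonneg (Finset.sum_nonneg fun i _ => h i) (Nat.cast_nonneg n)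

theorem inner_mean_left {n : ℕ} (u : Fin n → Vec d) (v : Vec d) :
    inner ℝ (mean u) v = mean fun i => inner ℝ (u i) v := by
  simp [mean, inner_smul_left, sum_inner]

/-- Jensen's inequality, read off from the nonnegativity of the variance about the mean. -/
theorem norm_mean_sq_le {n : ℕ} (hn : 0 < n) (u : Fin n → Vec d) :
    ‖mean u‖ ^ 2 ≤ mean fun i => ‖u i‖ ^ 2 := by
  have h : ∀ i, 0 ≤ ‖u i - mean u‖ ^ 2 := fun i => by positivity
  have := mean_nonneg h
  simp only [norm_sub_sq_real, mean_add, mean_sub, mean_mul, ← inner_mean_left, mean_const hn,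
    real_inner_self_eq_norm_sq] at this
  linarith

/-! ### Strongly convex functions -/

theorem StrongConvexOn.gradient_le {F : Vec d → ℝ} {μ : ℝ} (hc : StrongConvexOn Set.univ μ F)
    (hF : Differentiable ℝ F) (x y : Vec d) :
    F x + inner ℝ (gradient F x) (y - x) + μ / 2 * ‖y - x‖ ^ 2 ≤ F y := by
  have h := strongConvexOn_iff_convex.1 hc
  have hg : ∀ x, HasGradientAt (fun x => F x - μ / 2 * ‖x‖ ^ 2) (gradient F x - μ • x) x := by
    intro x
    have := HasGradientAt.add (hF x).hasGradientAt (hasGradientAt_half_normSq (-μ) 0 x)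
    convert this using 1
    · ext z; simp; ring
    · simp [sub_eq_add_neg]
  have := ConvexOn.gradient_le h (fun x => (hg x).differentiableAt) x y
  rw [(hg x).gradient, inner_sub_left, inner_smul_left] at this
  have e : ‖y‖ ^ 2 = ‖x‖ ^ 2 + 2 * inner ℝ x (y - x) + ‖y - x‖ ^ 2 := by
    rw [← norm_add_sq_real]; simp
  simp only [conj_trivial] at this
  rw [e] at this
  linarith

/-! ### Minimizers, and sums of smooth functions -/

theorem exists_minimizer {F : Vec d → ℝ} {μ : ℝ} (hμ : 0 < μ)
    (hF : Differentiable ℝ F)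
    (hc : ∀ x y, F x + inner ℝ (gradient F x) (y - x) + μ / 2 * ‖y - x‖ ^ 2 ≤ F y) :
    ∃ x, ∀ y, F x ≤ F y := by
  refine hF.continuous.exists_forall_le ?_
  have h : ∀ y, F 0 + (μ / 2 * ‖y‖ - ‖gradient F 0‖) * ‖y‖ ≤ F y := by
    intro y
    have h1 := hc 0 y
    have h2 := neg_le_of_abs_le (abs_real_inner_le_norm (gradient F 0) (y - 0))
    simp only [sub_zero] at h1 h2
    nlinarith
  refine Filter.tendsto_atTop_mono h (Filter.tendsto_atTop_add_const_left _ _ ?_)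
  have hn : Filter.Tendsto (fun y : Vec d => ‖y‖) (Filter.cocompact _) Filter.atTop :=
    tendsto_norm_cocompact_atTop
  refine Filter.Tendsto.atTop_mul_atTop₀ ?_ hn
  exact Filter.tendsto_atTop_add_const_right _ (-‖gradient F 0‖) (hn.const_mul_atTop (half_pos hμ))

theorem argmin_le {F : Vec d → ℝ} (h : ∃ x, ∀ y, F x ≤ F y) (y : Vec d) : F (argmin F) ≤ F y :=
  Classical.epsilon_spec h y

theorem iInf_eq_argmin {F : Vec d → ℝ} (h : ∃ x, ∀ y, F x ≤ F y) : ⨅ x, F x = F (argmin F) :=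
  le_antisymm (ciInf_le ⟨F (argmin F), by rintro _ ⟨y, rfl⟩; exact argmin_le h y⟩ _)
    (le_ciInf fun y => argmin_le h y)

theorem gradient_argmin {F : Vec d → ℝ} (h : ∃ x, ∀ y, F x ≤ F y) : gradient F (argmin F) = 0 := by
  have : IsLocalMin F (argmin F) := Filter.Eventually.of_forall fun y => argmin_le h y
  rw [gradient, this.fderiv_eq_zero, map_zero]

theorem IsSmooth.continuous_gradient {L : ℝ} {F : Vec d → ℝ} (hF : IsSmooth L F) :
    Continuous (gradient F) :=
  (LipschitzWith.of_dist_le_mul (K := L.toNNReal) fun x y => by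
    rw [dist_eq_norm, dist_eq_norm]
    exact (hF.2 x y).trans (by gcongr; exact Real.le_coe_toNNReal L)).continuous

theorem IsSmooth.add {L L' : ℝ} {F H : Vec d → ℝ} (hF : IsSmooth L F) (hH : IsSmooth L' H) :
    IsSmooth (L + L') (fun x => F x + H x) := by
  have hg := fun x => HasGradientAt.add (hF.hasGradientAt x) (hH.hasGradientAt x)
  refine ⟨fun x => (hg x).differentiableAt, fun x y => ?_⟩
  rw [(hg x).gradient, (hg y).gradient, add_sub_add_comm, add_mul]
  exact (norm_add_le _ _).trans (add_le_add (hF.2 x y) (hH.2 x y))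

theorem isSmooth_half_normSq {κ : ℝ} (hκ : 0 ≤ κ) (y : Vec d) :
    IsSmooth κ (fun x => κ / 2 * ‖x - y‖ ^ 2) := by
  have hg := hasGradientAt_half_normSq κ y
  refine ⟨fun x => (hg x).differentiableAt, fun x z => ?_⟩
  rw [(hg x).gradient, (hg z).gradient, ← smul_sub, norm_smul, Real.norm_of_nonneg hκ]
  simp

theorem IsSmooth.nonneg {L : ℝ} {F : Vec d → ℝ} (hF : IsSmooth L F) {x y : Vec d} (h : x ≠ y) :
    0 ≤ L :=
  nonneg_of_mul_nonneg_left ((norm_nonneg _).trans (hF.2 x y)) (norm_pos_iff.2 (sub_ne_zero.2 h))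

end ECCatalyst

end

noncomputable section

namespace ECCatalyst

variable {d : ℕ}

/-! ### Averages over independent uniform indices -/

/-- The average of a function over all choices of one index per node. -/
def avg {n m : ℕ} (H : (Fin n → Fin m) → ℝ) : ℝ := (∑ k, H k) / Fintype.card (Fin n → Fin m)

/-- Swapping coordinate `τ` with the extra index is an involution on pairs (tuple, index). Hence
resampling one coordinate leaves an average unchanged, which is the form of independence used below.
-/
theorem sum_sum_update {n m : ℕ} (τ : Fin n) (H : (Fin n → Fin m) → ℝ) :
    ∑ k, ∑ j, H (Function.update k τ j) = m * ∑ k, H k := by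
  have hinv : Function.Involutive
      (fun q : (Fin n → Fin m) × Fin m => (Function.update q.1 τ q.2, q.1 τ)) := by
    intro q; simp
  have h := Equiv.sum_comp hinv.toPerm (fun q => H q.1)
  rw [← Fintype.sum_prod_type' (fun k j => H (Function.update k τ j))]
  simp only [Function.Involutive.coe_toPerm] at h
  rw [h, Fintype.sum_prod_type]
  simp [Finset.mul_sum]

section Averages

variable {n m : ℕ}

theorem card_index_ne_zero (hm : 0 < m) : (Fintype.card (Fin n → Fin m) : ℝ) ≠ 0 := by
  have : 0 < Fintype.card (Fin n → Fin m) := by simp; positivity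
  positivity

theorem avg_eq_avg_mean (hm : 0 < m) (τ : Fin n) (H : (Fin n → Fin m) → ℝ) :
    avg H = avg fun k => mean fun j => H (Function.update k τ j) := by
  have h := sum_sum_update τ H
  have h' : (m : ℝ) ≠ 0 := by positivity
  simp only [avg, mean_real, ← Finset.sum_div, h]
  field_simp

theorem avg_const (hm : 0 < m) (c : ℝ) : avg (fun _ : Fin n → Fin m => c) = c := by
  rw [avg, Finset.sum_const, nsmul_eq_mul, Finset.card_univ, mul_div_cancel_left₀]
  exact card_index_ne_zero hm

theorem avg_marginal (hm : 0 < m) (τ : Fin n) (φ : Fin m → ℝ) :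
    avg (fun k : Fin n → Fin m => φ (k τ)) = mean φ := by
  rw [avg_eq_avg_mean hm τ]
  simp [avg_const hm]

theorem avg_add (H H' : (Fin n → Fin m) → ℝ) : avg (fun k => H k + H' k) = avg H + avg H' := by
  simp [avg, Finset.sum_add_distrib, add_div]

theorem avg_sub (H H' : (Fin n → Fin m) → ℝ) : avg (fun k => H k - H' k) = avg H - avg H' := by
  simp [avg, Finset.sum_sub_distrib, sub_div]

theorem avg_mul (c : ℝ) (H : (Fin n → Fin m) → ℝ) : avg (fun k => c * H k) = c * avg H := by
  simp only [avg, ← Finset.mul_sum, mul_div_assoc]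

theorem avg_mean {l : ℕ} (H : Fin l → (Fin n → Fin m) → ℝ) :
    avg (fun k => mean fun i => H i k) = mean fun i => avg (H i) := by
  simp only [avg, mean_real, ← Finset.sum_div]
  rw [Finset.sum_comm]
  field_simp

theorem avg_inner_marginal (hm : 0 < m) (τ : Fin n) (c : Vec d) (u : Fin m → Vec d) :
    avg (fun k : Fin n → Fin m => inner ℝ c (u (k τ))) = inner ℝ c (mean u) := by
  rw [avg_marginal hm τ fun i => inner ℝ c (u i), real_inner_comm, inner_mean_left]
  simp only [real_inner_comm]

/-- Resampling coordinate `τ` alone replaces the first factor by its mean without touching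
coordinate `σ`; the second factor is then averaged through its marginal. -/
theorem avg_inner (hm : 0 < m) {τ σ : Fin n} (h : τ ≠ σ) (u v : Fin m → Vec d) :
    avg (fun k : Fin n → Fin m => inner ℝ (u (k τ)) (v (k σ))) = inner ℝ (mean u) (mean v) := by
  rw [avg_eq_avg_mean hm τ]
  simp only [Function.update_self, Function.update_of_ne h.symm, ← inner_mean_left]
  exact avg_inner_marginal hm σ _ _

theorem mean_norm_sub_mean_sq (hm : 0 < m) (u : Fin m → Vec d) :
    mean (fun i => ‖u i - mean u‖ ^ 2) ≤ mean fun i => ‖u i‖ ^ 2 := by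
  simp only [norm_sub_sq_real, mean_add, mean_sub, mean_mul, ← inner_mean_left, mean_const hm,
    real_inner_self_eq_norm_sq]
  nlinarith [sq_nonneg ‖mean u‖]

/-- Second moment of a sampled vector. -/
theorem mean_norm_add_smul_sq_le (hm : 0 < m) (η : ℝ) (c : Vec d) (u : Fin m → Vec d) :
    mean (fun i => ‖c + η • u i‖ ^ 2)
      ≤ ‖c + η • mean u‖ ^ 2 + η ^ 2 * mean fun i => ‖u i‖ ^ 2 := by
  have e : ∀ i, ‖c + η • u i‖ ^ 2 = ‖c + η • mean u‖ ^ 2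
      + (2 * η) * (inner ℝ (u i) (c + η • mean u) - inner ℝ (mean u) (c + η • mean u))
      + η ^ 2 * ‖u i - mean u‖ ^ 2 := by
    intro i
    have : c + η • u i = (c + η • mean u) + η • (u i - mean u) := by module
    rw [this, norm_add_sq_real, norm_smul, inner_smul_right, ← inner_sub_left, mul_pow,
      Real.norm_eq_abs, sq_abs, real_inner_comm (c + η • mean u)]
    ring
  simp only [e, mean_add, mean_sub, mean_mul, ← inner_mean_left, mean_const hm]
  have := mean_norm_sub_mean_sq hm u
  have h2 : η ^ 2 * mean (fun i => ‖u i - mean u‖ ^ 2) ≤ η ^ 2 * mean fun i => ‖u i‖ ^ 2 := by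
    gcongr
  linarith

/-- The variance of a mean of independently sampled vectors is smaller by the factor `n`. -/
theorem avg_norm_sub_smul_mean_sq_le (hn : 0 < n) (hm : 0 < m) (η : ℝ) (c : Vec d)
    (u : Fin n → Fin m → Vec d) :
    avg (fun k => ‖c - η • mean fun τ => u τ (k τ)‖ ^ 2)
      ≤ ‖c - η • mean fun τ => mean (u τ)‖ ^ 2
        + η ^ 2 / n * mean fun τ => mean fun i => ‖u τ i‖ ^ 2 := by
  set C := c - η • mean fun τ => mean (u τ) with hC
  -- For the centred samples, products between distinct nodes average to zero. Only `n` of the `n ^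
  -- 2` products survive, whence the factor `1/n`.
  let ζ : Fin n → Fin m → Vec d := fun τ i => u τ i - mean (u τ)
  have hζ : ∀ τ, mean (ζ τ) = 0 := by
    intro τ; simp only [ζ, mean_sub, mean_const hm, sub_self]
  have e : ∀ k : Fin n → Fin m, ‖c - η • mean fun τ => u τ (k τ)‖ ^ 2
      = ‖C‖ ^ 2 - 2 * η * (mean fun τ => inner ℝ C (ζ τ (k τ)))
        + η ^ 2 * ((1 / n : ℝ) * mean fun τ => ∑ σ, inner ℝ (ζ τ (k τ)) (ζ σ (k σ))) := by
    intro k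
    have h1 : c - η • (mean fun τ => u τ (k τ)) = C - η • mean fun τ => ζ τ (k τ) := by
      simp only [hC, ζ, mean_sub, smul_sub]; abel
    have h2 : (1 / n : ℝ) * (mean fun τ => ∑ σ, inner ℝ (ζ τ (k τ)) (ζ σ (k σ)))
        = ‖mean fun τ => ζ τ (k τ)‖ ^ 2 := by
      rw [← real_inner_self_eq_norm_sq, inner_mean_left, ← mean_mul]
      congr 1; ext τ
      rw [real_inner_comm, inner_mean_left, mean, smul_eq_mul]
      simp only [real_inner_comm]
    have h3 : (mean fun τ => inner ℝ C (ζ τ (k τ))) = inner ℝ C (mean fun τ => ζ τ (k τ)) := by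
      rw [real_inner_comm, inner_mean_left]; simp only [real_inner_comm]
    rw [h1, h2, h3, norm_sub_sq_real, norm_smul, inner_smul_right, mul_pow, Real.norm_eq_abs,
      sq_abs]
    ring
  have h4 : ∀ τ, avg (fun k : Fin n → Fin m => ∑ σ, inner ℝ (ζ τ (k τ)) (ζ σ (k σ)))
      = mean fun i => ‖ζ τ i‖ ^ 2 := by
    intro τ
    have : avg (fun k : Fin n → Fin m => ∑ σ, inner ℝ (ζ τ (k τ)) (ζ σ (k σ)))
        = ∑ σ, avg (fun k : Fin n → Fin m => inner ℝ (ζ τ (k τ)) (ζ σ (k σ))) := by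
      simp only [avg, ← Finset.sum_div]; rw [Finset.sum_comm]
    rw [this, Finset.sum_eq_single τ]
    · simp only [real_inner_self_eq_norm_sq]
      exact avg_marginal hm τ fun i => ‖ζ τ i‖ ^ 2
    · intro σ _ h
      rw [avg_inner hm h.symm, hζ, inner_zero_left]
    · simp
  simp only [e, avg_add, avg_sub, avg_mul, avg_const hm, avg_mean, h4]
  simp only [avg_inner_marginal hm, hζ, inner_zero_right, mean_const hn]
  have h5 : (mean fun τ => mean fun i => ‖ζ τ i‖ ^ 2) ≤ mean fun τ => mean fun i => ‖u τ i‖ ^ 2 :=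
    mean_le fun τ => mean_norm_sub_mean_sq hm (u τ)
  have h6 : η ^ 2 / n * (mean fun τ => mean fun i => ‖ζ τ i‖ ^ 2)
      ≤ η ^ 2 / n * mean fun τ => mean fun i => ‖u τ i‖ ^ 2 := by gcongr
  calc _ = ‖C‖ ^ 2 + η ^ 2 / n * (mean fun τ => mean fun i => ‖ζ τ i‖ ^ 2) := by ring
    _ ≤ _ := by linarith

theorem lintegral_uniform_index (hm : 0 < m) {H : (Fin n → Fin m) → ℝ} (hH : ∀ k, 0 ≤ H k) :
    ∫⁻ k, ENNReal.ofReal (H k) ∂(Measure.pi fun _ : Fin n => uniformOn (Set.univ : Set (Fin m)))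
      = ENNReal.ofReal (avg H) := by
  have : Nonempty (Fin m) := ⟨⟨0, hm⟩⟩
  have : IsProbabilityMeasure (uniformOn (Set.univ : Set (Fin m))) :=
    isProbabilityMeasure_uniformOn Set.finite_univ Set.univ_nonempty
  rw [lintegral_fintype, avg, div_eq_mul_inv, ENNReal.ofReal_mul (Finset.sum_nonneg fun k _ => hH k),
    ENNReal.ofReal_sum_of_nonneg fun k _ => hH k, Finset.sum_mul]
  refine Finset.sum_congr rfl fun k _ => ?_
  congr 1
  have hc : (0 : ℝ) < m := by positivity
  rw [Measure.pi_singleton]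
  simp only [uniformOn_univ, Measure.count_singleton, Fintype.card_fin, Finset.prod_const,
    Finset.card_univ, Fintype.card_fun, Nat.cast_pow]
  rw [ENNReal.ofReal_inv_of_pos (by positivity), ENNReal.ofReal_pow hc.le, ENNReal.ofReal_natCast,
    one_div, ENNReal.inv_pow]

end Averages

end ECCatalyst

end

noncomputable section

namespace ECCatalyst

variable {d n m : ℕ} {S S₁ : Type*}

/-! ### The subproblem of the inner loop -/

/-- The average of all component functions. -/
def objective (F : Fin n → Fin m → Vec d → ℝ) : Vec d → ℝ := mean fun τ => mean (F τ)

/-- A finite sum of smooth convex functions, with strongly convex average. -/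
structure Subproblem (F : Fin n → Fin m → Vec d → ℝ) (AF Ab A μ : ℝ) : Prop where
  n_pos : 0 < n
  m_pos : 0 < m
  convex : ∀ τ i, ConvexOn ℝ Set.univ (F τ i)
  smooth_comp : ∀ τ i, IsSmooth A (F τ i)
  smooth_local : ∀ τ, IsSmooth Ab (mean (F τ))
  smooth_avg : IsSmooth AF (objective F)
  strong : ∀ x y, objective F x + inner ℝ (gradient (objective F) x) (y - x)
    + μ / 2 * ‖y - x‖ ^ 2 ≤ objective F y
  μ_pos : 0 < μ
  μ_le : μ ≤ AF
  A_pos : 0 < A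
  Ab_pos : 0 < Ab

/-- The suboptimality of `x`. -/
def subopt (F : Fin n → Fin m → Vec d → ℝ) (x : Vec d) : ℝ :=
  objective F x - objective F (argmin (objective F))

theorem ConvexOn.mean {l : ℕ} {F : Fin l → Vec d → ℝ} (h : ∀ i, ConvexOn ℝ Set.univ (F i)) :
    ConvexOn ℝ Set.univ (mean F) := by
  have : ConvexOn ℝ Set.univ (∑ i, F i) := by
    classical
    induction (Finset.univ : Finset (Fin l)) using Finset.induction_on with
    | empty => exact convexOn_const (0 : ℝ) convex_univ
    | insert a s ha ih => rw [Finset.sum_insert ha]; exact (h a).add ih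
  exact this.smul (by positivity)

theorem norm_sub_sq_le_add (a b c : Vec d) : ‖a - b‖ ^ 2 ≤ 2 * ‖a - c‖ ^ 2 + 2 * ‖b - c‖ ^ 2 := by
  have h := norm_sub_le_norm_sub_add_norm_sub a c b
  rw [norm_sub_rev c b] at h
  nlinarith [norm_nonneg (a - b), sq_nonneg (‖a - c‖ - ‖b - c‖)]

namespace Subproblem

variable {F : Fin n → Fin m → Vec d → ℝ} {AF Ab A μ : ℝ} (hF : Subproblem F AF Ab A μ)
include hF

theorem AF_pos : 0 < AF := hF.μ_pos.trans_le hF.μ_le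

theorem exists_min : ∃ x, ∀ y, objective F x ≤ objective F y :=
  exists_minimizer hF.μ_pos hF.smooth_avg.1 hF.strong

theorem gradient_local (τ : Fin n) (x : Vec d) :
    gradient (mean (F τ)) x = mean fun i => gradient (F τ i) x :=
  (HasGradientAt.mean fun i => (hF.smooth_comp τ i).hasGradientAt x).gradient

theorem gradient_objective (x : Vec d) :
    gradient (objective F) x = mean fun τ => gradient (mean (F τ)) x :=
  (HasGradientAt.mean fun τ => (hF.smooth_local τ).hasGradientAt x).gradient

theorem convex_local (τ : Fin n) : ConvexOn ℝ Set.univ (mean (F τ)) := ConvexOn.mean (hF.convex τ)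

theorem convex_objective : ConvexOn ℝ Set.univ (objective F) := ConvexOn.mean hF.convex_local

theorem gradient_min : gradient (objective F) (argmin (objective F)) = 0 :=
  gradient_argmin hF.exists_min

theorem subopt_nonneg (x : Vec d) : 0 ≤ subopt F x := sub_nonneg.2 (argmin_le hF.exists_min x)

theorem half_normSq_le_subopt (x : Vec d) :
    μ / 2 * ‖x - argmin (objective F)‖ ^ 2 ≤ subopt F x := by
  have := hF.strong (argmin (objective F)) x
  rw [hF.gradient_min, inner_zero_left] at this
  simp only [subopt]; linarith

theorem subopt_le_half_normSq (x : Vec d) :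
    subopt F x ≤ AF / 2 * ‖x - argmin (objective F)‖ ^ 2 := by
  have := hF.smooth_avg.le_quadratic (argmin (objective F)) x
  rw [hF.gradient_min, inner_zero_left] at this
  simp only [subopt]; linarith

theorem subopt_add_le_inner (x : Vec d) :
    subopt F x + μ / 2 * ‖x - argmin (objective F)‖ ^ 2
      ≤ inner ℝ (gradient (objective F) x) (x - argmin (objective F)) := by
  have := hF.strong x (argmin (objective F))
  rw [← neg_sub x, inner_neg_right, norm_neg] at this
  simp only [subopt]; linarith

theorem gradient_normSq_le (x : Vec d) :
    ‖gradient (objective F) x‖ ^ 2 ≤ 2 * AF * subopt F x := by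
  have := hF.smooth_avg.gradient_sub_sq_le hF.AF_pos hF.convex_objective x (argmin (objective F))
  rwa [hF.gradient_min, inner_zero_left, sub_zero, sub_zero] at this

/-- Cocoercivity bounds each square by the Bregman divergence of a local function from the
minimizer. These divergences average to that of the objective, which is the suboptimality because
the gradient there vanishes. The bound for the components has the same reason. -/
theorem mean_local_gradient_le_aux (x : Vec d) :
    (mean fun τ => ‖gradient (mean (F τ)) x - gradient (mean (F τ)) (argmin (objective F))‖ ^ 2)
      ≤ 2 * Ab * subopt F x := by
  refine (mean_le fun τ =>
    (hF.smooth_local τ).gradient_sub_sq_le hF.Ab_pos (hF.convex_local τ) _ _).trans ?_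
  simp only [mean_mul, mean_sub, ← inner_mean_left]
  rw [← hF.gradient_objective, hF.gradient_min, inner_zero_left, sub_zero, ← mean_apply,
    ← mean_apply]
  rfl

theorem mean_comp_gradient_le_aux (x : Vec d) :
    (mean fun τ => mean fun i =>
      ‖gradient (F τ i) x - gradient (F τ i) (argmin (objective F))‖ ^ 2)
      ≤ 2 * A * subopt F x := by
  refine (mean_le fun τ => mean_le fun i =>
    (hF.smooth_comp τ i).gradient_sub_sq_le hF.A_pos (hF.convex τ i) _ _).trans ?_
  simp only [mean_mul, mean_sub, ← inner_mean_left]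
  simp only [← hF.gradient_local, ← hF.gradient_objective, hF.gradient_min, inner_zero_left,
    sub_zero, ← mean_apply]
  rfl

theorem mean_local_gradient_le (x w : Vec d) :
    (mean fun τ => ‖gradient (mean (F τ)) x - gradient (mean (F τ)) w‖ ^ 2)
      ≤ 4 * Ab * (subopt F x + subopt F w) := by
  refine (mean_le fun τ => norm_sub_sq_le_add _ _
    (gradient (mean (F τ)) (argmin (objective F)))).trans ?_
  rw [mean_add, mean_mul, mean_mul]
  have h1 := hF.mean_local_gradient_le_aux x
  have h2 := hF.mean_local_gradient_le_aux w
  linarith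

theorem mean_comp_gradient_le (x w : Vec d) :
    (mean fun τ => mean fun i => ‖gradient (F τ i) x - gradient (F τ i) w‖ ^ 2)
      ≤ 4 * A * (subopt F x + subopt F w) := by
  refine (mean_le fun τ => mean_le fun i => norm_sub_sq_le_add _ _
    (gradient (F τ i) (argmin (objective F)))).trans ?_
  simp only [mean_add, mean_mul]
  have h1 := hF.mean_comp_gradient_le_aux x
  have h2 := hF.mean_comp_gradient_le_aux w
  linarith

end Subproblem

/-! ### The expected potential after one iteration -/

/-- A weighted sum of the error terms of EC-LSVRG. -/
def potential (F : Fin n → Fin m → Vec d → ℝ) (a b c : ℝ) (s : InnerState d n) : ℝ :=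
  ‖s.x - mean s.e - argmin (objective F)‖ ^ 2 + a * mean (fun τ => ‖s.e τ‖ ^ 2)
    + b * mean (fun τ => ‖s.h τ - gradient (mean (F τ)) s.w‖ ^ 2) + c * subopt F s.w

/-! ### The law of one iteration and its marginals -/

section Projections

variable [MeasurableSpace S] [MeasurableSpace S₁] {μ : Measure S} {μ₁ : Measure S₁}
  [IsProbabilityMeasure μ] [IsProbabilityMeasure μ₁]

/-- The law of the coin. -/
def coinLaw (p : ℝ) : Measure Bool :=
  ENNReal.ofReal p • Measure.dirac true + ENNReal.ofReal (1 - p) • Measure.dirac false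

theorem isProbabilityMeasure_coinLaw {p : ℝ} (h0 : 0 ≤ p) (h1 : p ≤ 1) :
    IsProbabilityMeasure (coinLaw p) := by
  constructor
  simp [coinLaw]
  rw [← ENNReal.ofReal_add h0 (sub_nonneg.2 h1)]
  simp

theorem lintegral_coinLaw (p : ℝ) (f : Bool → ℝ≥0∞) :
    ∫⁻ u, f u ∂(coinLaw p) = ENNReal.ofReal p * f true + ENNReal.ofReal (1 - p) * f false := by
  rw [coinLaw, lintegral_add_measure, lintegral_smul_measure, lintegral_smul_measure,
    lintegral_dirac, lintegral_dirac]
  rfl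

/-- The law of the sampled indices. -/
def indexLaw (n m : ℕ) : Measure (Fin n → Fin m) :=
  Measure.pi fun _ => uniformOn Set.univ

theorem isProbabilityMeasure_indexLaw (n : ℕ) (hm : 0 < m) :
    IsProbabilityMeasure (indexLaw n m) := by
  have : Nonempty (Fin m) := ⟨⟨0, hm⟩⟩
  have : IsProbabilityMeasure (uniformOn (Set.univ : Set (Fin m))) :=
    isProbabilityMeasure_uniformOn Set.finite_univ Set.univ_nonempty
  unfold indexLaw
  infer_instance

variable (μ μ₁)

theorem isProbabilityMeasure_sampleLaw (hm : 0 < m) {p : ℝ} (h0 : 0 ≤ p) (h1 : p ≤ 1) :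
    IsProbabilityMeasure (sampleLaw n m μ μ₁ p) := by
  have := isProbabilityMeasure_coinLaw h0 h1
  have := isProbabilityMeasure_indexLaw n hm
  change IsProbabilityMeasure ((Measure.pi fun _ => μ).prod ((Measure.pi fun _ => μ₁).prod
    ((indexLaw n m).prod (coinLaw p))))
  infer_instance

theorem measurePreserving_index (hm : 0 < m) {p : ℝ} (h0 : 0 ≤ p) (h1 : p ≤ 1) :
    MeasurePreserving (fun r : Sample n m S S₁ => r.2.2.1) (sampleLaw n m μ μ₁ p)
      (indexLaw n m) := by
  have := isProbabilityMeasure_coinLaw h0 h1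
  have := isProbabilityMeasure_indexLaw n hm
  exact (measurePreserving_fst (μ := indexLaw n m) (ν := coinLaw p)).comp
    ((measurePreserving_snd (μ := Measure.pi fun _ : Fin n => μ₁)
      (ν := (indexLaw n m).prod (coinLaw p))).comp
    (measurePreserving_snd (μ := Measure.pi fun _ : Fin n => μ)
      (ν := (Measure.pi fun _ : Fin n => μ₁).prod ((indexLaw n m).prod (coinLaw p)))))

theorem measurePreserving_coin (hm : 0 < m) {p : ℝ} (h0 : 0 ≤ p) (h1 : p ≤ 1) :
    MeasurePreserving (fun r : Sample n m S S₁ => r.2.2.2) (sampleLaw n m μ μ₁ p)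
      (coinLaw p) := by
  have := isProbabilityMeasure_coinLaw h0 h1
  have := isProbabilityMeasure_indexLaw n hm
  exact (measurePreserving_snd (μ := indexLaw n m) (ν := coinLaw p)).comp
    ((measurePreserving_snd (μ := Measure.pi fun _ : Fin n => μ₁)
      (ν := (indexLaw n m).prod (coinLaw p))).comp
    (measurePreserving_snd (μ := Measure.pi fun _ : Fin n => μ)
      (ν := (Measure.pi fun _ : Fin n => μ₁).prod ((indexLaw n m).prod (coinLaw p)))))

theorem measurePreserving_seed_index (hm : 0 < m) {p : ℝ} (h0 : 0 ≤ p) (h1 : p ≤ 1) (τ : Fin n) :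
    MeasurePreserving (fun r : Sample n m S S₁ => (r.1 τ, r.2.2.1)) (sampleLaw n m μ μ₁ p)
      (μ.prod (indexLaw n m)) := by
  have := isProbabilityMeasure_coinLaw h0 h1
  have := isProbabilityMeasure_indexLaw n hm
  exact (measurePreserving_eval (fun _ : Fin n => μ) τ).prod
    ((measurePreserving_fst (μ := indexLaw n m) (ν := coinLaw p)).comp
      (measurePreserving_snd (μ := Measure.pi fun _ : Fin n => μ₁)
        (ν := (indexLaw n m).prod (coinLaw p))))

theorem measurePreserving_seed_coin (hm : 0 < m) {p : ℝ} (h0 : 0 ≤ p) (h1 : p ≤ 1) (τ : Fin n) :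
    MeasurePreserving (fun r : Sample n m S S₁ => (r.2.1 τ, r.2.2.2)) (sampleLaw n m μ μ₁ p)
      (μ₁.prod (coinLaw p)) := by
  have := isProbabilityMeasure_coinLaw h0 h1
  have := isProbabilityMeasure_indexLaw n hm
  exact ((measurePreserving_eval (fun _ : Fin n => μ₁) τ).prod
    (measurePreserving_snd (μ := indexLaw n m) (ν := coinLaw p))).comp
      (measurePreserving_snd (μ := Measure.pi fun _ : Fin n => μ)
        (ν := (Measure.pi fun _ : Fin n => μ₁).prod ((indexLaw n m).prod (coinLaw p))))

end Projections

theorem ofReal_mean {l : ℕ} {u : Fin l → ℝ} (h : ∀ i, 0 ≤ u i) :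
    ENNReal.ofReal (mean u) = ENNReal.ofReal (1 / l) * ∑ i, ENNReal.ofReal (u i) := by
  rw [mean, smul_eq_mul, ENNReal.ofReal_mul (by positivity),
    ENNReal.ofReal_sum_of_nonneg fun i _ => h i]

theorem lintegral_mean_le {α : Type*} [MeasurableSpace α] {ν : Measure α} {l : ℕ}
    {u : Fin l → α → ℝ} (hu : ∀ i, Measurable (u i)) (h : ∀ i a, 0 ≤ u i a) {c : Fin l → ℝ}
    (hc : ∀ i, 0 ≤ c i) (hle : ∀ i, ∫⁻ a, ENNReal.ofReal (u i a) ∂ν ≤ ENNReal.ofReal (c i)) :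
    ∫⁻ a, ENNReal.ofReal (mean fun i => u i a) ∂ν ≤ ENNReal.ofReal (mean c) := by
  simp only [ofReal_mean fun i => h i _, ofReal_mean hc]
  rw [lintegral_const_mul _ (Finset.measurable_fun_sum _ fun i _ => (hu i).ennreal_ofReal),
    lintegral_finsetSum _ fun i _ => (hu i).ennreal_ofReal]
  gcongr
  exact hle _

end ECCatalyst

end

noncomputable section

namespace ECCatalyst

variable {d n m : ℕ} {S S₁ : Type*}

/-! ### Expectations of the four terms of the potential -/

/-- The coin moves the reference gradient by `D` with probability `p`. Young's inequality charges
`δ₁ / 2` of the cross term to `z`, half of what compression by `Q₁` gains. -/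
theorem two_point_norm_sq_le {p δ₁ : ℝ} (hp : 0 ≤ p) (hδ : 0 < δ₁) (z D : Vec d) :
    p * ‖z - D‖ ^ 2 + (1 - p) * ‖z‖ ^ 2
      ≤ (1 + δ₁ / 2) * ‖z‖ ^ 2 + p * (1 + 2 * p / δ₁) * ‖D‖ ^ 2 := by
  have h1 : ‖z - D‖ ^ 2 ≤ (‖z‖ + ‖D‖) ^ 2 := by gcongr; exact norm_sub_le _ _
  have h2 : p * ‖z - D‖ ^ 2 ≤ p * (‖z‖ + ‖D‖) ^ 2 := by gcongr
  have h3 : 2 * p * (‖z‖ * ‖D‖) ≤ δ₁ / 2 * ‖z‖ ^ 2 + 2 * p / δ₁ * p * ‖D‖ ^ 2 := by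
    have := sq_nonneg (δ₁ * ‖z‖ - 2 * p * ‖D‖)
    have e : δ₁ / 2 * ‖z‖ ^ 2 + 2 * p / δ₁ * p * ‖D‖ ^ 2 - 2 * p * (‖z‖ * ‖D‖)
        = (δ₁ * ‖z‖ - 2 * p * ‖D‖) ^ 2 / (2 * δ₁) := by field_simp; ring
    have : 0 ≤ (δ₁ * ‖z‖ - 2 * p * ‖D‖) ^ 2 / (2 * δ₁) := by positivity
    linarith
  nlinarith

/-- The compressed messages cancel from the new `x - mean e`: what is missing in `x` is stored in
`e`. They survive only as the compression residual in the error term. The first square is arranged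
as a fixed vector minus the sampled gradient differences, ready for the variance bound. -/
theorem potential_step_eq {F : Fin n → Fin m → Vec d → ℝ} (Q : S → Vec d → Vec d)
    (Q₁ : S₁ → Vec d → Vec d) (η a b c : ℝ) (s : InnerState d n) (r : Sample n m S S₁) :
    potential F a b c (ecLsvrgStep F Q Q₁ η r s)
      = ‖(s.x - mean s.e - argmin (objective F) - η • mean fun τ => gradient (mean (F τ)) s.w)
          - η • mean fun τ => (gradient (F τ (r.2.2.1 τ)) s.x - gradient (F τ (r.2.2.1 τ)) s.w)‖ ^ 2
        + a * mean (fun τ => ‖(s.e τ + η • (gradient (mean (F τ)) s.w - s.h τ)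
              + η • (gradient (F τ (r.2.2.1 τ)) s.x - gradient (F τ (r.2.2.1 τ)) s.w))
            - Q (r.1 τ) (s.e τ + η • (gradient (mean (F τ)) s.w - s.h τ)
              + η • (gradient (F τ (r.2.2.1 τ)) s.x - gradient (F τ (r.2.2.1 τ)) s.w))‖ ^ 2)
        + b * mean (fun τ => ‖(Q₁ (r.2.1 τ) (gradient (mean (F τ)) s.w - s.h τ)
              - (gradient (mean (F τ)) s.w - s.h τ))
            - (gradient (mean (F τ)) (if r.2.2.2 then s.x else s.w)
              - gradient (mean (F τ)) s.w)‖ ^ 2)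
        + c * subopt F (if r.2.2.2 then s.x else s.w) := by
  have e1 : ∀ τ, η • (gradient (F τ (r.2.2.1 τ)) s.x - gradient (F τ (r.2.2.1 τ)) s.w
      + gradient (mean (F τ)) s.w - s.h τ) + s.e τ
      = s.e τ + η • (gradient (mean (F τ)) s.w - s.h τ)
              + η • (gradient (F τ (r.2.2.1 τ)) s.x - gradient (F τ (r.2.2.1 τ)) s.w) := by
    intro τ; module
  unfold potential ecLsvrgStep
  simp only [e1]
  congr 1
  congr 1
  · congr 1
    · congr 2
      simp only [mean_add, mean_sub, mean_smul]
      module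
    · congr 2
      ext τ
      congr 2
      module
  · congr 2
    ext τ
    congr 2
    abel

variable [MeasurableSpace S] [MeasurableSpace S₁] {μ : Measure S} {μ₁ : Measure S₁}
  [IsProbabilityMeasure μ] [IsProbabilityMeasure μ₁]

theorem lintegral_index_term_le (hn : 0 < n) (hm : 0 < m) {p : ℝ} (h0 : 0 ≤ p) (h1 : p ≤ 1) (η : ℝ)
    (c : Vec d) (u : Fin n → Fin m → Vec d) :
    ∫⁻ r, ENNReal.ofReal (‖c - η • mean fun τ => u τ (r.2.2.1 τ)‖ ^ 2) ∂(sampleLaw n m μ μ₁ p)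
      ≤ ENNReal.ofReal (‖c - η • mean fun τ => mean (u τ)‖ ^ 2
        + η ^ 2 / n * mean fun τ => mean fun i => ‖u τ i‖ ^ 2) := by
  rw [(measurePreserving_index μ μ₁ hm h0 h1).lintegral_comp
    (f := fun k : Fin n → Fin m => ENNReal.ofReal (‖c - η • mean fun τ => u τ (k τ)‖ ^ 2))
    (measurable_of_finite _), indexLaw, lintegral_uniform_index hm fun k => by positivity]
  exact ENNReal.ofReal_le_ofReal (avg_norm_sub_smul_mean_sq_le hn hm η c u)

omit [IsProbabilityMeasure μ] in
theorem IsContractionCompressor.measurable_error {δ : ℝ} {Q : S → Vec d → Vec d}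
    (hQ : IsContractionCompressor μ δ Q) : Measurable fun q : S × Vec d => ‖q.2 - Q q.1 q.2‖ ^ 2 :=
  (measurable_snd.sub hQ.measurable).norm.pow_const 2

/-- The seed is integrated first, with the indices fixed, so that the compressor acts on a
deterministic vector; averaging over the index then adds the sampling variance. -/
theorem lintegral_error_term_le (hm : 0 < m) {p : ℝ} (h0 : 0 ≤ p) (h1 : p ≤ 1)
    {δ : ℝ} {Q : S → Vec d → Vec d} (hQ : IsContractionCompressor μ δ Q) (η : ℝ) (c : Vec d)
    (u : Fin m → Vec d) (τ : Fin n) :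
    ∫⁻ r, ENNReal.ofReal (‖(c + η • u (r.2.2.1 τ)) - Q (r.1 τ) (c + η • u (r.2.2.1 τ))‖ ^ 2)
        ∂(sampleLaw n m μ μ₁ p)
      ≤ ENNReal.ofReal ((1 - δ) * (‖c + η • mean u‖ ^ 2 + η ^ 2 * mean fun i => ‖u i‖ ^ 2)) := by
  have := isProbabilityMeasure_indexLaw n hm
  have hδ : 0 ≤ 1 - δ := sub_nonneg.2 hQ.le_one
  have hmeas : Measurable fun q : S × (Fin n → Fin m) =>
      ENNReal.ofReal (‖(c + η • u (q.2 τ)) - Q q.1 (c + η • u (q.2 τ))‖ ^ 2) :=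
    (hQ.measurable_error.comp (measurable_fst.prodMk
      ((measurable_of_finite fun k : Fin n → Fin m => c + η • u (k τ)).comp
        measurable_snd))).ennreal_ofReal
  rw [(measurePreserving_seed_index μ μ₁ hm h0 h1 τ).lintegral_comp hmeas,
    lintegral_prod_symm' _ hmeas]
  refine (lintegral_mono fun k : Fin n → Fin m => hQ.contraction (c + η • u (k τ))).trans ?_
  rw [indexLaw, lintegral_uniform_index hm fun k => by positivity]
  refine ENNReal.ofReal_le_ofReal ?_
  rw [avg_mul, avg_marginal hm τ fun i => ‖c + η • u i‖ ^ 2]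
  gcongr
  exact mean_norm_add_smul_sq_le hm η c u

/-- For a fixed seed the coin is averaged out by the two-point inequality; the contraction property
of `Q₁` handles the seed. The displacement `D` is zero when the reference point stays. -/
theorem lintegral_learn_term_le (hm : 0 < m) {p : ℝ} (h0 : 0 ≤ p) (h1 : p ≤ 1)
    {δ₁ : ℝ} {Q₁ : S₁ → Vec d → Vec d} (hQ : IsContractionCompressor μ₁ δ₁ Q₁) (v : Vec d)
    (D : Bool → Vec d) (hD : D false = 0) (τ : Fin n) :
    ∫⁻ r, ENNReal.ofReal (‖(Q₁ (r.2.1 τ) v - v) - D r.2.2.2‖ ^ 2) ∂(sampleLaw n m μ μ₁ p)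
      ≤ ENNReal.ofReal ((1 + δ₁ / 2) * ((1 - δ₁) * ‖v‖ ^ 2)
        + p * (1 + 2 * p / δ₁) * ‖D true‖ ^ 2) := by
  have := isProbabilityMeasure_coinLaw h0 h1
  have hδ : 0 ≤ 1 - δ₁ := sub_nonneg.2 hQ.le_one
  have hδ0 := hQ.pos
  have hm1 : Measurable fun s : S₁ => Q₁ s v :=
    hQ.measurable.comp (measurable_id.prodMk measurable_const)
  have hmeas : Measurable fun q : S₁ × Bool =>
      ENNReal.ofReal (‖(Q₁ q.1 v - v) - D q.2‖ ^ 2) :=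
    ((((hm1.comp measurable_fst).sub_const v).sub
      ((measurable_of_finite D).comp measurable_snd)).norm.pow_const 2).ennreal_ofReal
  rw [(measurePreserving_seed_coin μ μ₁ hm h0 h1 τ).lintegral_comp hmeas,
    lintegral_prod _ hmeas.aemeasurable]
  have hpt : ∀ s, ∫⁻ u, ENNReal.ofReal (‖(Q₁ s v - v) - D u‖ ^ 2) ∂(coinLaw p)
      ≤ ENNReal.ofReal (1 + δ₁ / 2) * ENNReal.ofReal (‖v - Q₁ s v‖ ^ 2)
        + ENNReal.ofReal (p * (1 + 2 * p / δ₁) * ‖D true‖ ^ 2) := by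
    intro s
    rw [lintegral_coinLaw, ← ENNReal.ofReal_mul h0, ← ENNReal.ofReal_mul (sub_nonneg.2 h1),
      ← ENNReal.ofReal_mul (by positivity), ← ENNReal.ofReal_add (by positivity)
        (mul_nonneg (sub_nonneg.2 h1) (by positivity)), ← ENNReal.ofReal_add (by positivity)
        (by positivity), hD, sub_zero, norm_sub_rev v]
    exact ENNReal.ofReal_le_ofReal (two_point_norm_sq_le h0 hδ0 _ _)
  refine (lintegral_mono hpt).trans ?_
  rw [lintegral_add_right _ measurable_const, lintegral_const_mul' _ _ ENNReal.ofReal_ne_top,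
    lintegral_const, measure_univ, mul_one,
    ENNReal.ofReal_add (p := (1 + δ₁ / 2) * ((1 - δ₁) * ‖v‖ ^ 2)) (by positivity) (by positivity),
    ENNReal.ofReal_mul (p := 1 + δ₁ / 2) (by positivity)]
  gcongr
  exact hQ.contraction v

theorem lintegral_coin_term (hm : 0 < m) {p : ℝ} (h0 : 0 ≤ p) (h1 : p ≤ 1) (g : Bool → ℝ)
    (hg : ∀ u, 0 ≤ g u) :
    ∫⁻ r, ENNReal.ofReal (g r.2.2.2) ∂(sampleLaw n m μ μ₁ p)
      = ENNReal.ofReal (p * g true + (1 - p) * g false) := by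
  rw [(measurePreserving_coin μ μ₁ hm h0 h1).lintegral_comp (f := fun u => ENNReal.ofReal (g u))
    (measurable_of_finite _), lintegral_coinLaw, ← ENNReal.ofReal_mul h0,
    ← ENNReal.ofReal_mul (sub_nonneg.2 h1), ← ENNReal.ofReal_add (mul_nonneg h0 (hg _))
      (mul_nonneg (sub_nonneg.2 h1) (hg _))]

/-- Each of the four terms depends on only part of the randomness: the indices, seed and indices,
seed and coin, or the coin. By linearity the corresponding marginals suffice. -/
theorem Subproblem.lintegral_potential_step_le {F : Fin n → Fin m → Vec d → ℝ} {AF Ab A ν : ℝ}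
    (hF : Subproblem F AF Ab A ν) {p : ℝ} (h0 : 0 ≤ p) (h1 : p ≤ 1) {δ δ₁ : ℝ}
    {Q : S → Vec d → Vec d} (hQ : IsContractionCompressor μ δ Q)
    {Q₁ : S₁ → Vec d → Vec d} (hQ₁ : IsContractionCompressor μ₁ δ₁ Q₁)
    (η : ℝ) {a b c : ℝ} (ha : 0 ≤ a) (hb : 0 ≤ b) (hc : 0 ≤ c) (s : InnerState d n) :
    ∫⁻ r, ENNReal.ofReal (potential F a b c (ecLsvrgStep F Q Q₁ η r s)) ∂(sampleLaw n m μ μ₁ p)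
      ≤ ENNReal.ofReal (
        (‖s.x - mean s.e - argmin (objective F) - η • gradient (objective F) s.x‖ ^ 2
          + η ^ 2 / n * mean fun τ => mean fun i =>
            ‖gradient (F τ i) s.x - gradient (F τ i) s.w‖ ^ 2)
        + a * mean (fun τ => (1 - δ) * (‖s.e τ + η • (gradient (mean (F τ)) s.x - s.h τ)‖ ^ 2
            + η ^ 2 * mean fun i => ‖gradient (F τ i) s.x - gradient (F τ i) s.w‖ ^ 2))
        + b * mean (fun τ => (1 + δ₁ / 2) * ((1 - δ₁) * ‖s.h τ - gradient (mean (F τ)) s.w‖ ^ 2)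
            + p * (1 + 2 * p / δ₁) * ‖gradient (mean (F τ)) s.x - gradient (mean (F τ)) s.w‖ ^ 2)
        + c * (p * subopt F s.x + (1 - p) * subopt F s.w)) := by
  have hm := hF.m_pos
  have hδ : 0 ≤ 1 - δ := sub_nonneg.2 hQ.le_one
  have hδ₁ : 0 ≤ 1 - δ₁ := sub_nonneg.2 hQ₁.le_one
  have hδ₁0 := hQ₁.pos
  have hg := hF.subopt_nonneg
  simp only [potential_step_eq]
  let u : Fin n → Fin m → Vec d := fun τ i => gradient (F τ i) s.x - gradient (F τ i) s.w
  let v : Fin n → Vec d := fun τ => s.e τ + η • (gradient (mean (F τ)) s.w - s.h τ)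
  let D : Fin n → Bool → Vec d := fun τ t =>
    gradient (mean (F τ)) (if t then s.x else s.w) - gradient (mean (F τ)) s.w
  have hu : ∀ τ, mean (u τ) = gradient (mean (F τ)) s.x - gradient (mean (F τ)) s.w := by
    intro τ
    simp only [u, mean_sub, hF.gradient_local]
  -- measurability of the four terms
  have mi : ∀ {β : Type} [MeasurableSpace β] (f : (Fin n → Fin m) → β),
      Measurable fun r : Sample n m S S₁ => f r.2.2.1 := fun f =>
    (measurable_of_finite f).comp (measurable_fst.comp (measurable_snd.comp measurable_snd))
  have mc : ∀ {β : Type} [MeasurableSpace β] (f : Bool → β),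
      Measurable fun r : Sample n m S S₁ => f r.2.2.2 := fun f =>
    (measurable_of_finite f).comp (measurable_snd.comp (measurable_snd.comp measurable_snd))
  have m2 : ∀ τ, Measurable fun r : Sample n m S S₁ =>
      ‖(v τ + η • u τ (r.2.2.1 τ)) - Q (r.1 τ) (v τ + η • u τ (r.2.2.1 τ))‖ ^ 2 := fun τ =>
    hQ.measurable_error.comp (g := fun q : S × Vec d => ‖q.2 - Q q.1 q.2‖ ^ 2)
      (f := fun r : Sample n m S S₁ => (r.1 τ, v τ + η • u τ (r.2.2.1 τ)))
      (((measurable_pi_apply τ).comp measurable_fst).prodMk (mi fun k => v τ + η • u τ (k τ)))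
  have m3 : ∀ τ, Measurable fun r : Sample n m S S₁ =>
      ‖(Q₁ (r.2.1 τ) (gradient (mean (F τ)) s.w - s.h τ)
        - (gradient (mean (F τ)) s.w - s.h τ)) - D τ r.2.2.2‖ ^ 2 := fun τ =>
    (((hQ₁.measurable.comp (f := fun r : Sample n m S S₁ =>
      (r.2.1 τ, gradient (mean (F τ)) s.w - s.h τ)) (((measurable_pi_apply τ).comp
      (measurable_fst.comp measurable_snd)).prodMk measurable_const)).sub_const
        (gradient (mean (F τ)) s.w - s.h τ)).sub (mc (D τ))).norm.pow_const 2
  have mm : ∀ {w : Fin n → Sample n m S S₁ → ℝ}, (∀ τ, Measurable (w τ)) →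
      Measurable fun r => mean fun τ => w τ r := fun hw =>
    (Finset.measurable_fun_sum _ fun τ _ => hw τ).const_mul _
  have nn : ∀ {w : Fin n → Vec d}, 0 ≤ mean fun τ => ‖w τ‖ ^ 2 := mean_nonneg fun τ => by positivity
  have b1 := lintegral_index_term_le (μ := μ) (μ₁ := μ₁) hF.n_pos hm h0 h1 η
    (s.x - mean s.e - argmin (objective F) - η • mean fun τ => gradient (mean (F τ)) s.w) u
  have b2 := lintegral_mean_le (ν := sampleLaw n m μ μ₁ p)
    (u := fun τ r => ‖(v τ + η • u τ (r.2.2.1 τ)) - Q (r.1 τ) (v τ + η • u τ (r.2.2.1 τ))‖ ^ 2)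
    (c := fun τ => (1 - δ) * (‖v τ + η • mean (u τ)‖ ^ 2 + η ^ 2 * mean fun i => ‖u τ i‖ ^ 2))
    m2 (fun _ _ => by positivity)
    (fun τ => mul_nonneg hδ (add_nonneg (by positivity)
      (mul_nonneg (by positivity) (mean_nonneg fun i => by positivity))))
    fun τ => lintegral_error_term_le hm h0 h1 hQ η (v τ) (u τ) τ
  have b3 := lintegral_mean_le (ν := sampleLaw n m μ μ₁ p)
    (u := fun τ r => ‖(Q₁ (r.2.1 τ) (gradient (mean (F τ)) s.w - s.h τ)
        - (gradient (mean (F τ)) s.w - s.h τ)) - D τ r.2.2.2‖ ^ 2)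
    (c := fun τ => (1 + δ₁ / 2) * ((1 - δ₁) * ‖gradient (mean (F τ)) s.w - s.h τ‖ ^ 2)
      + p * (1 + 2 * p / δ₁) * ‖D τ true‖ ^ 2)
    m3 (fun _ _ => by positivity)
    (fun τ => by positivity)
    fun τ => lintegral_learn_term_le hm h0 h1 hQ₁ (gradient (mean (F τ)) s.w - s.h τ) (D τ)
      (by simp [D]) τ
  have b4 := lintegral_coin_term (n := n) (μ := μ) (μ₁ := μ₁) hm h0 h1
    (fun t => subopt F (if t then s.x else s.w)) fun t => hg _
  have E1 : (s.x - mean s.e - argmin (objective F) - η • mean fun τ => gradient (mean (F τ)) s.w)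
      - (η • mean fun τ => mean (u τ))
      = s.x - mean s.e - argmin (objective F) - η • gradient (objective F) s.x := by
    simp only [hu, mean_sub, hF.gradient_objective]
    module
  have E2 : ∀ τ, v τ + η • mean (u τ) = s.e τ + η • (gradient (mean (F τ)) s.x - s.h τ) := by
    intro τ
    rw [hu]
    module
  rw [E1] at b1
  simp only [E2] at b2
  have nA : 0 ≤ mean fun τ => mean fun i => ‖u τ i‖ ^ 2 :=
    mean_nonneg fun τ => mean_nonneg fun i => by positivity
  have nB : 0 ≤ mean (fun τ => (1 - δ) * (‖s.e τ + η • (gradient (mean (F τ)) s.x - s.h τ)‖ ^ 2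
            + η ^ 2 * mean fun i => ‖u τ i‖ ^ 2)) :=
    mean_nonneg fun τ => mul_nonneg hδ (add_nonneg (by positivity)
      (mul_nonneg (by positivity) (mean_nonneg fun i => by positivity)))
  have nC : 0 ≤ mean (fun τ => (1 + δ₁ / 2) * ((1 - δ₁) * ‖s.h τ - gradient (mean (F τ)) s.w‖ ^ 2)
      + p * (1 + 2 * p / δ₁) * ‖gradient (mean (F τ)) s.x - gradient (mean (F τ)) s.w‖ ^ 2) :=
    mean_nonneg fun τ => by positivity
  have nD : 0 ≤ p * subopt F s.x + (1 - p) * subopt F s.w :=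
    add_nonneg (mul_nonneg h0 (hg _)) (mul_nonneg (sub_nonneg.2 h1) (hg _))
  have hsplit : ∀ {t1 t2 t3 t4 : ℝ}, 0 ≤ t1 → 0 ≤ t2 → 0 ≤ t3 → 0 ≤ t4 →
      ENNReal.ofReal (t1 + a * t2 + b * t3 + c * t4) = ENNReal.ofReal t1
        + ENNReal.ofReal a * ENNReal.ofReal t2 + ENNReal.ofReal b * ENNReal.ofReal t3
        + ENNReal.ofReal c * ENNReal.ofReal t4 := by
    intro t1 t2 t3 t4 p1 p2 p3 p4
    rw [ENNReal.ofReal_add (by positivity) (by positivity), ENNReal.ofReal_add (by positivity)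
      (by positivity), ENNReal.ofReal_add (by positivity) (by positivity), ENNReal.ofReal_mul ha,
      ENNReal.ofReal_mul hb, ENNReal.ofReal_mul hc]
  rw [hsplit (by positivity) nB nC nD]
  rw [lintegral_congr fun r => hsplit (by positivity) nn nn (hg _)]
  have M1 := (mi fun k => ‖(s.x - mean s.e - argmin (objective F)
    - η • mean fun τ => gradient (mean (F τ)) s.w) - η • mean fun τ => u τ (k τ)‖ ^ 2).ennreal_ofReal
  have M4 := (mc fun t => subopt F (if t then s.x else s.w)).ennreal_ofReal
  have M2 := (mm m2).ennreal_ofReal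
  have M3 := (mm m3).ennreal_ofReal
  rw [lintegral_add_right _ (M4.const_mul _), lintegral_add_right _ (M3.const_mul _),
    lintegral_add_right _ (M2.const_mul _), lintegral_const_mul' _ _ ENNReal.ofReal_ne_top,
    lintegral_const_mul' _ _ ENNReal.ofReal_ne_top, lintegral_const_mul' _ _ ENNReal.ofReal_ne_top]
  refine add_le_add (add_le_add (add_le_add b1 ?_) ?_) ?_
  · exact mul_le_mul_right b2 _
  · refine mul_le_mul_right (b3.trans (ENNReal.ofReal_le_ofReal (mean_le fun τ => ?_))) _
    simp [D, norm_sub_rev (s.h τ)]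
  · exact mul_le_mul_right b4.le _

end ECCatalyst

end

noncomputable section

namespace ECCatalyst

variable {d n m : ℕ} {S S₁ : Type*}

/-! ### Contraction of the potential -/

/-- Three quarters of `p` times the weight of `G(w) - G*` in the potential. -/
def refWeight (n : ℕ) (AF Ab A δ δ₁ p η : ℝ) : ℝ :=
  48 * (1 - δ) * AF * η ^ 3 / δ * (4 * Ab / δ + A + 16 * Ab * p / (δ * δ₁) * (1 + 2 * p / δ₁))
    + 4 * A * η ^ 2 / n

theorem sqrt_div_sq_le {s t c : ℝ} (hs : 0 ≤ s) (ht : 0 < t) {η : ℝ} (hη : 0 ≤ η)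
    (h : η * (√s / t) ≤ c) : η ^ 2 * (s / t ^ 2) ≤ c ^ 2 := by
  calc η ^ 2 * (s / t ^ 2) = (η * (√s / t)) ^ 2 := by rw [mul_pow, div_pow, Real.sq_sqrt hs]
    _ ≤ c ^ 2 := by gcongr

/-- The products `AF * Ab` and `AF * A` in `refWeight` are, with their factors, the squares of the
square-root terms of the step scale. As `p / δ₁ ≤ c₂`, the remaining bracket is at most a quadratic
polynomial in `c₂`, absorbed by the factor `1 / (1 + c₂)` in the stepsize constant. -/
theorem stepsize_bounds {n : ℕ} {AF Ab A δ δ₁ p η c₂ : ℝ} (hAF : 0 < AF) (hAb : 0 < Ab)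
    (hA : 0 < A) (hδ : 0 < δ) (hδ1 : δ ≤ 1) (hδ₁ : 0 < δ₁) (hp : 0 < p) (hη : 0 < η)
    (hc₂ : 0 < c₂) (hpc : p ≤ c₂ * δ₁)
    (hS : η * (AF + A / n + √((1 - δ) * AF * Ab) / δ + √((1 - δ) * AF * A) / √δ)
      ≤ 1 / (128 * (1 + c₂))) :
    AF * η ≤ 1 / 4 ∧ refWeight n AF Ab A δ δ₁ p η ≤ η / 4 := by
  set c₀ := 1 / (128 * (1 + c₂)) with hc₀
  have hc : c₀ * (1 + c₂) = 1 / 128 := by rw [hc₀]; field_simp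
  have hc₀p : 0 < c₀ := by positivity
  have hc₀' : c₀ ≤ 1 / 128 := by nlinarith
  have hδ2 : 0 ≤ 1 - δ := sub_nonneg.2 hδ1
  have n1 : 0 ≤ η * AF := by positivity
  have n2 : 0 ≤ η * (A / n) := by positivity
  have n3 : 0 ≤ η * (√((1 - δ) * AF * Ab) / δ) := by positivity
  have n4 : 0 ≤ η * (√((1 - δ) * AF * A) / √δ) := by positivity
  have h1 : η * AF ≤ c₀ := by linarith
  have h2 : η * (A / n) ≤ c₀ := by linarith
  have h3 := sqrt_div_sq_le (s := (1 - δ) * AF * Ab) (by positivity) hδ hη.le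
    (show _ ≤ c₀ by linarith)
  have h4 := sqrt_div_sq_le (s := (1 - δ) * AF * A) (by positivity) (Real.sqrt_pos.2 hδ) hη.le
    (show _ ≤ c₀ by linarith)
  rw [Real.sq_sqrt hδ.le] at h4
  refine ⟨by linarith, ?_⟩
  have hr : p / δ₁ ≤ c₂ := by rwa [div_le_iff₀ hδ₁]
  have hr0 : 0 ≤ p / δ₁ := by positivity
  have e : refWeight n AF Ab A δ δ₁ p η
      = η * (48 * (η ^ 2 * ((1 - δ) * AF * Ab / δ ^ 2) * (4 + 16 * (p / δ₁) * (1 + 2 * (p / δ₁)))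
        + η ^ 2 * ((1 - δ) * AF * A / δ)) + 4 * (η * (A / n))) := by
    unfold refWeight; field_simp; ring
  have h5 : η ^ 2 * ((1 - δ) * AF * Ab / δ ^ 2) * (4 + 16 * (p / δ₁) * (1 + 2 * (p / δ₁)))
      ≤ c₀ ^ 2 * (4 + 16 * c₂ * (1 + 2 * c₂)) := by gcongr
  have h6 : c₀ ^ 2 * (4 + 16 * c₂ * (1 + 2 * c₂)) + c₀ ^ 2 ≤ 32 * (c₀ * (1 + c₂)) ^ 2 := by
    have : 0 ≤ c₀ ^ 2 * (27 + 48 * c₂) := by positivity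
    nlinarith
  rw [e, show η / 4 = η * (1 / 4) by ring]
  rw [hc] at h6
  refine mul_le_mul_of_nonneg_left ?_ hη.le
  linarith

/-- Young's inequality tuned so that half of the contraction remains for `u`. Keeping the factor `1
- δ` on the second term lets it vanish without compression, including at `δ = 1`. -/
theorem compressed_norm_sq_le {δ : ℝ} (hδ : 0 < δ) (hδ1 : δ ≤ 1) (u v : Vec d) :
    (1 - δ) * ‖u + v‖ ^ 2 ≤ (1 - δ / 2) * ‖u‖ ^ 2 + (1 - δ) * (2 / δ) * ‖v‖ ^ 2 := by
  have hδ2 : 0 ≤ 1 - δ := sub_nonneg.2 hδ1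
  have h1 : ‖u + v‖ ^ 2 ≤ (‖u‖ + ‖v‖) ^ 2 := by gcongr; exact norm_add_le _ _
  have h2 : (1 - δ) * ‖u + v‖ ^ 2 ≤ (1 - δ) * (‖u‖ + ‖v‖) ^ 2 := by gcongr
  have e : (1 - δ / 2) * ‖u‖ ^ 2 + (1 - δ) * (2 / δ) * ‖v‖ ^ 2 - (1 - δ) * (‖u‖ + ‖v‖) ^ 2
      = (δ * ‖u‖ - 2 * (1 - δ) * ‖v‖) ^ 2 / (2 * δ) + (1 - δ) * ‖v‖ ^ 2 := by
    field_simp; ring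
  have : 0 ≤ (δ * ‖u‖ - 2 * (1 - δ) * ‖v‖) ^ 2 / (2 * δ) + (1 - δ) * ‖v‖ ^ 2 := by positivity
  linarith

/-- The gradient is taken at `x`, but the step starts from `x - e`. In the cross term with `e`,
Young's inequality with weight `4 * AF` costs a quarter of the `2 η` available from the gap and
leaves `4 * AF * η * ‖e‖ ^ 2`. Comparing `x` with `x - e` in the strong convexity term adds one more
`AF * η * ‖e‖ ^ 2`, by `ν ≤ AF`. -/
theorem Subproblem.virtual_step_le {F : Fin n → Fin m → Vec d → ℝ} {AF Ab A ν : ℝ}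
    (hF : Subproblem F AF Ab A ν) {η : ℝ} (hη : 0 < η) (x e : Vec d) :
    ‖x - e - argmin (objective F) - η • gradient (objective F) x‖ ^ 2
      ≤ (1 - ν * η / 2) * ‖x - e - argmin (objective F)‖ ^ 2 - 3 / 2 * η * subopt F x
        + 5 * AF * η * ‖e‖ ^ 2 + 2 * AF * η ^ 2 * subopt F x := by
  set xs := argmin (objective F)
  set g := gradient (objective F) x
  have hAF := hF.AF_pos
  have h1 : subopt F x + ν / 2 * ‖x - xs‖ ^ 2 ≤ inner ℝ g (x - xs) := hF.subopt_add_le_inner x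
  have h2 : ‖g‖ ^ 2 ≤ 2 * AF * subopt F x := hF.gradient_normSq_le x
  have h3 : ‖x - e - xs‖ ^ 2 ≤ 2 * ‖x - xs‖ ^ 2 + 2 * ‖e‖ ^ 2 := by
    have : x - e - xs = (x - xs) - e := by abel
    rw [this]
    simpa using norm_sub_sq_le_add (x - xs) e 0
  have h4 : 2 * inner ℝ g e ≤ ‖g‖ ^ 2 / (4 * AF) + 4 * AF * ‖e‖ ^ 2 := by
    have h := real_inner_le_norm g e
    have e1 : ‖g‖ ^ 2 / (4 * AF) + 4 * AF * ‖e‖ ^ 2 - 2 * (‖g‖ * ‖e‖)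
      = (‖g‖ - 4 * AF * ‖e‖) ^ 2 / (4 * AF) := by field_simp; ring
    have : 0 ≤ (‖g‖ - 4 * AF * ‖e‖) ^ 2 / (4 * AF) := by positivity
    linarith
  have h5 : ‖g‖ ^ 2 / (4 * AF) ≤ subopt F x / 2 := by
    rw [div_le_iff₀ (by positivity)]; linarith
  have h6 : inner ℝ (x - e - xs) g = inner ℝ g (x - xs) - inner ℝ g e := by
    rw [real_inner_comm, ← inner_sub_right]; congr 1; abel
  rw [norm_sub_sq_real, inner_smul_right, norm_smul, mul_pow, Real.norm_of_nonneg hη.le, h6]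
  have h7 : 2 * η * inner ℝ g e ≤ η * (subopt F x / 2 + 4 * AF * ‖e‖ ^ 2) := by
    have : η * (2 * inner ℝ g e) ≤ η * (subopt F x / 2 + 4 * AF * ‖e‖ ^ 2) := by
      gcongr; linarith
    linarith
  have h8 : 2 * η * (subopt F x + ν / 2 * ‖x - xs‖ ^ 2) ≤ 2 * η * inner ℝ g (x - xs) := by gcongr
  have h9 : η ^ 2 * ‖g‖ ^ 2 ≤ η ^ 2 * (2 * AF * subopt F x) := by gcongr
  have h10 : ν * η / 2 * ‖x - e - xs‖ ^ 2 ≤ ν * η / 2 * (2 * ‖x - xs‖ ^ 2 + 2 * ‖e‖ ^ 2) := by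
    have := hF.μ_pos
    gcongr
  have h11 : ν * η * ‖e‖ ^ 2 ≤ AF * η * ‖e‖ ^ 2 := by gcongr; exact hF.μ_le
  linarith

theorem Subproblem.error_step_le {F : Fin n → Fin m → Vec d → ℝ} {AF Ab A ν : ℝ}
    (hF : Subproblem F AF Ab A ν) {δ : ℝ} (hδ : 0 < δ) (hδ1 : δ ≤ 1) (η : ℝ)
    (s : InnerState d n) :
    mean (fun τ => (1 - δ) * (‖s.e τ + η • (gradient (mean (F τ)) s.x - s.h τ)‖ ^ 2
        + η ^ 2 * mean fun i => ‖gradient (F τ i) s.x - gradient (F τ i) s.w‖ ^ 2))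
      ≤ (1 - δ / 2) * mean (fun τ => ‖s.e τ‖ ^ 2)
        + (1 - δ) * η ^ 2 * ((16 * Ab / δ + 4 * A) * (subopt F s.x + subopt F s.w)
          + 4 / δ * mean (fun τ => ‖s.h τ - gradient (mean (F τ)) s.w‖ ^ 2)) := by
  have hδ2 : 0 ≤ 1 - δ := sub_nonneg.2 hδ1
  have h : ∀ τ, (1 - δ) * (‖s.e τ + η • (gradient (mean (F τ)) s.x - s.h τ)‖ ^ 2
        + η ^ 2 * mean fun i => ‖gradient (F τ i) s.x - gradient (F τ i) s.w‖ ^ 2)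
      ≤ (1 - δ / 2) * ‖s.e τ‖ ^ 2 + ((1 - δ) * η ^ 2 * (4 / δ)
          * ‖gradient (mean (F τ)) s.x - gradient (mean (F τ)) s.w‖ ^ 2
        + (1 - δ) * η ^ 2 * (4 / δ) * ‖s.h τ - gradient (mean (F τ)) s.w‖ ^ 2
        + (1 - δ) * η ^ 2 * mean fun i => ‖gradient (F τ i) s.x - gradient (F τ i) s.w‖ ^ 2) := by
    intro τ
    have h1 := compressed_norm_sq_le hδ hδ1 (s.e τ) (η • (gradient (mean (F τ)) s.x - s.h τ))
    have h2 := norm_sub_sq_le_add (gradient (mean (F τ)) s.x) (s.h τ) (gradient (mean (F τ)) s.w)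
    rw [norm_smul, mul_pow, Real.norm_eq_abs, sq_abs] at h1
    have h3 : (1 - δ) * (2 / δ) * (η ^ 2 * ‖gradient (mean (F τ)) s.x - s.h τ‖ ^ 2)
        ≤ (1 - δ) * (2 / δ) * (η ^ 2 * (2 * ‖gradient (mean (F τ)) s.x - gradient (mean (F τ)) s.w‖ ^ 2
          + 2 * ‖s.h τ - gradient (mean (F τ)) s.w‖ ^ 2)) := by gcongr
    have e4 : (4 : ℝ) / δ = 2 * (2 / δ) := by ring
    rw [e4]
    linarith
  refine (mean_le h).trans ?_
  simp only [mean_add, mean_mul]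
  have h1 : (1 - δ) * η ^ 2 * (4 / δ)
      * mean (fun τ => ‖gradient (mean (F τ)) s.x - gradient (mean (F τ)) s.w‖ ^ 2)
      ≤ (1 - δ) * η ^ 2 * (4 / δ) * (4 * Ab * (subopt F s.x + subopt F s.w)) := by
    gcongr; exact hF.mean_local_gradient_le s.x s.w
  have h2 : (1 - δ) * η ^ 2
      * mean (fun τ => mean fun i => ‖gradient (F τ i) s.x - gradient (F τ i) s.w‖ ^ 2)
      ≤ (1 - δ) * η ^ 2 * (4 * A * (subopt F s.x + subopt F s.w)) := by
    gcongr; exact hF.mean_comp_gradient_le s.x s.w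
  refine (add_le_add_right (add_le_add (add_le_add h1 le_rfl) h2) _).trans (le_of_eq ?_)
  ring

theorem Subproblem.learn_step_le {F : Fin n → Fin m → Vec d → ℝ} {AF Ab A ν : ℝ}
    (hF : Subproblem F AF Ab A ν) {δ₁ p : ℝ} (hδ₁ : 0 < δ₁) (hp : 0 < p)
    (s : InnerState d n) :
    mean (fun τ => (1 + δ₁ / 2) * ((1 - δ₁) * ‖s.h τ - gradient (mean (F τ)) s.w‖ ^ 2)
        + p * (1 + 2 * p / δ₁) * ‖gradient (mean (F τ)) s.x - gradient (mean (F τ)) s.w‖ ^ 2)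
      ≤ (1 - δ₁ / 2) * mean (fun τ => ‖s.h τ - gradient (mean (F τ)) s.w‖ ^ 2)
        + p * (1 + 2 * p / δ₁) * (4 * Ab * (subopt F s.x + subopt F s.w)) := by
  simp only [mean_add, mean_mul]
  have h1 : 0 ≤ mean (fun τ => ‖s.h τ - gradient (mean (F τ)) s.w‖ ^ 2) :=
    mean_nonneg fun τ => by positivity
  have h2 : p * (1 + 2 * p / δ₁)
      * mean (fun τ => ‖gradient (mean (F τ)) s.x - gradient (mean (F τ)) s.w‖ ^ 2)
      ≤ p * (1 + 2 * p / δ₁) * (4 * Ab * (subopt F s.x + subopt F s.w)) := by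
    gcongr; exact hF.mean_local_gradient_le s.x s.w
  -- Here `(1 + δ₁ / 2) * (1 - δ₁)` equals `1 - δ₁ / 2 - δ₁ ^ 2 / 2`.
  nlinarith [mul_nonneg (sq_nonneg δ₁) h1]

variable [MeasurableSpace S] [MeasurableSpace S₁] {μ : Measure S} {μ₁ : Measure S₁}
  [IsProbabilityMeasure μ] [IsProbabilityMeasure μ₁]

/-- The weights balance a budget: each term keeps a fixed fraction of its own decrease as
contraction and spends the rest on the terms it causes elsewhere. All gap terms caused by variance
and drift add up to `refWeight` times the gaps at `x` and `w`. -/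
theorem Subproblem.lintegral_potential_step_le_mul {F : Fin n → Fin m → Vec d → ℝ}
    {AF Ab A ν : ℝ} (hF : Subproblem F AF Ab A ν) {p : ℝ} (h0 : 0 < p) (h1 : p ≤ 1) {δ δ₁ : ℝ}
    {Q : S → Vec d → Vec d} (hQ : IsContractionCompressor μ δ Q)
    {Q₁ : S₁ → Vec d → Vec d} (hQ₁ : IsContractionCompressor μ₁ δ₁ Q₁)
    {η : ℝ} (hη : 0 < η) (hs1 : AF * η ≤ 1 / 4) (hs2 : refWeight n AF Ab A δ δ₁ p η ≤ η / 4)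
    {r : ℝ} (hr1 : r ≤ ν * η / 2) (hr2 : r ≤ δ / 12) (hr3 : r ≤ δ₁ / 4) (hr4 : r ≤ p / 4)
    (s : InnerState d n) :
    ∫⁻ ω, ENNReal.ofReal (potential F (12 * AF * η / δ)
        (192 * (1 - δ) * AF * η ^ 3 / (δ ^ 2 * δ₁)) (4 / (3 * p) * refWeight n AF Ab A δ δ₁ p η)
        (ecLsvrgStep F Q Q₁ η ω s)) ∂(sampleLaw n m μ μ₁ p)
      ≤ ENNReal.ofReal ((1 - r) * potential F (12 * AF * η / δ)
        (192 * (1 - δ) * AF * η ^ 3 / (δ ^ 2 * δ₁)) (4 / (3 * p) * refWeight n AF Ab A δ δ₁ p η)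
        s) := by
  have hAF := hF.AF_pos
  have hA := hF.A_pos
  have hAb := hF.Ab_pos
  have hδ := hQ.pos
  have hδ₁ := hQ₁.pos
  have hδ2 : 0 ≤ 1 - δ := sub_nonneg.2 hQ.le_one
  have hR : 0 ≤ refWeight n AF Ab A δ δ₁ p η := by unfold refWeight; positivity
  refine (hF.lintegral_potential_step_le h0.le h1 hQ hQ₁ η (by positivity) (by positivity)
    (by positivity) s).trans (ENNReal.ofReal_le_ofReal ?_)
  have b1 := hF.virtual_step_le hη s.x (mean s.e)
  have b2 := hF.error_step_le hδ hQ.le_one η s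
  have b3 := hF.learn_step_le hδ₁ h0 s
  have b4 := hF.mean_comp_gradient_le s.x s.w
  have b5 := norm_mean_sq_le hF.n_pos s.e
  have gx := hF.subopt_nonneg s.x
  have gw := hF.subopt_nonneg s.w
  unfold potential
  set X := ‖s.x - mean s.e - argmin (objective F)‖ ^ 2
  set E := mean (fun τ => ‖s.e τ‖ ^ 2)
  set H := mean (fun τ => ‖s.h τ - gradient (mean (F τ)) s.w‖ ^ 2)
  set Gx := subopt F s.x
  set Gw := subopt F s.w
  set R := refWeight n AF Ab A δ δ₁ p η with hRdef
  have nX : 0 ≤ X := by positivity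
  have nE : 0 ≤ E := mean_nonneg fun τ => by positivity
  have nH : 0 ≤ H := mean_nonneg fun τ => by positivity
  have b2' := mul_le_mul_of_nonneg_left b2 (show 0 ≤ 12 * AF * η / δ by positivity)
  have b3' := mul_le_mul_of_nonneg_left b3
    (show 0 ≤ 192 * (1 - δ) * AF * η ^ 3 / (δ ^ 2 * δ₁) by positivity)
  have b4' := mul_le_mul_of_nonneg_left b4 (show 0 ≤ η ^ 2 / n by positivity)
  have b5' : 5 * AF * η * ‖mean s.e‖ ^ 2 ≤ 5 * AF * η * E := by gcongr
  have key : R * (Gx + Gw) = 12 * AF * η / δ * ((1 - δ) * η ^ 2 * ((16 * Ab / δ + 4 * A) * (Gx + Gw)))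
      + 192 * (1 - δ) * AF * η ^ 3 / (δ ^ 2 * δ₁) * (p * (1 + 2 * p / δ₁) * (4 * Ab * (Gx + Gw)))
      + η ^ 2 / n * (4 * A * (Gx + Gw)) := by
    have hn : (n : ℝ) ≠ 0 := by have := hF.n_pos; positivity
    rw [hRdef, refWeight]; field_simp; ring
  -- Compression gains `6 * AF * η * E`, the virtual step costs `5 * AF * η * E`; the difference is
  -- the fraction `δ / 12`.
  have kE : 12 * AF * η / δ * ((1 - δ / 2) * E) + 5 * AF * η * E
      ≤ (1 - r) * (12 * AF * η / δ * E) := by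
    have : 12 * AF * η / δ * ((1 - δ / 2) * E) + 5 * AF * η * E
        = (1 - δ / 12) * (12 * AF * η / δ * E) := by field_simp; ring
    rw [this]; gcongr
  -- Half of the gain `δ₁ / 2` of the learning term pays for its contribution to the error term.
  have kH : 12 * AF * η / δ * ((1 - δ) * η ^ 2 * (4 / δ * H))
        + 192 * (1 - δ) * AF * η ^ 3 / (δ ^ 2 * δ₁) * ((1 - δ₁ / 2) * H)
      ≤ (1 - r) * (192 * (1 - δ) * AF * η ^ 3 / (δ ^ 2 * δ₁) * H) := by
    have : 12 * AF * η / δ * ((1 - δ) * η ^ 2 * (4 / δ * H))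
        + 192 * (1 - δ) * AF * η ^ 3 / (δ ^ 2 * δ₁) * ((1 - δ₁ / 2) * H)
        = (1 - δ₁ / 4) * (192 * (1 - δ) * AF * η ^ 3 / (δ ^ 2 * δ₁) * H) := by field_simp; ring
    rw [this]; gcongr
  have kX : (1 - ν * η / 2) * X ≤ (1 - r) * X := by gcongr
  -- The coin removes `4/3 * R` of the gap at `w`, of which `R` is spent; the remaining `R / 3` is
  -- the fraction `p / 4` of the weight.
  have kw : 4 / (3 * p) * R * ((1 - p) * Gw) + R * Gw ≤ (1 - r) * (4 / (3 * p) * R * Gw) := by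
    have : 4 / (3 * p) * R * ((1 - p) * Gw) + R * Gw
        = (1 - p / 4) * (4 / (3 * p) * R * Gw) := by field_simp; ring
    rw [this]; gcongr
  -- The demands on the gap at `x` are `7/3 * R + 2 * AF * η ^ 2`, at most `13/12 * η`, below the
  -- available `3/2 * η`.
  have kx : 4 / (3 * p) * R * (p * Gx) + R * Gx + 2 * AF * η ^ 2 * Gx ≤ 3 / 2 * η * Gx := by
    have h : 4 / (3 * p) * R * (p * Gx) = 4 / 3 * (R * Gx) := by field_simp
    have h2 : R * Gx ≤ η / 4 * Gx := by gcongr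
    have h3 : AF * η * (η * Gx) ≤ 1 / 4 * (η * Gx) := by gcongr
    have h4 : 0 ≤ η * Gx := by positivity
    rw [h]; linarith
  clear_value X E H Gx Gw R
  linarith

end ECCatalyst

end

noncomputable section

namespace ECCatalyst

variable {d n m : ℕ} {S S₁ : Type*}

/-! ### Accelerated inexact proximal point method -/

/-- The algebra behind acceleration, with the minimizer translated to the origin. The proximal
inequality is used at the minimizer with weight `θ` and at the previous iterate `u` with weight `1 -
θ`. The extrapolated point `(1 + θ)⁻¹ • (u + θ • v)` is the one for which the remainder is a
combination of squares, nonnegative for `θ ≤ 1`. -/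
theorem acceleration_identity {θ : ℝ} (h0 : 0 < θ) (x u v : Vec d) :
    θ * ((1 - θ ^ 2) * ‖x - (1 + θ)⁻¹ • (u + θ • v)‖ ^ 2
        - (1 - θ ^ 2) * ‖(1 + θ)⁻¹ • (u + θ • v)‖ ^ 2 + ‖x‖ ^ 2)
      + (1 - θ) * ((1 - θ ^ 2) * ‖x - (1 + θ)⁻¹ • (u + θ • v)‖ ^ 2
        - (1 - θ ^ 2) * ‖u - (1 + θ)⁻¹ • (u + θ • v)‖ ^ 2 + ‖u - x‖ ^ 2)
      = ‖x - (1 - θ) • u‖ ^ 2 - (1 - θ) * θ ^ 2 * ‖v‖ ^ 2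
        + ((1 - θ) * ‖θ • v - (x - (1 - θ) • u)‖ ^ 2 + θ * ‖x - (1 - θ) • u - θ • x‖ ^ 2
          + θ ^ 2 * (1 - θ) * ‖u - x‖ ^ 2) := by
  simp only [← real_inner_self_eq_norm_sq, inner_add_left, inner_add_right, inner_sub_left,
    inner_sub_right, inner_smul_left, inner_smul_right, conj_trivial]
  rw [real_inner_comm x u, real_inner_comm x v, real_inner_comm u v]
  field_simp
  ring

/-- Here `c` is the exact proximal point and `x` the computed one. Inexactness costs `e` in the
function value, and a cross term because strong convexity is centred at `c` instead of `x`. -/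
theorem accelerated_step_le {F : Vec d → ℝ} {lam kap θ e Fs : ℝ} (h0 : 0 < θ)
    (h1 : θ ≤ 1) (hμ : 0 < lam + kap) (hθ : lam = θ ^ 2 * (lam + kap)) (he : 0 ≤ e)
    {x u v v' y c xs : Vec d} (hy : (1 + θ) • y = u + θ • v) (hv : θ • v' = x - (1 - θ) • u)
    (hFs : F xs = Fs)
    (hprox : ∀ z, F x + kap / 2 * ‖x - y‖ ^ 2 - e + (lam + kap) / 2 * ‖z - c‖ ^ 2
      ≤ F z + kap / 2 * ‖z - y‖ ^ 2)
    (hc : (lam + kap) / 2 * ‖x - c‖ ^ 2 ≤ e) (hmin : Fs ≤ F x) :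
    F x - Fs + lam / 2 * ‖v' - xs‖ ^ 2 ≤ (1 - θ) * (F u - Fs + lam / 2 * ‖v - xs‖ ^ 2)
      + e + 2 * √e * √(F x - Fs + lam / 2 * ‖v' - xs‖ ^ 2) := by
  set M := lam + kap with hM
  have hkap : kap = (1 - θ ^ 2) * M := by linear_combination (norm := ring_nf) hM.symm - hθ
  have hlam : 0 ≤ lam := by rw [hθ]; positivity
  have hθ2 : 0 ≤ 1 - θ := sub_nonneg.2 h1
  -- Recentring the quadratic from `c` to `x`; the cross term with `x - c` is kept.
  have hz : ∀ z, F x + kap / 2 * ‖x - y‖ ^ 2 - e + M / 2 * ‖z - x‖ ^ 2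
      + M * inner ℝ (z - x) (x - c) ≤ F z + kap / 2 * ‖z - y‖ ^ 2 := by
    intro z
    have e1 : z - c = (z - x) + (x - c) := by abel
    have h := hprox z
    rw [e1, norm_add_sq_real] at h
    have : 0 ≤ M / 2 * ‖x - c‖ ^ 2 := by positivity
    linarith
  have hA := mul_le_mul_of_nonneg_left (hz xs) h0.le
  have hB := mul_le_mul_of_nonneg_left (hz u) hθ2
  -- With the weights `θ` and `1 - θ`, the two cross terms combine into one along `v' - xs`, the
  -- vector occurring in the Lyapunov function. Its size can therefore be bounded by the square root
  -- of that function.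
  have hcross : θ * inner ℝ (xs - x) (x - c) + (1 - θ) * inner ℝ (u - x) (x - c)
      = - (θ * inner ℝ (v' - xs) (x - c)) := by
    have e2 : θ • (xs - x) + (1 - θ) • (u - x) = - (θ • (v' - xs)) := by
      rw [smul_sub θ v' xs, hv]; module
    have := congrArg (fun w => inner ℝ w (x - c)) e2
    simpa [inner_add_left, inner_smul_left] using this
  have hin : M * θ * inner ℝ (v' - xs) (x - c)
      ≤ 2 * √e * √(F x - Fs + lam / 2 * ‖v' - xs‖ ^ 2) := by
    have a1 : M * θ * inner ℝ (v' - xs) (x - c) ≤ M * θ * (‖v' - xs‖ * ‖x - c‖) := by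
      gcongr; exact real_inner_le_norm _ _
    refine a1.trans ?_
    rw [mul_assoc 2, ← Real.sqrt_mul he]
    have : M * θ * (‖v' - xs‖ * ‖x - c‖) / 2
        ≤ √(e * (F x - Fs + lam / 2 * ‖v' - xs‖ ^ 2)) := by
      apply Real.le_sqrt_of_sq_le
      calc (M * θ * (‖v' - xs‖ * ‖x - c‖) / 2) ^ 2
          = (M / 2 * ‖x - c‖ ^ 2) * (θ ^ 2 * M / 2 * ‖v' - xs‖ ^ 2) := by ring
        _ ≤ e * (F x - Fs + lam / 2 * ‖v' - xs‖ ^ 2) := by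
          rw [← hθ]
          gcongr
          linarith
    linarith
  have hid := acceleration_identity h0 (x - xs) (u - xs) (v - xs)
  have hyy : (1 + θ)⁻¹ • (u - xs + θ • (v - xs)) = y - xs := by
    have : u - xs + θ • (v - xs) = (1 + θ) • (y - xs) := by
      rw [smul_sub (1 + θ), hy]; module
    rw [this, smul_smul, inv_mul_cancel₀ (by positivity), one_smul]
  have hvv : x - xs - (1 - θ) • (u - xs) = θ • (v' - xs) := by
    rw [smul_sub θ, hv]; module
  rw [hyy, hvv, sub_sub_sub_cancel_right, sub_sub_sub_cancel_right, sub_sub_sub_cancel_right,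
    norm_smul θ (v' - xs), Real.norm_of_nonneg h0.le, mul_pow] at hid
  have hnn : 0 ≤ (1 - θ) * ‖θ • (v - xs) - θ • (v' - xs)‖ ^ 2
      + θ * ‖θ • (v' - xs) - θ • (x - xs)‖ ^ 2 + θ ^ 2 * (1 - θ) * ‖u - x‖ ^ 2 := by positivity
  have hid2 := mul_le_mul_of_nonneg_left (sub_nonneg.1 ((sub_eq_of_eq_add' hid) ▸ hnn))
    (show 0 ≤ M / 2 by positivity)
  rw [norm_sub_rev y xs, norm_sub_rev x xs] at hid2
  rw [hFs] at hA
  have hc2 := congrArg (fun t => M * t) hcross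
  have e5 : lam / 2 * ‖v' - xs‖ ^ 2 = M / 2 * (θ ^ 2 * ‖v' - xs‖ ^ 2) := by
    rw [show lam = θ ^ 2 * M from hθ]; ring
  have e6 : lam / 2 * ‖v - xs‖ ^ 2 = M / 2 * (θ ^ 2 * ‖v - xs‖ ^ 2) := by
    rw [show lam = θ ^ 2 * M from hθ]; ring
  rw [hkap] at hA hB
  rw [e5] at hin ⊢
  rw [e6]
  linarith

/-- Completing the square in `√W` leaves `2 * e` on the right, which fits into `(3/2 * √e) ^ 2`. -/
theorem sqrt_recursion {V W θ e : ℝ} (hV : 0 ≤ V) (hW : 0 ≤ W) (h1 : 0 ≤ 1 - θ)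
    (he : 0 ≤ e) (h : W ≤ (1 - θ) * V + e + 2 * √e * √W) :
    √W ≤ √(1 - θ) * √V + 5 / 2 * √e := by
  have hsq : (√W - √e) ^ 2 ≤ (√(1 - θ) * √V + 3 / 2 * √e) ^ 2 := by
    have e1 := Real.sq_sqrt hV
    have e2 := Real.sq_sqrt hW
    have e3 := Real.sq_sqrt he
    have e4 := Real.sq_sqrt h1
    have n1 : 0 ≤ √(1 - θ) * √V * √e := by positivity
    calc (√W - √e) ^ 2 = W + e - 2 * √e * √W := by rw [sub_sq, e2, e3]; ring
      _ ≤ (1 - θ) * V + 9 / 4 * e + 3 * (√(1 - θ) * √V * √e) := by linarith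
      _ = _ := by rw [add_sq, mul_pow, mul_pow, e1, e3, e4]; ring
  have := abs_le_of_sq_le_sq' hsq (by positivity)
  linarith [this.2]

/-- In square roots the recursion is linear with factor `√(1 - θ)`, driven by errors decaying like
`√(1 - ρ) ^ k`. As `ρ < θ`, the slower rate wins, and the difference of the two factors is at least
`(θ - ρ) / 2`. -/
theorem accelerated_rate {V : ℕ → ℝ} {θ ρ g : ℝ} (hρ : 0 < ρ) (hθ : ρ < θ) (h1 : θ ≤ 1)
    (hg : 0 ≤ g) (hV : ∀ k, 0 ≤ V k) (hV0 : V 0 ≤ 2 * g) {k : ℕ}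
    (hstep : ∀ j < k, V (j + 1) ≤ (1 - θ) * V j + 2 / 9 * g * (1 - ρ) ^ (j + 1)
      + 2 * √(2 / 9 * g * (1 - ρ) ^ (j + 1)) * √(V (j + 1))) :
    V k ≤ 9 / (θ - ρ) ^ 2 * g * (1 - ρ) ^ k := by
  have hρ1 : 0 < 1 - ρ := by linarith
  have hθ1 : 0 ≤ 1 - θ := by linarith
  have hdiff : 0 < θ - ρ := by linarith
  set b := √(1 - ρ) with hb
  set a := √(1 - θ) with ha
  have hb2 : b ^ 2 = 1 - ρ := Real.sq_sqrt hρ1.le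
  have ha2 : a ^ 2 = 1 - θ := Real.sq_sqrt hθ1
  have hb0 : 0 < b := Real.sqrt_pos.2 hρ1
  have ha0 : 0 ≤ a := Real.sqrt_nonneg _
  have hab : a ≤ b := Real.sqrt_le_sqrt (by linarith)
  have hb1 : b ≤ 1 := Real.sqrt_le_one.2 (by linarith)
  have hsg := Real.sqrt_nonneg g
  have key : ∀ j ≤ k, √(V j) ≤ 3 / (θ - ρ) * √g * b ^ j := by
    intro j
    induction j with
    | zero =>
      intro _
      rw [pow_zero, mul_one]
      have h3 : (3 : ℝ) ≤ 3 / (θ - ρ) := by rw [le_div_iff₀ hdiff]; nlinarith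
      calc √(V 0) ≤ √(3 ^ 2 * g) := Real.sqrt_le_sqrt (by linarith)
        _ = 3 * √g := by rw [Real.sqrt_mul (by positivity), Real.sqrt_sq (by norm_num)]
        _ ≤ _ := by gcongr
    | succ j ih =>
      intro hj
      have hs := sqrt_recursion (hV j) (hV (j + 1)) hθ1 (by positivity) (hstep j (by omega))
      have e1 : √(2 / 9 * g * (1 - ρ) ^ (j + 1)) ≤ 1 / 2 * √g * b ^ (j + 1) := by
        rw [← hb2, ← pow_mul, mul_comm 2, pow_mul]
        apply Real.sqrt_le_iff.2 ⟨by positivity, ?_⟩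
        rw [mul_pow, mul_pow, Real.sq_sqrt hg]
        gcongr
        norm_num
      have h2 := ih (by omega)
      have h3 : a * √(V j) ≤ a * (3 / (θ - ρ) * √g * b ^ j) := by gcongr
      -- The constant 3 gives `3 / (θ - ρ) * (b - a) ≥ 3/2`, enough for the error coefficient `5/2 *
      -- 1/2 = 5/4`.
      have h4 : a * (3 / (θ - ρ)) + 5 / 4 * b ≤ 3 / (θ - ρ) * b := by
        have : θ - ρ = (b - a) * (b + a) := by nlinarith
        have h5 : (θ - ρ) ≤ (b - a) * 2 := by rw [this]; gcongr; linarith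
        have h6 : 3 / (θ - ρ) * (θ - ρ) ≤ 3 / (θ - ρ) * ((b - a) * 2) := by gcongr
        rw [div_mul_cancel₀ _ hdiff.ne'] at h6
        linarith
      have h5 : (a * (3 / (θ - ρ)) + 5 / 4 * b) * (√g * b ^ j)
          ≤ 3 / (θ - ρ) * b * (√g * b ^ j) := by gcongr
      have e2 : b ^ (j + 1) = b ^ j * b := pow_succ _ _
      rw [e2] at e1 ⊢
      linarith
  have hk := key k le_rfl
  calc V k = √(V k) ^ 2 := (Real.sq_sqrt (hV k)).symm
    _ ≤ (3 / (θ - ρ) * √g * b ^ k) ^ 2 := by gcongr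
    _ = 9 / (θ - ρ) ^ 2 * g * (1 - ρ) ^ k := by
      rw [mul_pow, mul_pow, div_pow, Real.sq_sqrt hg, ← hb2, ← pow_mul, ← pow_mul, mul_comm k]
      norm_num

end ECCatalyst

end

noncomputable section

namespace ECCatalyst

variable {d n m : ℕ} {S S₁ : Type*}

/-! ### The subproblems of Catalyst -/

/-- The deterministic hypotheses on a run. -/
structure Run.Valid (D : Run d n m S S₁) (Λ c₁ c₂ c : ℝ) : Prop where
  n_pos : 0 < n
  m_pos : 0 < m
  primal : D.PrimalAssumption
  ell_le : D.ell ≤ Λ * D.lam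
  δ_pos : 0 < D.δ
  δ_le : D.δ ≤ 1
  δ₁_pos : 0 < D.δ₁
  δ₁_le : D.δ₁ ≤ 1
  kap_nonneg : 0 ≤ D.kap
  ρ_pos : 0 < D.ρ
  ρ_lt : D.ρ < √D.q
  gap_pos : (⨅ x, D.P x) < D.P D.x0
  c₁_pos : 0 < c₁
  c₂_pos : 0 < c₂
  c_pos : 0 < c
  le_p : c₁ * D.δ₁ ≤ D.p
  p_le : D.p ≤ c₂ * D.δ₁
  p_le_one : D.p ≤ 1
  le_step : c ≤ D.η * D.stepScale
  step_le : D.η * D.stepScale ≤ 1 / (128 * (1 + c₂))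

namespace Run.Valid

variable {D : Run d n m S S₁} {Λ c₁ c₂ c : ℝ} (hD : D.Valid Λ c₁ c₂ c)
include hD

/-- A positive gap rules out the one-point space, where the Lipschitz condition would say nothing
about the sign of a smoothness constant. -/
theorem exists_ne : ∃ x, x ≠ D.x0 := by
  obtain ⟨x, hx⟩ := exists_lt_of_ciInf_lt hD.gap_pos
  exact ⟨x, fun h => by rw [h] at hx; exact lt_irrefl _ hx⟩

theorem Lf_nonneg : 0 ≤ D.Lf := hD.primal.smooth_avg.nonneg hD.exists_ne.choose_spec

theorem Lbar_nonneg : 0 ≤ D.Lbar :=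
  (hD.primal.smooth_local ⟨0, hD.n_pos⟩).nonneg hD.exists_ne.choose_spec

theorem L_nonneg : 0 ≤ D.L :=
  (hD.primal.smooth_comp ⟨0, hD.n_pos⟩ ⟨0, hD.m_pos⟩).nonneg hD.exists_ne.choose_spec

theorem lam_le_ell : D.lam ≤ D.ell := by
  obtain ⟨x, hx⟩ := hD.exists_ne
  have h1 := StrongConvexOn.gradient_le hD.primal.strong hD.primal.smooth_reg.1 D.x0 x
  have h2 := hD.primal.smooth_reg.le_quadratic D.x0 x
  have h3 : 0 < ‖x - D.x0‖ ^ 2 := by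
    have := norm_pos_iff.2 (sub_ne_zero.2 hx)
    positivity
  have h4 : D.lam / 2 * ‖x - D.x0‖ ^ 2 ≤ D.ell / 2 * ‖x - D.x0‖ ^ 2 := by linarith
  have := le_of_mul_le_mul_right h4 h3
  linarith

theorem μ_pos : 0 < D.lam + D.kap := by have := hD.primal.lam_pos; have := hD.kap_nonneg; linarith

theorem μ_le_AF : D.lam + D.kap ≤ D.AF := by
  have := hD.Lf_nonneg; have := hD.lam_le_ell; unfold Run.AF; linarith

theorem Abar_pos : 0 < D.Abar := by
  have := hD.Lbar_nonneg; have := hD.lam_le_ell; have := hD.μ_pos; unfold Run.Abar; linarith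

theorem AL_pos : 0 < D.AL := by
  have := hD.L_nonneg; have := hD.lam_le_ell; have := hD.μ_pos; unfold Run.AL; linarith

theorem AF_pos : 0 < D.AF := hD.μ_pos.trans_le hD.μ_le_AF

theorem p_pos : 0 < D.p := (mul_pos hD.c₁_pos hD.δ₁_pos).trans_le hD.le_p

theorem AF_le_stepScale : D.AF ≤ D.stepScale := by
  have h1 := hD.AL_pos
  have h2 : 0 ≤ D.AL / n := by positivity
  have hδ := hD.δ_pos
  have h3 : 0 ≤ √((1 - D.δ) * D.AF * D.Abar) / D.δ := by positivity
  have h4 : 0 ≤ √((1 - D.δ) * D.AF * D.AL) / √D.δ := by positivity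
  unfold Run.stepScale
  linarith

theorem stepScale_pos : 0 < D.stepScale := hD.AF_pos.trans_le hD.AF_le_stepScale

theorem η_pos : 0 < D.η := pos_of_mul_pos_left (hD.c_pos.trans_le hD.le_step) hD.stepScale_pos.le

theorem mean_comp (y : Vec d) (τ : Fin n) :
    mean (D.comp y τ) = fun x => mean (D.f τ) x + (D.ψ x + D.kap / 2 * ‖x - y‖ ^ 2) := by
  ext x
  rw [mean_apply, mean_apply]
  simp only [Run.comp, mean_add, mean_const hD.m_pos, add_assoc]

theorem objective_comp (y : Vec d) : objective (D.comp y) = D.G y := by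
  ext x
  rw [objective, mean_apply]
  simp only [hD.mean_comp]
  rw [mean_add, mean_const hD.n_pos, Run.G, Run.P, mean_apply, add_assoc]

theorem hasGradientAt_P (x : Vec d) :
    HasGradientAt D.P (gradient (mean fun τ => mean (D.f τ)) x + gradient D.ψ x) x :=
  HasGradientAt.add (hD.primal.smooth_avg.hasGradientAt x) (hD.primal.smooth_reg.hasGradientAt x)

theorem P_strong (x y : Vec d) :
    D.P x + Inner.inner ℝ (gradient D.P x) (y - x) + D.lam / 2 * ‖y - x‖ ^ 2 ≤ D.P y := by
  have hc : ConvexOn ℝ Set.univ (mean fun τ => mean (D.f τ)) :=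
    ConvexOn.mean fun τ => ConvexOn.mean (hD.primal.convex τ)
  have h1 := ConvexOn.gradient_le hc hD.primal.smooth_avg.1 x y
  have h2 := StrongConvexOn.gradient_le hD.primal.strong hD.primal.smooth_reg.1 x y
  rw [(hD.hasGradientAt_P x).gradient, inner_add_left]
  unfold Run.P
  linarith

theorem hasGradientAt_G (y x : Vec d) :
    HasGradientAt (D.G y) (gradient D.P x + D.kap • (x - y)) x :=
  HasGradientAt.add (hD.hasGradientAt_P x).differentiableAt.hasGradientAt
    (hasGradientAt_half_normSq D.kap y x)

theorem G_strong (c x y : Vec d) :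
    D.G c x + Inner.inner ℝ (gradient (D.G c) x) (y - x) + (D.lam + D.kap) / 2 * ‖y - x‖ ^ 2
      ≤ D.G c y := by
  have h := hD.P_strong x y
  rw [(hD.hasGradientAt_G c x).gradient, inner_add_left, inner_smul_left]
  have e : y - c = (x - c) + (y - x) := by abel
  simp only [Run.G, e, norm_add_sq_real, conj_trivial]
  linarith

theorem subproblem (y : Vec d) :
    Subproblem (D.comp y) D.AF D.Abar D.AL (D.lam + D.kap) where
  n_pos := hD.n_pos
  m_pos := hD.m_pos
  convex τ i := by
    have h1 : ConvexOn ℝ Set.univ D.ψ := by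
      refine hD.primal.strong.convexOn fun r => ?_
      have := hD.primal.lam_pos
      positivity
    have h2 : ConvexOn ℝ Set.univ fun x : Vec d => D.kap / 2 * ‖x - y‖ ^ 2 := by
      have := ((convexOn_dist y (convex_univ (𝕜 := ℝ))).pow (fun _ _ => dist_nonneg) 2).smul
        (show 0 ≤ D.kap / 2 from by have := hD.kap_nonneg; positivity)
      simpa [dist_eq_norm] using this
    exact ((hD.primal.convex τ i).add h1).add h2
  smooth_comp τ i := ((hD.primal.smooth_comp τ i).add hD.primal.smooth_reg).add
    (isSmooth_half_normSq hD.kap_nonneg y)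
  smooth_local τ := by
    rw [hD.mean_comp, Run.Abar, add_assoc]
    exact (hD.primal.smooth_local τ).add
      (hD.primal.smooth_reg.add (isSmooth_half_normSq hD.kap_nonneg y))
  smooth_avg := by
    rw [hD.objective_comp]
    exact (hD.primal.smooth_avg.add hD.primal.smooth_reg).add (isSmooth_half_normSq hD.kap_nonneg y)
  strong := by
    rw [hD.objective_comp]
    exact hD.G_strong y
  μ_pos := hD.μ_pos
  μ_le := hD.μ_le_AF
  A_pos := hD.AL_pos
  Ab_pos := hD.Abar_pos

theorem P_exists_min : ∃ x, ∀ y, D.P x ≤ D.P y :=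
  exists_minimizer hD.primal.lam_pos (fun x => (hD.hasGradientAt_P x).differentiableAt) hD.P_strong

theorem G_exists_min (c : Vec d) : ∃ x, ∀ y, D.G c x ≤ D.G c y := by
  have := (hD.subproblem c).exists_min
  rwa [hD.objective_comp] at this

theorem subopt_comp (y x : Vec d) : subopt (D.comp y) x = D.G y x - D.Gstar y := by
  rw [subopt, hD.objective_comp, Run.Gstar, iInf_eq_argmin (hD.G_exists_min y)]

omit hD in
theorem ηTilde_eq : D.ηTilde
    = 4 / (3 * D.p) * refWeight n D.AF D.Abar D.AL D.δ D.δ₁ D.p D.η := rfl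

theorem Φ₃_eq (y : Vec d) (s : InnerState d n) :
    D.Φ₃ y s = potential (D.comp y) (12 * D.AF * D.η / D.δ)
      (192 * (1 - D.δ) * D.AF * D.η ^ 3 / (D.δ ^ 2 * D.δ₁)) D.ηTilde s := by
  have := hD.n_pos
  have := hD.δ_pos
  have := hD.δ₁_pos
  rw [Run.Φ₃, potential, hD.objective_comp, hD.subopt_comp, mean_real, mean_real]
  congr 1
  congr 1
  · congr 1
    field_simp
  · field_simp

theorem half_normSq_le_G (y x : Vec d) :
    (D.lam + D.kap) / 2 * ‖x - argmin (D.G y)‖ ^ 2 ≤ D.G y x - D.Gstar y := by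
  have := (hD.subproblem y).half_normSq_le_subopt x
  rwa [hD.objective_comp, hD.subopt_comp] at this

theorem gap_eq : D.gap = D.P D.x0 - D.P (argmin D.P) := by
  rw [Run.gap, iInf_eq_argmin hD.P_exists_min]

theorem half_normSq_le_P (x : Vec d) :
    D.lam / 2 * ‖x - argmin D.P‖ ^ 2 ≤ D.P x - D.P (argmin D.P) := by
  have := hD.P_strong (argmin D.P) x
  rw [gradient_argmin hD.P_exists_min, inner_zero_left] at this
  linarith

theorem argmin_P_le (x : Vec d) : D.P (argmin D.P) ≤ D.P x := argmin_le hD.P_exists_min x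

theorem Gstar_ge (y : Vec d) : D.P (argmin D.P) ≤ D.Gstar y := by
  rw [Run.Gstar]
  refine le_ciInf fun x => (hD.argmin_P_le x).trans ?_
  have := hD.kap_nonneg
  exact le_add_of_nonneg_right (by positivity)

/-! ### Convergence of Catalyst -/

theorem gap_pos' : 0 < D.gap := sub_pos.2 hD.gap_pos

theorem q_pos : 0 < D.q := div_pos hD.primal.lam_pos hD.μ_pos

theorem sqrt_q_pos : 0 < √D.q := Real.sqrt_pos.2 hD.q_pos

theorem sqrt_q_le : √D.q ≤ 1 := by
  refine Real.sqrt_le_one.2 ?_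
  rw [Run.q, div_le_one hD.μ_pos]
  linarith [hD.kap_nonneg]

theorem ρ_lt_one : D.ρ < 1 := hD.ρ_lt.trans_le hD.sqrt_q_le

/-- `√q` is a fixed point: for `α² = q` the recursion reads `q = (1 - α) * q + q * α`. -/
theorem α_eq (k : ℕ) : D.α k = √D.q := by
  induction k with
  | zero => rfl
  | succ k ih =>
    have h := Real.sq_sqrt hD.q_pos.le
    rw [Run.α, ih, h, sub_self, zero_add, zero_pow two_ne_zero, zero_add,
      show (4 : ℝ) * D.q = 2 ^ 2 * D.q by norm_num, Real.sqrt_mul (by norm_num),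
      Real.sqrt_sq (by norm_num)]
    ring

theorem β_eq (k : ℕ) : D.β k = (1 - √D.q) / (1 + √D.q) := by
  have := hD.sqrt_q_pos
  rw [Run.β, hD.α_eq, hD.α_eq]
  field_simp
  ring

theorem rate {x y : ℕ → Vec d} (hx0 : x 0 = D.x0) (hy0 : y 0 = D.x0)
    (hy : ∀ k, y (k + 1) = x (k + 1) + D.β k • (x (k + 1) - x k)) {k : ℕ}
    (hsub : ∀ j < k, D.G (y j) (x (j + 1)) - D.Gstar (y j) ≤ D.ε (j + 1)) :
    D.P (x k) - D.P (argmin D.P) ≤ 9 / (√D.q - D.ρ) ^ 2 * D.gap * (1 - D.ρ) ^ k := by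
  set θ := √D.q with hθ
  have hθ0 : 0 < θ := hD.sqrt_q_pos
  have hθ2 : θ ^ 2 = D.q := Real.sq_sqrt hD.q_pos.le
  have hgap := hD.gap_pos'
  have hlam := hD.primal.lam_pos
  have hμ := hD.μ_pos
  have hρ1 : 0 < 1 - D.ρ := by linarith [hD.ρ_lt_one]
  -- Nesterov's auxiliary sequence. Its start at `x⁰` matches `y⁰ = x⁰`, and with the constant `β`
  -- the extrapolation becomes `(1 + θ) y = x + θ v` at every step.
  let v : ℕ → Vec d := fun k => Nat.casesOn k D.x0 fun j => x j + θ⁻¹ • (x (j + 1) - x j)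
  have hv0 : v 0 = D.x0 := rfl
  have hv : ∀ j, v (j + 1) = x j + θ⁻¹ • (x (j + 1) - x j) := fun j => rfl
  have hv' : ∀ j, θ • v (j + 1) = x (j + 1) - (1 - θ) • x j := by
    intro j
    rw [hv, smul_add, smul_smul, mul_inv_cancel₀ hθ0.ne', one_smul]
    module
  have hyv : ∀ j, (1 + θ) • y j = x j + θ • v j := by
    intro j
    cases j with
    | zero => rw [hx0, hy0, hv0]; module
    | succ j =>
      rw [hv', hy, hD.β_eq, smul_add, smul_smul, mul_div_cancel₀ _ (by positivity)]
      module
  let V : ℕ → ℝ := fun k => D.P (x k) - D.P (argmin D.P) + D.lam / 2 * ‖v k - argmin D.P‖ ^ 2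
  have hVP : ∀ j, D.P (x j) - D.P (argmin D.P) ≤ V j := fun j =>
    le_add_of_nonneg_right (by positivity)
  have hV : ∀ j, 0 ≤ V j := fun j => (sub_nonneg.2 (hD.argmin_P_le _)).trans (hVP j)
  refine (hVP k).trans (accelerated_rate hD.ρ_pos hD.ρ_lt hD.sqrt_q_le hgap.le hV ?_ ?_)
  · have := hD.half_normSq_le_P D.x0
    simp only [V, hv0, hx0]
    rw [hD.gap_eq]
    linarith
  · intro j hj
    have hε : D.ε (j + 1) = 2 / 9 * D.gap * (1 - D.ρ) ^ (j + 1) := rfl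
    rw [← hε]
    have hsj := hsub j hj
    refine accelerated_step_le (kap := D.kap) (c := argmin (D.G (y j))) hθ0 hD.sqrt_q_le hμ ?_ ?_
      (hyv j) (hv' j) rfl ?_ ((hD.half_normSq_le_G _ _).trans hsj) (hD.argmin_P_le _)
    · rw [hθ2, Run.q]; field_simp
    · rw [hε]; positivity
    · intro z
      have h1 := hD.half_normSq_le_G (y j) z
      have e1 : D.P (x (j + 1)) + D.kap / 2 * ‖x (j + 1) - y j‖ ^ 2 = D.G (y j) (x (j + 1)) := rfl
      have e2 : D.P z + D.kap / 2 * ‖z - y j‖ ^ 2 = D.G (y j) z := rfl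
      rw [e1, e2]
      linarith

end Run.Valid

end ECCatalyst

end

noncomputable section

namespace ECCatalyst

variable {d n m : ℕ} {S S₁ : Type*}

/-! ### Crude bounds on all constants -/

/-- Numerical factors up to 8 are swallowed by one more power of `R`. Exponents need no care, since
only `log R` enters the final bound. -/
theorem mul_pow_le_pow {R c : ℝ} (hR : 8 ≤ R) (hc : c ≤ 8) {i j : ℕ} (hij : i + 1 ≤ j) :
    c * R ^ i ≤ R ^ j := by
  calc c * R ^ i ≤ R * R ^ i := by gcongr; linarith
    _ = R ^ (i + 1) := (pow_succ' R i).symm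
    _ ≤ R ^ j := pow_le_pow_right₀ (by linarith) hij

/-- All constants of a run are bounded by a power of `R`. -/
structure Run.SizeBound (D : Run d n m S S₁) (Λ c₁ c₂ c R : ℝ) : Prop where
  le_R : 8 ≤ R
  δ : 1 ≤ R * D.δ
  δ₁ : 1 ≤ R * D.δ₁
  lam : D.lam ≤ R
  lam_inv : 1 ≤ R * D.lam
  kap : D.kap ≤ R
  Lf : D.Lf ≤ R
  diff : 1 ≤ R * (√D.q - D.ρ)
  Lbar : D.Lbar ≤ 2 * R ^ 2
  L : D.L ≤ 2 * R ^ 2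
  Λ : Λ ≤ R
  c₁ : 1 ≤ R * c₁
  c₂ : c₂ ≤ R
  c : 1 ≤ R * c

namespace Run.Valid

variable {D : Run d n m S S₁} {Λ c₁ c₂ c : ℝ} (hD : D.Valid Λ c₁ c₂ c)
include hD

omit hD in
theorem initErr_nonneg : 0 ≤ D.initErr := mean_nonneg fun τ => by positivity

theorem logArg_extra_nonneg (k : ℕ) : 0 ≤ if k = 0 then D.initErr / D.gap else 0 := by
  split_ifs
  · exact div_nonneg initErr_nonneg hD.gap_pos'.le
  · exact le_rfl

theorem logArg_parts (k : ℕ) : 2 ≤ D.logArg k ∧ 1 / D.δ ≤ D.logArg k ∧ 1 / D.δ₁ ≤ D.logArg k ∧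
    D.lam ≤ D.logArg k ∧ 1 / D.lam ≤ D.logArg k ∧ D.kap ≤ D.logArg k ∧ D.Lf ≤ D.logArg k ∧
    (n : ℝ) * m ≤ D.logArg k ∧ 1 / (√D.q - D.ρ) ≤ D.logArg k ∧
    D.Lbar - n * D.Lf ≤ D.logArg k ∧ D.L - n * m * D.Lf ≤ D.logArg k ∧
    (if k = 0 then D.initErr / D.gap else 0) ≤ D.logArg k := by
  have h1 := hD.logArg_extra_nonneg k
  have h2 := hD.δ_pos
  have h3 := hD.δ₁_pos
  have h4 := hD.primal.lam_pos
  have h5 := hD.kap_nonneg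
  have h6 := hD.Lf_nonneg
  have h7 : 0 < √D.q - D.ρ := sub_pos.2 hD.ρ_lt
  have g2 : 0 < 1 / D.δ := by positivity
  have g3 : 0 < 1 / D.δ₁ := by positivity
  have g4 : 0 < 1 / D.lam := by positivity
  have g7 : 0 < 1 / (√D.q - D.ρ) := by positivity
  have g8 : (0 : ℝ) ≤ n * m := by positivity
  have m1 := le_max_left 0 (D.Lbar - n * D.Lf)
  have m2 := le_max_left 0 (D.L - n * m * D.Lf)
  have m3 := le_max_right 0 (D.Lbar - n * D.Lf)
  have m4 := le_max_right 0 (D.L - n * m * D.Lf)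
  unfold Run.logArg
  refine ⟨?_, ?_, ?_, ?_, ?_, ?_, ?_, ?_, ?_, ?_, ?_, ?_⟩ <;> linarith

theorem sizeBound (k : ℕ) :
    D.SizeBound Λ c₁ c₂ c ((4 + |Λ| + 1 / c + 1 / c₁ + c₂) * D.logArg k) := by
  obtain ⟨h0, h1, h2, h3, h4, h5, h6, h7, h8, h9, h10, -⟩ := hD.logArg_parts k
  set M := D.logArg k
  set K := 4 + |Λ| + 1 / c + 1 / c₁ + c₂ with hK
  have a1 := hD.c_pos
  have a2 := hD.c₁_pos
  have a3 := hD.c₂_pos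
  have b1 : 0 < 1 / c := by positivity
  have b2 : 0 < 1 / c₁ := by positivity
  have b3 := abs_nonneg Λ
  have hK4 : 4 ≤ K := by linarith
  have hKM : K ≤ K * M := by nlinarith
  have hM : M ≤ K * M := by nlinarith
  have hinv : ∀ {t R : ℝ}, 0 < t → 1 / t ≤ R → 1 ≤ R * t := fun ht h => (div_le_iff₀ ht).1 h
  -- `Lbar` is at most `n * Lf` plus a term of the logarithm's argument, hence of order `R ^ 2`;
  -- similarly for `L` below.
  have nLf : (n : ℝ) * D.Lf ≤ M * M := by
    have : (1 : ℝ) ≤ m := by exact_mod_cast hD.m_pos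
    have hn : (n : ℝ) ≤ n * m := le_mul_of_one_le_right (by positivity) this
    exact mul_le_mul (hn.trans h7) h6 hD.Lf_nonneg (by linarith)
  have nmLf : (n : ℝ) * m * D.Lf ≤ M * M := mul_le_mul h7 h6 hD.Lf_nonneg (by linarith)
  have hMM : M + M * M ≤ 2 * (K * M) ^ 2 := by
    have : M * M ≤ (K * M) ^ 2 := by rw [sq]; gcongr
    nlinarith
  exact {
    le_R := by nlinarith
    δ := hinv hD.δ_pos (h1.trans hM)
    δ₁ := hinv hD.δ₁_pos (h2.trans hM)
    lam := h3.trans hM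
    lam_inv := hinv hD.primal.lam_pos (h4.trans hM)
    kap := h5.trans hM
    Lf := h6.trans hM
    diff := hinv (sub_pos.2 hD.ρ_lt) (h8.trans hM)
    Lbar := by linarith
    L := by linarith
    Λ := (le_abs_self Λ).trans ((by linarith : |Λ| ≤ K).trans hKM)
    c₁ := hinv a2 ((by linarith : 1 / c₁ ≤ K).trans hKM)
    c₂ := (by linarith : c₂ ≤ K).trans hKM
    c := hinv a1 ((by linarith : 1 / c ≤ K).trans hKM) }

/-! ### Sizes of the stepsize and of the weights in the potential -/

theorem stepsize : D.AF * D.η ≤ 1 / 4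
    ∧ refWeight n D.AF D.Abar D.AL D.δ D.δ₁ D.p D.η ≤ D.η / 4 :=
  stepsize_bounds hD.AF_pos hD.Abar_pos hD.AL_pos hD.δ_pos hD.δ_le hD.δ₁_pos hD.p_pos hD.η_pos
    hD.c₂_pos hD.p_le hD.step_le

theorem refWeight_nonneg : 0 ≤ refWeight n D.AF D.Abar D.AL D.δ D.δ₁ D.p D.η := by
  have := hD.AF_pos
  have := hD.Abar_pos
  have := hD.AL_pos
  have := hD.δ_pos
  have := hD.δ₁_pos
  have := hD.p_pos
  have := hD.η_pos
  have : 0 ≤ 1 - D.δ := sub_nonneg.2 hD.δ_le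
  unfold refWeight
  positivity

theorem ηTilde_nonneg : 0 ≤ D.ηTilde := by
  rw [ηTilde_eq]
  have := hD.p_pos
  have := hD.refWeight_nonneg
  positivity

variable {R : ℝ} (hR : D.SizeBound Λ c₁ c₂ c R)
include hR

theorem ell_le_pow : D.ell ≤ R ^ 2 := by
  have h1 := hD.primal.lam_pos
  have h2 := hR.le_R
  calc D.ell ≤ Λ * D.lam := hD.ell_le
    _ ≤ R * R := mul_le_mul hR.Λ hR.lam h1.le (by linarith)
    _ = R ^ 2 := (sq R).symm

theorem constants_le_pow : D.AF ≤ R ^ 3 ∧ D.Abar ≤ R ^ 3 ∧ D.AL ≤ R ^ 3 := by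
  have h1 := hD.ell_le_pow hR
  have h2 := hR.le_R
  have h3 : R ≤ R ^ 2 := by nlinarith
  have h4 := mul_pow_le_pow h2 (le_refl 8) (show 2 + 1 ≤ 3 by norm_num)
  have := hR.kap
  have := hR.Lf
  have := hR.Lbar
  have := hR.L
  unfold Run.AF Run.Abar Run.AL
  refine ⟨?_, ?_, ?_⟩ <;> linarith

theorem stepScale_le : D.stepScale ≤ R ^ 5 := by
  obtain ⟨h1, h2, h3⟩ := hD.constants_le_pow hR
  have hR8 := hR.le_R
  have hδ := hD.δ_pos
  have hδ1 := hD.δ_le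
  have p1 := hD.AF_pos
  have p2 := hD.Abar_pos
  have p3 := hD.AL_pos
  have hs : ∀ t, 0 < t → t ≤ R ^ 3 → √((1 - D.δ) * D.AF * t) ≤ R ^ 3 := by
    intro t t0 ht
    refine Real.sqrt_le_iff.2 ⟨by positivity, ?_⟩
    calc (1 - D.δ) * D.AF * t ≤ 1 * R ^ 3 * R ^ 3 := by
          gcongr
          · linarith
      _ = (R ^ 3) ^ 2 := by ring
  have q1 : D.AL / n ≤ R ^ 3 := by
    have hn : (1 : ℝ) ≤ n := by exact_mod_cast hD.n_pos
    exact (div_le_self p3.le hn).trans h3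
  have q2 : √((1 - D.δ) * D.AF * D.Abar) / D.δ ≤ R ^ 4 := by
    rw [div_le_iff₀ hδ]
    calc _ ≤ R ^ 3 := hs _ p2 h2
      _ ≤ R ^ 3 * (R * D.δ) := le_mul_of_one_le_right (by positivity) hR.δ
      _ = R ^ 4 * D.δ := by ring
  have q3 : √((1 - D.δ) * D.AF * D.AL) / √D.δ ≤ R ^ 4 := by
    rw [div_le_iff₀ (Real.sqrt_pos.2 hδ)]
    have : D.δ ≤ √D.δ := Real.le_sqrt_of_sq_le (by nlinarith)
    calc _ ≤ R ^ 3 := hs _ p3 h3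
      _ ≤ R ^ 3 * (R * D.δ) := le_mul_of_one_le_right (by positivity) hR.δ
      _ = R ^ 4 * D.δ := by ring
      _ ≤ R ^ 4 * √D.δ := by gcongr
  have q4 : R ^ 3 ≤ R ^ 4 := pow_le_pow_right₀ (by linarith) (by norm_num)
  have q5 := mul_pow_le_pow hR8 (le_refl 8) (show 4 + 1 ≤ 5 by norm_num)
  have : 0 ≤ R ^ 4 := by positivity
  unfold Run.stepScale
  linarith

theorem one_le_mul_η : 1 ≤ R ^ 6 * D.η := by
  have hη := hD.η_pos
  have hR8 := hR.le_R
  calc 1 ≤ R * c := hR.c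
    _ ≤ R * (D.η * D.stepScale) := by gcongr; exact hD.le_step
    _ ≤ R * (D.η * R ^ 5) := by gcongr; exact hD.stepScale_le hR
    _ = R ^ 6 * D.η := by ring

theorem η_le : D.η ≤ R := by
  have hη := hD.η_pos
  have hlam := hD.primal.lam_pos
  have h1 : D.lam ≤ D.AF := by have := hD.μ_le_AF; have := hD.kap_nonneg; linarith
  have hR8 := hR.le_R
  have h2 : D.lam * D.η ≤ 1 := by
    have : D.lam * D.η ≤ D.AF * D.η := by gcongr
    linarith [hD.stepsize.1]
  calc D.η ≤ (R * D.lam) * D.η := le_mul_of_one_le_left hη.le hR.lam_inv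
    _ = R * (D.lam * D.η) := by ring
    _ ≤ R * 1 := by gcongr
    _ = R := mul_one R

theorem learnWeight_le : 192 * (1 - D.δ) * D.AF * D.η ^ 3 / (D.δ ^ 2 * D.δ₁) ≤ R ^ 7 := by
  have hη := hD.η_pos
  have hδ := hD.δ_pos
  have hδ₁ := hD.δ₁_pos
  have hR8 := hR.le_R
  have hAF := hD.AF_pos
  rw [div_le_iff₀ (by positivity)]
  calc 192 * (1 - D.δ) * D.AF * D.η ^ 3 = 192 * (1 - D.δ) * (D.AF * D.η) * D.η ^ 2 := by ring
    _ ≤ 192 * 1 * (1 / 4) * R ^ 2 := by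
        gcongr
        · linarith
        · exact hD.stepsize.1
        · exact hD.η_le hR
    _ ≤ R ^ 4 := by have : 64 ≤ R ^ 2 := by nlinarith
                    nlinarith
    _ = R ^ 4 * (1 ^ 2 * 1) := by ring
    _ ≤ R ^ 4 * ((R * D.δ) ^ 2 * (R * D.δ₁)) := by
        gcongr
        · exact hR.δ
        · exact hR.δ₁
    _ = R ^ 7 * (D.δ ^ 2 * D.δ₁) := by ring

theorem ηTilde_le : D.ηTilde ≤ R ^ 3 := by
  have hp := hD.p_pos
  have hη := hD.η_pos
  have hR8 := hR.le_R
  have hδ₁ := hD.δ₁_pos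
  have hc₁ := hD.c₁_pos
  rw [ηTilde_eq]
  have h1 : 1 ≤ R ^ 2 * D.p := by
    calc (1 : ℝ) = 1 * 1 := by ring
      _ ≤ (R * c₁) * (R * D.δ₁) := by
        gcongr
        · exact hR.c₁
        · exact hR.δ₁
      _ = R ^ 2 * (c₁ * D.δ₁) := by ring
      _ ≤ R ^ 2 * D.p := by gcongr; exact hD.le_p
  calc 4 / (3 * D.p) * refWeight n D.AF D.Abar D.AL D.δ D.δ₁ D.p D.η
      ≤ 4 / (3 * D.p) * (D.η / 4) := by gcongr; exact hD.stepsize.2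
    _ = D.η / 3 / D.p := by field_simp
    _ ≤ R ^ 3 := by
      rw [div_le_iff₀ hp]
      calc D.η / 3 ≤ R := by linarith [hD.η_le hR]
        _ ≤ R * (R ^ 2 * D.p) := le_mul_of_one_le_right (by linarith) h1
        _ = R ^ 3 * D.p := by ring

omit hR in
-- At the end of a run the gap at `w` is bounded through its weight `ηTilde`. Moving the reference
-- point from `w` to `x` costs the learning weight times `Abar` times this gap, so that product must
-- be dominated by `ηTilde`; `p ≤ c₂ * δ₁` provides this.
theorem learnWeight_mul_le : 192 * (1 - D.δ) * D.AF * D.η ^ 3 / (D.δ ^ 2 * D.δ₁) * D.Abar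
    ≤ c₂ * D.ηTilde := by
  have hη := hD.η_pos
  have hδ := hD.δ_pos
  have hδ₁ := hD.δ₁_pos
  have hp := hD.p_pos
  have hAF := hD.AF_pos
  have hAb := hD.Abar_pos
  have hAL := hD.AL_pos
  have hc₂ := hD.c₂_pos
  have h1 : 0 ≤ 1 - D.δ := sub_nonneg.2 hD.δ_le
  have h2 : 256 * (1 - D.δ) * D.AF * D.η ^ 3 * D.Abar / (D.δ ^ 2 * D.p) ≤ D.ηTilde := by
    have e : D.ηTilde = 256 * (1 - D.δ) * D.AF * D.η ^ 3 * D.Abar / (D.δ ^ 2 * D.p)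
        + 4 / (3 * D.p) * (48 * (1 - D.δ) * D.AF * D.η ^ 3 / D.δ *
          (D.AL + 16 * D.Abar * D.p / (D.δ * D.δ₁) * (1 + 2 * D.p / D.δ₁))
          + 4 * D.AL * D.η ^ 2 / n) := by
      have : (n : ℝ) ≠ 0 := by have := hD.n_pos; positivity
      unfold Run.ηTilde
      field_simp
      ring
    rw [e]
    exact le_add_of_nonneg_right (by positivity)
  calc _ = (192 * (1 - D.δ) * D.AF * D.η ^ 3 * D.Abar / (D.δ ^ 2 * D.p)) * (D.p / D.δ₁) := by
        field_simp
    _ ≤ (256 * (1 - D.δ) * D.AF * D.η ^ 3 * D.Abar / (D.δ ^ 2 * D.p)) * c₂ := by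
        gcongr
        · norm_num
        · rw [div_le_iff₀ hδ₁]; exact hD.p_le
    _ ≤ c₂ * D.ηTilde := by rw [mul_comm]; gcongr

theorem one_le_errorWeight : 1 ≤ R ^ 7 * (12 * D.AF * D.η / D.δ) := by
  have hη := hD.η_pos
  have hδ := hD.δ_pos
  have hR8 := hR.le_R
  have hlam := hD.primal.lam_pos
  have h1 : D.lam ≤ D.AF := by have := hD.μ_le_AF; have := hD.kap_nonneg; linarith
  have h2 : D.AF * D.η ≤ 12 * D.AF * D.η / D.δ := by
    rw [le_div_iff₀ hδ]
    have : 0 ≤ D.AF * D.η := by have := hD.AF_pos; positivity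
    nlinarith [hD.δ_le]
  calc (1 : ℝ) = 1 * 1 := by ring
    _ ≤ (R * D.lam) * (R ^ 6 * D.η) := by
      gcongr
      · exact hR.lam_inv
      · exact hD.one_le_mul_η hR
    _ = R ^ 7 * (D.lam * D.η) := by ring
    _ ≤ R ^ 7 * (D.AF * D.η) := by gcongr
    _ ≤ _ := by gcongr

/-- The potential controls the suboptimality of the current iterate. -/
theorem Φ₃_add_le (y : Vec d) (s : InnerState d n) :
    0 ≤ D.Φ₃ y s ∧ D.Φ₃ y s + D.G y s.x - D.Gstar y ≤ R ^ 7 * D.Φ₃ y s := by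
  have hη := hD.η_pos
  have hδ := hD.δ_pos
  have hδ₁ := hD.δ₁_pos
  have hR8 := hR.le_R
  have hAF := hD.AF_pos
  have h1 : 0 ≤ 1 - D.δ := sub_nonneg.2 hD.δ_le
  have hsub := hD.subproblem y
  rw [hD.Φ₃_eq, potential, hD.objective_comp]
  have g1 := hsub.subopt_le_half_normSq s.x
  rw [hD.objective_comp, hD.subopt_comp] at g1
  have g2 := hsub.subopt_nonneg s.w
  have g3 := hD.ηTilde_nonneg
  have g4 := norm_mean_sq_le hD.n_pos s.e
  have g5 : ‖s.x - argmin (D.G y)‖ ^ 2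
      ≤ 2 * ‖s.x - mean s.e - argmin (D.G y)‖ ^ 2 + 2 * ‖mean s.e‖ ^ 2 := by
    have := norm_sub_sq_le_add (s.x - argmin (D.G y)) 0 (mean s.e)
    rw [sub_zero, zero_sub, norm_neg, sub_right_comm] at this
    exact this
  set X := ‖s.x - mean s.e - argmin (D.G y)‖ ^ 2
  set E := mean (fun τ => ‖s.e τ‖ ^ 2)
  set H := mean (fun τ => ‖s.h τ - gradient (mean (D.comp y τ)) s.w‖ ^ 2)
  have nX : 0 ≤ X := by positivity
  have nE : 0 ≤ E := mean_nonneg fun τ => by positivity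
  have nH : 0 ≤ H := mean_nonneg fun τ => by positivity
  set a := 12 * D.AF * D.η / D.δ with ha
  set b := 192 * (1 - D.δ) * D.AF * D.η ^ 3 / (D.δ ^ 2 * D.δ₁)
  have na : 0 ≤ a := by positivity
  have nb : 0 ≤ b := by positivity
  have nbH : 0 ≤ b * H := by positivity
  have ncW : 0 ≤ D.ηTilde * subopt (D.comp y) s.w := by positivity
  refine ⟨by positivity, ?_⟩
  have k1 : D.AF * X ≤ R ^ 3 * X := by gcongr; exact (hD.constants_le_pow hR).1
  have k2 : D.AF * E ≤ R ^ 6 * (a * E) := by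
    have : D.AF ≤ R ^ 6 * a := by
      have h2 : D.AF ≤ (R ^ 6 * D.η) * D.AF :=
        le_mul_of_one_le_left hAF.le (hD.one_le_mul_η hR)
      have h3 : D.AF * D.η ≤ a := by
        rw [ha, le_div_iff₀ hδ]
        have : 0 ≤ D.AF * D.η := by positivity
        nlinarith [hD.δ_le]
      calc D.AF ≤ R ^ 6 * (D.AF * D.η) := by linarith
        _ ≤ R ^ 6 * a := by gcongr
    calc D.AF * E ≤ R ^ 6 * a * E := by gcongr
      _ = _ := by ring
  set t := X + a * E + b * H + D.ηTilde * subopt (D.comp y) s.w with ht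
  have k3 : R ^ 3 * X ≤ R ^ 6 * X := by
    gcongr
    · linarith
    · norm_num
  have k4 : X + a * E ≤ t := by linarith
  have k5 : R ^ 6 * (X + a * E) ≤ R ^ 6 * t := by gcongr
  have nt : 0 ≤ t := by positivity
  have k6 : D.AF / 2 * ‖s.x - argmin (D.G y)‖ ^ 2 ≤ D.AF / 2 * (2 * X + 2 * E) := by
    gcongr
    linarith
  have k7 : t + R ^ 6 * t ≤ R ^ 7 * t := by
    have : 1 + R ^ 6 ≤ R ^ 7 := by
      have h2 := mul_pow_le_pow hR8 (le_refl 8) (show 6 + 1 ≤ 7 by norm_num)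
      have : (1 : ℝ) ≤ R ^ 6 := one_le_pow₀ (by linarith)
      linarith
    calc t + R ^ 6 * t = (1 + R ^ 6) * t := by ring
      _ ≤ R ^ 7 * t := by gcongr
  linarith

end Run.Valid

end ECCatalyst

end

noncomputable section

namespace ECCatalyst

variable {d n m : ℕ} {S S₁ : Type*}

/-! ### The outer iterations along a path -/

/-- A finite infimum in `ℕ∞` comes from a nonempty set and is attained. For an infinite stopping
time `toNat` returns 0 and nothing is guaranteed about the state, so the path statements below
assume finiteness. -/
theorem Run.stopTime_spec (D : Run d n m S S₁) {k : ℕ} {o : OuterState d n}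
    {r : ℕ → Sample n m S S₁} (h : D.stopTime k o r ≠ ⊤) :
    D.Φ₃ o.y (D.inner k o r (D.stopTime k o r).toNat)
      + D.G o.y (D.inner k o r (D.stopTime k o r).toNat).x - D.Gstar o.y ≤ D.ε (k + 1) := by
  have hne : ((fun K : ℕ => (K : ℕ∞)) '' {K : ℕ | 1 ≤ K ∧
    D.Φ₃ o.y (D.inner k o r K) + D.G o.y (D.inner k o r K).x - D.Gstar o.y ≤ D.ε (k + 1)}).Nonempty := by
    by_contra hne
    rw [Set.not_nonempty_iff_eq_empty] at hne
    exact h (by rw [Run.stopTime, hne, sInf_empty])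
  obtain ⟨K, hK, hKe⟩ := csInf_mem hne
  have : (D.stopTime k o r).toNat = K := by rw [Run.stopTime, ← hKe]; rfl
  rw [this]
  exact hK.2

namespace Run.Valid

variable {D : Run d n m S S₁} {Λ c₁ c₂ c : ℝ} (hD : D.Valid Λ c₁ c₂ c)
include hD

theorem gradient_mean_comp (y : Vec d) (τ : Fin n) (x : Vec d) :
    gradient (mean (D.comp y τ)) x
      = gradient (mean (D.f τ)) x + (gradient D.ψ x + D.kap • (x - y)) := by
  rw [hD.mean_comp]
  exact (HasGradientAt.add ((hD.primal.smooth_local τ).hasGradientAt x)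
    (HasGradientAt.add (hD.primal.smooth_reg.hasGradientAt x)
      (hasGradientAt_half_normSq D.kap y x))).gradient

/-- The state with which an outer iteration ends. -/
theorem exists_final_state {r : ℕ → ℕ → Sample n m S S₁} {k : ℕ} (h : D.T r k ≠ ⊤) :
    ∃ s : InnerState d n, D.outer r (k + 1) =
        { x := s.x, y := s.x + D.β k • (s.x - (D.outer r k).x), yPrev := (D.outer r k).y,
          e := s.e, h := s.h } ∧
      D.Φ₃ (D.outer r k).y s ≤ D.ε (k + 1) ∧
      D.G (D.outer r k).y s.x - D.Gstar (D.outer r k).y ≤ D.ε (k + 1) := by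
  have h1 := D.stopTime_spec h
  set s := D.inner k (D.outer r k) (r k) (D.stopTime k (D.outer r k) (r k)).toNat
  have h2 := hD.half_normSq_le_G (D.outer r k).y s.x
  -- Only nonnegativity of the potential is used, so the index in `sizeBound` is arbitrary.
  have h3 := (hD.Φ₃_add_le (hD.sizeBound 0) (D.outer r k).y s).1
  have hμ := hD.μ_pos
  have h4 : 0 ≤ (D.lam + D.kap) / 2 * ‖s.x - argmin (D.G (D.outer r k).y)‖ ^ 2 := by positivity
  exact ⟨s, rfl, by linarith, by linarith⟩

theorem outer_rate {r : ℕ → ℕ → Sample n m S S₁} {k : ℕ} (hT : ∀ j < k, D.T r j ≠ ⊤) :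
    D.P (D.outer r k).x - D.P (argmin D.P)
      ≤ 9 / (√D.q - D.ρ) ^ 2 * D.gap * (1 - D.ρ) ^ k := by
  refine hD.rate (x := fun k => (D.outer r k).x) (y := fun k => (D.outer r k).y) rfl rfl
    (fun _ => rfl) fun j hj => ?_
  obtain ⟨s, hs, -, h⟩ := hD.exists_final_state (hT j hj)
  simp only [hs]
  exact h

variable {R : ℝ} (hR : D.SizeBound Λ c₁ c₂ c R)
include hR

/-- Passing to the next target accuracy costs one factor `R`, because `1 - ρ ≥ √q - ρ ≥ 1 / R`. -/
theorem geom_le (k : ℕ) : D.gap * (1 - D.ρ) ^ k ≤ R * (D.gap * (1 - D.ρ) ^ (k + 1)) := by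
  have h1 := hR.le_R
  have h2 : 1 ≤ R * (1 - D.ρ) := hR.diff.trans (by gcongr; exact hD.sqrt_q_le)
  have h3 : 0 ≤ 1 - D.ρ := by linarith [hD.ρ_lt_one]
  have h4 := hD.gap_pos'.le
  calc D.gap * (1 - D.ρ) ^ k ≤ (D.gap * (1 - D.ρ) ^ k) * (R * (1 - D.ρ)) :=
        le_mul_of_one_le_right (by positivity) h2
    _ = _ := by ring

theorem outer_gap_le {r : ℕ → ℕ → Sample n m S S₁} {k : ℕ} (hT : ∀ j < k, D.T r j ≠ ⊤) :
    D.P (D.outer r k).x - D.P (argmin D.P) ≤ 9 * R ^ 2 * (D.gap * (1 - D.ρ) ^ k) := by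
  have h0 : 0 < √D.q - D.ρ := sub_pos.2 hD.ρ_lt
  have h1 := hR.le_R
  have h3 : 0 ≤ 1 - D.ρ := by linarith [hD.ρ_lt_one]
  have h4 := hD.gap_pos'.le
  refine (hD.outer_rate hT).trans ?_
  rw [mul_assoc]
  gcongr
  rw [div_le_iff₀ (by positivity)]
  have : 1 ≤ (R * (√D.q - D.ρ)) ^ 2 := one_le_pow₀ hR.diff
  linarith

theorem norm_outer_x_sq_le {r : ℕ → ℕ → Sample n m S S₁} {k : ℕ} (hT : ∀ j < k, D.T r j ≠ ⊤) :
    ‖(D.outer r k).x - argmin D.P‖ ^ 2 ≤ R ^ 5 * (D.gap * (1 - D.ρ) ^ k) := by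
  have h1 := hR.le_R
  have h2 := hD.primal.lam_pos
  have h3 : 0 ≤ 1 - D.ρ := by linarith [hD.ρ_lt_one]
  have h4 := hD.gap_pos'.le
  have h5 := (hD.half_normSq_le_P (D.outer r k).x).trans (hD.outer_gap_le hR hT)
  set N := ‖(D.outer r k).x - argmin D.P‖ ^ 2
  have hN : 0 ≤ N := by positivity
  calc N ≤ (R * D.lam) * N := le_mul_of_one_le_left hN hR.lam_inv
    _ = 2 * R * (D.lam / 2 * N) := by ring
    _ ≤ 2 * R * (9 * R ^ 2 * (D.gap * (1 - D.ρ) ^ k)) := by gcongr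
    _ = 18 * R ^ 3 * (D.gap * (1 - D.ρ) ^ k) := by ring
    _ ≤ R ^ 5 * (D.gap * (1 - D.ρ) ^ k) := by
      gcongr
      have := mul_pow_le_pow h1 (le_refl 8) (show 3 + 1 ≤ 4 by norm_num)
      have := mul_pow_le_pow h1 (le_refl 8) (show 4 + 1 ≤ 5 by norm_num)
      have : 0 ≤ R ^ 3 := by positivity
      linarith

theorem norm_outer_y_sq_le {r : ℕ → ℕ → Sample n m S S₁} {k : ℕ} (hT : ∀ j < k, D.T r j ≠ ⊤) :
    ‖(D.outer r k).y - argmin D.P‖ ^ 2 ≤ R ^ 7 * (D.gap * (1 - D.ρ) ^ k) := by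
  have h1 := hR.le_R
  have h3 : 0 ≤ 1 - D.ρ := by linarith [hD.ρ_lt_one]
  have h4 := hD.gap_pos'.le
  have hx := hD.norm_outer_x_sq_le hR hT
  have e57 : R ^ 5 ≤ R ^ 7 := pow_le_pow_right₀ (by linarith) (by norm_num)
  cases k with
  | zero =>
    refine hx.trans ?_
    gcongr
  | succ k =>
    have hx' := hD.norm_outer_x_sq_le hR (r := r) (k := k) fun j hj => hT j (by omega)
    have hg := hD.geom_le hR k
    have hy : (D.outer r (k + 1)).y - argmin D.P
        = (1 + D.β k) • ((D.outer r (k + 1)).x - argmin D.P)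
          - D.β k • ((D.outer r k).x - argmin D.P) := by
      have : (D.outer r (k + 1)).y = (D.outer r (k + 1)).x
        + D.β k • ((D.outer r (k + 1)).x - (D.outer r k).x) := rfl
      rw [this]
      module
    have hβ0 : 0 ≤ D.β k := by
      rw [hD.β_eq]
      have := hD.sqrt_q_pos
      exact div_nonneg (sub_nonneg.2 hD.sqrt_q_le) (by positivity)
    have hβ1 : D.β k ≤ 1 := by
      rw [hD.β_eq]
      have := hD.sqrt_q_pos
      rw [div_le_one (by positivity)]
      linarith
    have h5 := norm_sub_sq_le_add ((1 + D.β k) • ((D.outer r (k + 1)).x - argmin D.P))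
      (D.β k • ((D.outer r k).x - argmin D.P)) 0
    rw [sub_zero, sub_zero, ← hy, norm_smul, norm_smul, mul_pow, mul_pow, Real.norm_eq_abs,
      Real.norm_eq_abs, sq_abs, sq_abs] at h5
    set a := ‖(D.outer r (k + 1)).x - argmin D.P‖ ^ 2
    set b := ‖(D.outer r k).x - argmin D.P‖ ^ 2
    set t := D.gap * (1 - D.ρ) ^ (k + 1)
    have ht : 0 ≤ t := by positivity
    have h6 : (1 + D.β k) ^ 2 * a ≤ (1 + 1) ^ 2 * a := by gcongr
    have h7 : D.β k ^ 2 * b ≤ 1 ^ 2 * b := by gcongr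
    have h8 : b ≤ R ^ 6 * t := hx'.trans <| by
      calc _ ≤ R ^ 5 * (R * t) := by gcongr
        _ = R ^ 6 * t := by ring
    have h9 : R ^ 5 * 8 * t ≤ R ^ 6 * t := by
      gcongr
      linarith [mul_pow_le_pow h1 (le_refl 8) (show 5 + 1 ≤ 6 by norm_num)]
    have h10 : R ^ 6 * 8 * t ≤ R ^ 7 * t := by
      gcongr
      linarith [mul_pow_le_pow h1 (le_refl 8) (show 6 + 1 ≤ 7 by norm_num)]
    have : 0 ≤ R ^ 6 * t := by positivity
    linarith

theorem outer_subopt_le {r : ℕ → ℕ → Sample n m S S₁} {k : ℕ} (hT : ∀ j < k, D.T r j ≠ ⊤) :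
    D.G (D.outer r k).y (D.outer r k).x - D.Gstar (D.outer r k).y
      ≤ R ^ 10 * (D.gap * (1 - D.ρ) ^ k) := by
  have h1 := hR.le_R
  have h3 : 0 ≤ 1 - D.ρ := by linarith [hD.ρ_lt_one]
  have h4 := hD.gap_pos'.le
  have hx := hD.norm_outer_x_sq_le hR hT
  have hy := hD.norm_outer_y_sq_le hR hT
  have hP := hD.outer_gap_le hR hT
  have hG := hD.Gstar_ge (D.outer r k).y
  have h5 := norm_sub_sq_le_add (D.outer r k).x (D.outer r k).y (argmin D.P)
  have e : D.G (D.outer r k).y (D.outer r k).x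
    = D.P (D.outer r k).x + D.kap / 2 * ‖(D.outer r k).x - (D.outer r k).y‖ ^ 2 := rfl
  rw [e]
  set t := D.gap * (1 - D.ρ) ^ k
  have ht : 0 ≤ t := by positivity
  have h6 : D.kap / 2 * ‖(D.outer r k).x - (D.outer r k).y‖ ^ 2
      ≤ R / 2 * (2 * (R ^ 5 * t) + 2 * (R ^ 7 * t)) := by
    gcongr
    · exact hR.kap
    · linarith
  have h7 : (9 * R ^ 2 + R ^ 6 + R ^ 8) * t ≤ R ^ 10 * t := by
    gcongr
    have a1 := mul_pow_le_pow h1 (le_refl 8) (show 9 + 1 ≤ 10 by norm_num)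
    have a2 : R ^ 8 ≤ R ^ 9 := pow_le_pow_right₀ (by linarith) (by norm_num)
    have a3 : R ^ 6 ≤ R ^ 9 := pow_le_pow_right₀ (by linarith) (by norm_num)
    have a4 := mul_pow_le_pow h1 (le_refl 8) (show 2 + 1 ≤ 3 by norm_num)
    have a5 : R ^ 3 ≤ R ^ 9 := pow_le_pow_right₀ (by linarith) (by norm_num)
    have a6 : R ^ 2 ≤ R ^ 9 := pow_le_pow_right₀ (by linarith) (by norm_num)
    linarith
  linarith

/-! ### Warm start -/

omit hD hR in
theorem norm_add_three_sq_le (a b c : Vec d) :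
    ‖a + b + c‖ ^ 2 ≤ 3 * ‖a‖ ^ 2 + 3 * ‖b‖ ^ 2 + 3 * ‖c‖ ^ 2 := by
  have h := norm_add₃_le (a := a) (b := b) (c := c)
  nlinarith [norm_nonneg (a + b + c), sq_nonneg (‖a‖ - ‖b‖), sq_nonneg (‖b‖ - ‖c‖),
    sq_nonneg (‖a‖ - ‖c‖)]

omit hR in
-- The weight of the errors does not depend on the prox-center, so the bound from the stopping rule
-- of the previous run carries over unchanged.
theorem warm_error_le {r : ℕ → ℕ → Sample n m S S₁} {k : ℕ} (hT : ∀ j < k, D.T r j ≠ ⊤) :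
    12 * D.AF * D.η / D.δ * mean (fun τ => ‖(D.innerInit k (D.outer r k)).e τ‖ ^ 2)
      ≤ D.gap * (1 - D.ρ) ^ k := by
  have h3 : 0 ≤ 1 - D.ρ := by linarith [hD.ρ_lt_one]
  have h4 := hD.gap_pos'.le
  have hz : 12 * D.AF * D.η / D.δ * mean (fun _ : Fin n => ‖(0 : Vec d)‖ ^ 2)
      ≤ D.gap * (1 - D.ρ) ^ k := by
    rw [mean_const hD.n_pos]; simp; positivity
  have he : (D.innerInit k (D.outer r k)).e = if D.carryE k then (D.outer r k).e else fun _ => 0 :=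
    rfl
  rw [he]
  split_ifs
  swap
  · exact hz
  cases k with
  | zero => exact hz
  | succ k =>
    obtain ⟨s, hs, hΦ, -⟩ := hD.exists_final_state (hT k (by omega))
    rw [hs]
    rw [hD.Φ₃_eq, potential] at hΦ
    have := hD.AF_pos
    have := hD.η_pos
    have := hD.δ_pos
    have := hD.δ₁_pos
    have := hD.ηTilde_nonneg
    have hδ : 0 ≤ 1 - D.δ := sub_nonneg.2 hD.δ_le
    have n1 := mean_nonneg fun τ => sq_nonneg ‖s.h τ - gradient (mean (D.comp (D.outer r k).y τ)) s.w‖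
    have n2 := (hD.subproblem (D.outer r k).y).subopt_nonneg s.w
    have n3 := sq_nonneg ‖s.x - mean s.e - argmin (objective (D.comp (D.outer r k).y))‖
    have n4 : 0 ≤ 192 * (1 - D.δ) * D.AF * D.η ^ 3 / (D.δ ^ 2 * D.δ₁)
      * mean (fun τ => ‖s.h τ - gradient (mean (D.comp (D.outer r k).y τ)) s.w‖ ^ 2) := by
      positivity
    have n5 : 0 ≤ D.ηTilde * subopt (D.comp (D.outer r k).y) s.w := by positivity
    have n6 : D.ε (k + 1) ≤ D.gap * (1 - D.ρ) ^ (k + 1) := by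
      have : 0 ≤ D.gap * (1 - D.ρ) ^ (k + 1) := by positivity
      unfold Run.ε
      linarith
    linarith

/-- The new learning error splits into the final one of the previous run, the change of the local
gradients from `w` to `x`, and the effect of the moved prox-center. The stopping rule bounds the
first two; the distance between consecutive centers bounds the third. -/
theorem warm_learn_le {r : ℕ → ℕ → Sample n m S S₁} {k : ℕ} (hT : ∀ j < k, D.T r j ≠ ⊤)
    (hinit : k = 0 → D.initErr ≤ R * D.gap) :
    192 * (1 - D.δ) * D.AF * D.η ^ 3 / (D.δ ^ 2 * D.δ₁)
        * mean (fun τ => ‖(D.innerInit k (D.outer r k)).h τ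
          - gradient (mean (D.comp (D.outer r k).y τ)) (D.outer r k).x‖ ^ 2)
      ≤ R ^ 20 * (D.gap * (1 - D.ρ) ^ k) := by
  have h1 := hR.le_R
  have h3 : 0 ≤ 1 - D.ρ := by linarith [hD.ρ_lt_one]
  have h4 := hD.gap_pos'.le
  have hAF := hD.AF_pos
  have hη := hD.η_pos
  have hδ := hD.δ_pos
  have hδ₁ := hD.δ₁_pos
  have hηT := hD.ηTilde_nonneg
  have hδ1 : 0 ≤ 1 - D.δ := sub_nonneg.2 hD.δ_le
  have hb := hD.learnWeight_le hR
  have hbA := hD.learnWeight_mul_le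
  set b := 192 * (1 - D.δ) * D.AF * D.η ^ 3 / (D.δ ^ 2 * D.δ₁) with hbdef
  have hb0 : 0 ≤ b := by positivity
  cases k with
  | zero =>
    -- In the first run both prox-centers are `x⁰`, so the shift option changes nothing.
    have e : mean (fun τ => ‖(D.innerInit 0 (D.outer r 0)).h τ
          - gradient (mean (D.comp (D.outer r 0).y τ)) (D.outer r 0).x‖ ^ 2) = D.initErr := by
      unfold Run.initErr
      congr 1
      ext τ
      rw [hD.gradient_mean_comp]
      simp only [Run.innerInit, Run.outer, Run.outerInit, sub_self, smul_zero, add_zero, ite_self]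
      rw [sub_sub]
    rw [e, pow_zero, mul_one]
    have := hinit rfl
    have hn := initErr_nonneg (D := D)
    calc b * D.initErr ≤ R ^ 7 * (R * D.gap) := by gcongr
      _ = R ^ 8 * D.gap := by ring
      _ ≤ R ^ 20 * D.gap := by
        gcongr
        · linarith
        · norm_num
  | succ k =>
    obtain ⟨s, hs, hΦ, hG⟩ := hD.exists_final_state (hT k (by omega))
    have hy := hD.norm_outer_y_sq_le hR hT
    have hy' := hD.norm_outer_y_sq_le hR (r := r) (k := k) fun j hj => hT j (by omega)
    have hgeom := hD.geom_le hR k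
    have hyy := norm_sub_sq_le_add (D.outer r (k + 1)).y (D.outer r k).y (argmin D.P)
    have hsub := hD.subproblem (D.outer r k).y
    have hgl := hsub.mean_local_gradient_le s.w s.x
    set t := D.gap * (1 - D.ρ) ^ (k + 1)
    have ht : 0 ≤ t := by positivity
    have hεt : D.ε (k + 1) ≤ t := by unfold Run.ε; linarith
    set ΔY := ‖(D.outer r (k + 1)).y - (D.outer r k).y‖ ^ 2 with hΔY
    have hpt : ∀ τ, ‖(D.innerInit (k + 1) (D.outer r (k + 1))).h τ
          - gradient (mean (D.comp (D.outer r (k + 1)).y τ)) (D.outer r (k + 1)).x‖ ^ 2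
        ≤ 3 * ‖s.h τ - gradient (mean (D.comp (D.outer r k).y τ)) s.w‖ ^ 2
          + 3 * ‖gradient (mean (D.comp (D.outer r k).y τ)) s.w
            - gradient (mean (D.comp (D.outer r k).y τ)) s.x‖ ^ 2
          + 3 * (R ^ 2 * ΔY) := by
      intro τ
      have hx : (D.outer r (k + 1)).x = s.x := by rw [hs]
      have hh : (D.outer r (k + 1)).h = s.h := by rw [hs]
      have hyp : (D.outer r (k + 1)).yPrev = (D.outer r k).y := by rw [hs]
      have hyn : ∀ σ : ℝ, (σ = 0 ∨ σ = 1) → ‖(σ * D.kap) • ((D.outer r (k + 1)).y - (D.outer r k).y)‖ ^ 2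
          ≤ R ^ 2 * ΔY := by
        intro σ hσ
        have hk := hR.kap
        have hk0 := hD.kap_nonneg
        rw [norm_smul, mul_pow, Real.norm_eq_abs, sq_abs]
        have : (σ * D.kap) ^ 2 ≤ R ^ 2 := by
          rcases hσ with rfl | rfl
          · rw [zero_mul, zero_pow two_ne_zero]; positivity
          · rw [one_mul]; gcongr
        gcongr
      -- Moving the center changes every local gradient by the same vector, a multiple of `κ`. The
      -- shift compensates it exactly (`σ = 0`); without the shift it remains (`σ = 1`).
      have hkey : ∃ σ : ℝ, (σ = 0 ∨ σ = 1) ∧ (D.innerInit (k + 1) (D.outer r (k + 1))).h τ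
          - gradient (mean (D.comp (D.outer r (k + 1)).y τ)) (D.outer r (k + 1)).x
          = (s.h τ - gradient (mean (D.comp (D.outer r k).y τ)) s.w)
            + (gradient (mean (D.comp (D.outer r k).y τ)) s.w
              - gradient (mean (D.comp (D.outer r k).y τ)) s.x)
            + (σ * D.kap) • ((D.outer r (k + 1)).y - (D.outer r k).y) := by
        simp only [Run.innerInit, hx, hh, hyp, hD.gradient_mean_comp]
        split_ifs
        · exact ⟨0, Or.inl rfl, by module⟩
        · exact ⟨1, Or.inr rfl, by module⟩
      obtain ⟨σ, hσ, e⟩ := hkey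
      rw [e]
      have := norm_add_three_sq_le (s.h τ - gradient (mean (D.comp (D.outer r k).y τ)) s.w)
        (gradient (mean (D.comp (D.outer r k).y τ)) s.w
              - gradient (mean (D.comp (D.outer r k).y τ)) s.x)
        ((σ * D.kap) • ((D.outer r (k + 1)).y - (D.outer r k).y))
      linarith [hyn σ hσ]
    have hm := mul_le_mul_of_nonneg_left (mean_le hpt) hb0
    simp only [mean_add, mean_mul, mean_const hD.n_pos] at hm
    rw [hD.Φ₃_eq, potential, ← hbdef] at hΦ
    set H := mean fun τ => ‖s.h τ - gradient (mean (D.comp (D.outer r k).y τ)) s.w‖ ^ 2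
    have hw0 := hsub.subopt_nonneg s.w
    have hx0 := hsub.subopt_nonneg s.x
    rw [← hD.subopt_comp] at hG
    set Gw := subopt (D.comp (D.outer r k).y) s.w
    set Gx := subopt (D.comp (D.outer r k).y) s.x
    have n1 : 0 ≤ b * H := mul_nonneg hb0 (mean_nonneg fun τ => by positivity)
    have n2 : 0 ≤ D.ηTilde * Gw := by positivity
    have n3 := sq_nonneg ‖s.x - mean s.e - argmin (objective (D.comp (D.outer r k).y))‖
    have n4 : 0 ≤ 12 * D.AF * D.η / D.δ * mean (fun τ => ‖s.e τ‖ ^ 2) :=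
      mul_nonneg (by positivity) (mean_nonneg fun τ => by positivity)
    have k1 : b * H ≤ t := by linarith
    have k2 : D.ηTilde * Gw ≤ t := by linarith
    have k3 : b * (4 * D.Abar * (Gw + Gx)) ≤ R ^ 12 * t := by
      have a1 : b * D.Abar * Gw ≤ R * t := by
        calc b * D.Abar * Gw ≤ c₂ * D.ηTilde * Gw := by gcongr
          _ = c₂ * (D.ηTilde * Gw) := by ring
          _ ≤ R * t := by
            have := hR.c₂
            have := hD.c₂_pos
            gcongr
      have a2 : b * D.Abar * Gx ≤ R ^ 10 * t := by
        have hAb := hD.Abar_pos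
        calc b * D.Abar * Gx ≤ R ^ 7 * R ^ 3 * t := by
              gcongr
              · exact (hD.constants_le_pow hR).2.1
              · linarith
          _ = R ^ 10 * t := by ring
      have a3 : R * t ≤ R ^ 10 * t := by
        gcongr
        exact le_self_pow₀ (by linarith) (by norm_num)
      have a4 : 8 * R ^ 10 * t ≤ R ^ 12 * t := by
        gcongr
        exact mul_pow_le_pow h1 (le_refl 8) (by norm_num)
      linarith
    have k4 : b * mean (fun τ => ‖gradient (mean (D.comp (D.outer r k).y τ)) s.w
        - gradient (mean (D.comp (D.outer r k).y τ)) s.x‖ ^ 2) ≤ R ^ 12 * t :=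
      (mul_le_mul_of_nonneg_left hgl hb0).trans k3
    have k5 : ΔY ≤ R ^ 9 * t := by
      have a1 : R ^ 7 * (D.gap * (1 - D.ρ) ^ k) ≤ R ^ 8 * t := by
        calc _ ≤ R ^ 7 * (R * t) := by gcongr
          _ = R ^ 8 * t := by ring
      have a2 : R ^ 7 * t ≤ R ^ 8 * t := by
        gcongr
        · linarith
        · norm_num
      have a3 : 8 * R ^ 8 * t ≤ R ^ 9 * t := by
        gcongr
        exact mul_pow_le_pow h1 (le_refl 8) (by norm_num)
      have : 0 ≤ R ^ 8 * t := by positivity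
      linarith
    have k6 : b * (R ^ 2 * ΔY) ≤ R ^ 18 * t := by
      calc b * (R ^ 2 * ΔY) ≤ R ^ 7 * (R ^ 2 * (R ^ 9 * t)) := by gcongr
        _ = R ^ 18 * t := by ring
    have k7 : (3 + 3 * R ^ 12 + 3 * R ^ 18) * t ≤ R ^ 20 * t := by
      gcongr
      have a1 := mul_pow_le_pow h1 (le_refl 8) (show 18 + 1 ≤ 19 by norm_num)
      have a2 := mul_pow_le_pow h1 (le_refl 8) (show 19 + 1 ≤ 20 by norm_num)
      have a3 : R ^ 12 ≤ R ^ 18 := pow_le_pow_right₀ (by linarith) (by norm_num)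
      have a4 : 1 ≤ R ^ 18 := one_le_pow₀ (by linarith)
      linarith
    linarith

/-- With warm start, the initial potential is a fixed multiple of the demanded accuracy. -/
theorem warm_start_le {r : ℕ → ℕ → Sample n m S S₁} {k : ℕ} (hT : ∀ j < k, D.T r j ≠ ⊤)
    (hinit : k = 0 → D.initErr ≤ R * D.gap) :
    D.Φ₃ (D.outer r k).y (D.innerInit k (D.outer r k)) ≤ R ^ 23 * D.ε (k + 1) := by
  have h1 := hR.le_R
  have h3 : 0 ≤ 1 - D.ρ := by linarith [hD.ρ_lt_one]
  have h4 := hD.gap_pos'.le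
  have hE := hD.warm_error_le hT
  have hH := hD.warm_learn_le hR hT hinit
  have hS := hD.outer_subopt_le hR hT
  have hw : (D.innerInit k (D.outer r k)).w = (D.outer r k).x := rfl
  have hx : (D.innerInit k (D.outer r k)).x = (D.outer r k).x := rfl
  have hgeom := hD.geom_le hR k
  have hmin := hD.half_normSq_le_G (D.outer r k).y (D.outer r k).x
  rw [hD.Φ₃_eq, potential, hD.objective_comp, hw, hx, hD.subopt_comp]
  have hme := norm_mean_sq_le hD.n_pos (D.innerInit k (D.outer r k)).e
  set e := (D.innerInit k (D.outer r k)).e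
  set E := mean fun τ => ‖e τ‖ ^ 2
  have hE0 : 0 ≤ E := mean_nonneg fun τ => by positivity
  set t := D.gap * (1 - D.ρ) ^ k with ht
  have ht0 : 0 ≤ t := by positivity
  have hε : t ≤ R * (9 / 2 * D.ε (k + 1)) := by
    refine hgeom.trans (le_of_eq ?_)
    unfold Run.ε
    ring
  have k1 : E ≤ R ^ 7 * t := by
    calc E ≤ (R ^ 7 * (12 * D.AF * D.η / D.δ)) * E :=
          le_mul_of_one_le_left hE0 (hD.one_le_errorWeight hR)
      _ = R ^ 7 * (12 * D.AF * D.η / D.δ * E) := by ring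
      _ ≤ R ^ 7 * t := by gcongr
  set N := ‖(D.outer r k).x - argmin (D.G (D.outer r k).y)‖ ^ 2
  have k2 : N ≤ R ^ 12 * t := by
    have hN0 : 0 ≤ N := by positivity
    have hμ : 1 ≤ R * (D.lam + D.kap) := by
      have := hR.lam_inv
      have := hD.kap_nonneg
      nlinarith
    calc N ≤ (R * (D.lam + D.kap)) * N := le_mul_of_one_le_left hN0 hμ
      _ = 2 * R * ((D.lam + D.kap) / 2 * N) := by ring
      _ ≤ 2 * R * (R ^ 10 * t) :=
          mul_le_mul_of_nonneg_left (hmin.trans hS) (by linarith)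
      _ = 2 * R ^ 11 * t := by ring
      _ ≤ R ^ 12 * t := by
        gcongr
        exact mul_pow_le_pow h1 (by norm_num) (by norm_num)
  have k3 : ‖(D.outer r k).x - mean e - argmin (D.G (D.outer r k).y)‖ ^ 2 ≤ R ^ 13 * t := by
    have a1 := norm_sub_sq_le_add ((D.outer r k).x - argmin (D.G (D.outer r k).y)) (mean e) 0
    rw [sub_zero, sub_zero, sub_right_comm] at a1
    have a2 : R ^ 7 * t ≤ R ^ 12 * t := by
      gcongr
      · linarith
      · norm_num
    have a3 : 8 * R ^ 12 * t ≤ R ^ 13 * t := by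
      gcongr
      exact mul_pow_le_pow h1 (le_refl 8) (by norm_num)
    have : 0 ≤ R ^ 12 * t := by positivity
    linarith
  have k4 : D.ηTilde * (D.G (D.outer r k).y (D.outer r k).x - D.Gstar (D.outer r k).y)
      ≤ R ^ 13 * t := by
    have hμ := hD.μ_pos
    have hS0 : 0 ≤ D.G (D.outer r k).y (D.outer r k).x - D.Gstar (D.outer r k).y :=
      le_trans (by positivity) hmin
    calc _ ≤ R ^ 3 * (R ^ 10 * t) := by gcongr; exact hD.ηTilde_le hR
      _ = R ^ 13 * t := by ring
  have k5 : (2 * R ^ 13 + 1 + R ^ 20) * t ≤ R ^ 21 * t := by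
    gcongr
    have a1 := mul_pow_le_pow h1 (le_refl 8) (show 20 + 1 ≤ 21 by norm_num)
    have a2 : R ^ 13 ≤ R ^ 20 := pow_le_pow_right₀ (by linarith) (by norm_num)
    have a3 : 1 ≤ R ^ 20 := one_le_pow₀ (by linarith)
    linarith
  have k6 : R ^ 21 * t ≤ R ^ 23 * D.ε (k + 1) := by
    have hε0 : 0 ≤ D.ε (k + 1) := by unfold Run.ε; positivity
    calc R ^ 21 * t ≤ R ^ 21 * (R * (9 / 2 * D.ε (k + 1))) := by gcongr
      _ = 9 / 2 * R ^ 22 * D.ε (k + 1) := by ring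
      _ ≤ R ^ 23 * D.ε (k + 1) := by
        gcongr
        exact mul_pow_le_pow h1 (by norm_num) (by norm_num)
  linarith

end Run.Valid

end ECCatalyst

end

noncomputable section

namespace ECCatalyst

variable {d n m : ℕ} {S S₁ : Type*}

/-! ### The number of inner iterations -/

/-- The constant in the rate of EC-LSVRG. -/
def rateConst (Λ c₁ c : ℝ) : ℝ := 6 * (1 + |Λ|) / c + 12 + 4 / c₁

namespace Run.Valid

variable {D : Run d n m S S₁} {Λ c₁ c₂ c : ℝ} (hD : D.Valid Λ c₁ c₂ c)
include hD

theorem bound_ge : 1 / D.δ ≤ D.bound ∧ 1 / D.δ₁ ≤ D.bound := by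
  have h1 := hD.δ_pos
  have h2 := hD.δ₁_pos
  have h3 := hD.μ_pos
  have h4 := hD.Lf_nonneg
  have h5 := hD.L_nonneg
  have g1 : 0 ≤ 1 / D.δ := by positivity
  have g2 : 0 ≤ 1 / D.δ₁ := by positivity
  have g3 : 0 ≤ √((1 - D.δ) * (D.Lf + D.lam + D.kap) * (D.Lbar + D.lam + D.kap))
    / (D.δ * (D.lam + D.kap)) := by positivity
  have g4 : 0 ≤ D.Lf / (D.lam + D.kap) := by positivity
  have g5 : 0 ≤ D.L / (n * (D.lam + D.kap)) := by positivity
  have g6 : 0 ≤ √((1 - D.δ) * (D.Lf + D.lam + D.kap) * (D.L + D.lam + D.kap))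
    / (√D.δ * (D.lam + D.kap)) := by positivity
  unfold Run.bound
  constructor <;> linarith

theorem one_le_bound : 1 ≤ D.bound := by
  refine le_trans ?_ hD.bound_ge.1
  rw [le_div_iff₀ hD.δ_pos]
  linarith [hD.δ_le]

/-- Replacing `ℓ` by `λ` costs the factor `1 + |Λ|` in each constant. Both `AF` and `AL / n` leave a
spare summand `λ + κ`; these two are paid from `bound ≥ 1`, whence the 3. -/
theorem stepScale_le_bound : D.stepScale ≤ 3 * (1 + |Λ|) * D.bound * (D.lam + D.kap) := by
  have hδ := hD.δ_pos
  have hδ₁ := hD.δ₁_pos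
  have hμ := hD.μ_pos
  have hLf := hD.Lf_nonneg
  have hL := hD.L_nonneg
  have hLb := hD.Lbar_nonneg
  have hlam := hD.primal.lam_pos
  have hkap := hD.kap_nonneg
  have hn : (1 : ℝ) ≤ n := by exact_mod_cast hD.n_pos
  have hδ2 : 0 ≤ 1 - D.δ := sub_nonneg.2 hD.δ_le
  set Γ := 1 + |Λ| with hΓ
  have hΓ1 : 1 ≤ Γ := by have := abs_nonneg Λ; linarith
  have hell : D.ell ≤ Γ * D.lam := hD.ell_le.trans (by gcongr; linarith [le_abs_self Λ])
  have hX : ∀ t, 0 ≤ t → t + D.ell + D.kap ≤ Γ * (t + D.lam + D.kap) := by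
    intro t ht
    nlinarith
  have hs : ∀ t, 0 ≤ t → √((1 - D.δ) * (D.Lf + D.ell + D.kap) * (t + D.ell + D.kap))
      ≤ Γ * √((1 - D.δ) * (D.Lf + D.lam + D.kap) * (t + D.lam + D.kap)) := by
    intro t ht
    have e : Γ * √((1 - D.δ) * (D.Lf + D.lam + D.kap) * (t + D.lam + D.kap))
        = √(Γ ^ 2 * ((1 - D.δ) * (D.Lf + D.lam + D.kap) * (t + D.lam + D.kap))) := by
      rw [Real.sqrt_mul (sq_nonneg Γ), Real.sqrt_sq (by linarith)]
    rw [e]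
    refine Real.sqrt_le_sqrt ?_
    have hell0 : 0 ≤ D.ell := hlam.le.trans hD.lam_le_ell
    calc (1 - D.δ) * (D.Lf + D.ell + D.kap) * (t + D.ell + D.kap)
        ≤ (1 - D.δ) * (Γ * (D.Lf + D.lam + D.kap)) * (Γ * (t + D.lam + D.kap)) := by
          gcongr
          · exact hX _ hLf
          · exact hX _ ht
      _ = _ := by ring
  have e : 3 * Γ * D.bound * (D.lam + D.kap) = 2 * Γ * D.bound * (D.lam + D.kap)
      + Γ * ((D.lam + D.kap) * (1 / D.δ + 1 / D.δ₁)
        + √((1 - D.δ) * (D.Lf + D.lam + D.kap) * (D.Lbar + D.lam + D.kap)) / D.δ + D.Lf + D.L / n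
        + √((1 - D.δ) * (D.Lf + D.lam + D.kap) * (D.L + D.lam + D.kap)) / √D.δ) := by
    have : 0 < √D.δ := Real.sqrt_pos.2 hδ
    have : (0 : ℝ) < n := by linarith
    unfold Run.bound
    field_simp
    ring
  have h1 : D.AF ≤ Γ * (D.Lf + D.lam + D.kap) := hX _ hLf
  have h2 : D.AL / n ≤ Γ * (D.L / n + (D.lam + D.kap)) := by
    have : (D.lam + D.kap) / n ≤ D.lam + D.kap := div_le_self hμ.le hn
    calc D.AL / n ≤ Γ * (D.L + D.lam + D.kap) / n := by gcongr; exact hX _ hL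
      _ = Γ * (D.L / n + (D.lam + D.kap) / n) := by ring
      _ ≤ _ := by gcongr
  have h3 : √((1 - D.δ) * D.AF * D.Abar) / D.δ
      ≤ Γ * (√((1 - D.δ) * (D.Lf + D.lam + D.kap) * (D.Lbar + D.lam + D.kap)) / D.δ) := by
    rw [← mul_div_assoc]
    gcongr
    exact hs _ hLb
  have h4 : √((1 - D.δ) * D.AF * D.AL) / √D.δ
      ≤ Γ * (√((1 - D.δ) * (D.Lf + D.lam + D.kap) * (D.L + D.lam + D.kap)) / √D.δ) := by
    rw [← mul_div_assoc]
    gcongr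
    exact hs _ hL
  have h5 : 2 * Γ * (D.lam + D.kap) ≤ 2 * Γ * D.bound * (D.lam + D.kap) := by
    calc 2 * Γ * (D.lam + D.kap) = 2 * Γ * 1 * (D.lam + D.kap) := by ring
      _ ≤ _ := by gcongr; exact hD.one_le_bound
  have h6 : 0 ≤ Γ * ((D.lam + D.kap) * (1 / D.δ + 1 / D.δ₁)) := by positivity
  rw [e]
  unfold Run.stepScale
  linarith

omit hD in
theorem rateConst_ge (hc₁ : 0 < c₁) (hc : 0 < c) : 12 ≤ rateConst Λ c₁ c := by
  have h0 := abs_nonneg Λ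
  have h1 : 0 ≤ 6 * (1 + |Λ|) / c := by positivity
  have h2 : 0 ≤ 4 / c₁ := by positivity
  unfold rateConst
  linarith

/-- The rate of EC-LSVRG is of the order of the inverse of `bound`. -/
theorem rate_le {r : ℝ} (hr : r = 1 / (rateConst Λ c₁ c * D.bound)) :
    0 < r ∧ r ≤ 1 / 12 ∧ r ≤ (D.lam + D.kap) * D.η / 2 ∧ r ≤ D.δ / 12 ∧ r ≤ D.δ₁ / 4
      ∧ r ≤ D.p / 4 := by
  have hc₁ := hD.c₁_pos
  have hc := hD.c_pos
  have hK := rateConst_ge (Λ := Λ) hc₁ hc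
  have hB := hD.one_le_bound
  obtain ⟨hB1, hB2⟩ := hD.bound_ge
  have hδ := hD.δ_pos
  have hδ₁ := hD.δ₁_pos
  have hη := hD.η_pos
  have hμ := hD.μ_pos
  have hΓ : 0 ≤ 1 + |Λ| := by have := abs_nonneg Λ; linarith
  have g1 : 0 ≤ 6 * (1 + |Λ|) / c := by positivity
  have g2 : 0 ≤ 4 / c₁ := by positivity
  have hKB : 0 < rateConst Λ c₁ c * D.bound := by positivity
  -- Each upper bound on `r` uses one summand of `rateConst`, or its lower bound 12.
  have main : ∀ t s : ℝ, 0 < t → s ≤ rateConst Λ c₁ c → 1 ≤ s * D.bound * t → r ≤ t := by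
    intro t s ht hs h
    rw [hr, div_le_iff₀ hKB]
    calc 1 ≤ s * D.bound * t := h
      _ ≤ rateConst Λ c₁ c * D.bound * t := by gcongr
      _ = _ := by ring
  have b1 : 1 ≤ D.bound * D.δ := (div_le_iff₀ hδ).1 hB1
  have b2 : 1 ≤ D.bound * D.δ₁ := (div_le_iff₀ hδ₁).1 hB2
  refine ⟨by rw [hr]; positivity, ?_, ?_, ?_, ?_, ?_⟩
  · exact main _ 12 (by norm_num) hK (by linarith)
  · refine main _ (6 * (1 + |Λ|) / c) (by positivity) (by unfold rateConst; linarith) ?_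
    have h := hD.le_step.trans (mul_le_mul_of_nonneg_left hD.stepScale_le_bound hη.le)
    have h' : 1 ≤ D.η * (3 * (1 + |Λ|) * D.bound * (D.lam + D.kap)) / c := by
      rwa [le_div_iff₀ hc, one_mul]
    calc 1 ≤ _ := h'
      _ = _ := by ring
  · exact main _ 12 (by positivity) hK (by linarith)
  · refine main _ 12 (by positivity) hK ?_
    linarith
  · refine main _ (4 / c₁) (by have := hD.p_pos; positivity) (by unfold rateConst; linarith) ?_
    calc 1 ≤ D.bound * D.δ₁ := b2
      _ = 4 / c₁ * D.bound * ((c₁ * D.δ₁) / 4) := by field_simp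
      _ ≤ 4 / c₁ * D.bound * (D.p / 4) := by gcongr; exact hD.le_p

/-- The stopping time is controlled by the potentials. -/
theorem stopTime_le {R : ℝ} (hR : D.SizeBound Λ c₁ c₂ c R) (k : ℕ) (o : OuterState d n)
    (r : ℕ → Sample n m S S₁) (K₀ : ℕ) :
    (D.stopTime k o r : ℝ≥0∞) ≤ (1 + K₀ : ℕ)
      + ∑' i, ENNReal.ofReal (R ^ 7 / D.ε (k + 1) * D.Φ₃ o.y (D.inner k o r (K₀ + 1 + i))) := by
  have hε : 0 < D.ε (k + 1) := by
    have := hD.gap_pos'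
    have : 0 < 1 - D.ρ := by linarith [hD.ρ_lt_one]
    unfold Run.ε
    positivity
  have hlt : ∀ K : ℕ, 1 ≤ K → (K : ℕ∞) < D.stopTime k o r →
      1 ≤ ENNReal.ofReal (R ^ 7 / D.ε (k + 1) * D.Φ₃ o.y (D.inner k o r K)) := by
    intro K hK h
    have h1 : ¬ (D.Φ₃ o.y (D.inner k o r K) + D.G o.y (D.inner k o r K).x - D.Gstar o.y
        ≤ D.ε (k + 1)) := fun hc =>
          (not_lt.2 (show D.stopTime k o r ≤ K from sInf_le ⟨K, ⟨hK, hc⟩, rfl⟩)) h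
    have h2 := (hD.Φ₃_add_le hR o.y (D.inner k o r K)).2
    rw [← ENNReal.ofReal_one]
    refine ENNReal.ofReal_le_ofReal ?_
    rw [div_mul_eq_mul_div, le_div_iff₀ hε]
    linarith
  -- Each of the `N` iterations before stopping contributes at least 1 to the sum.
  have hsum : ∀ N : ℕ, ((K₀ + 1 + N : ℕ) : ℕ∞) ≤ D.stopTime k o r →
      (N : ℝ≥0∞) ≤ ∑' i, ENNReal.ofReal
        (R ^ 7 / D.ε (k + 1) * D.Φ₃ o.y (D.inner k o r (K₀ + 1 + i))) := by
    intro N hN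
    refine le_trans ?_ (ENNReal.sum_le_tsum (Finset.range N))
    calc (N : ℝ≥0∞) = ∑ _i ∈ Finset.range N, 1 := by simp
      _ ≤ _ := Finset.sum_le_sum fun i hi => hlt _ (by omega) (lt_of_lt_of_le
          (by exact_mod_cast (by have := Finset.mem_range.1 hi; omega : K₀ + 1 + i < K₀ + 1 + N)) hN)
  generalize hT : D.stopTime k o r = T at *
  cases T with
  | top =>
    -- If the run never stops, the sum exceeds every `N` and is infinite too.
    refine le_of_le_of_eq le_top (ENNReal.eq_top_of_forall_nnreal_le fun x => ?_).symm
    obtain ⟨N, hN⟩ := exists_nat_ge x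
    refine le_trans ?_ ((hsum N le_top).trans le_add_self)
    exact_mod_cast hN
  | coe t =>
    by_cases ht : t ≤ 1 + K₀
    · refine le_trans ?_ le_self_add
      simpa using (by exact_mod_cast ht : (t : ℝ≥0∞) ≤ ((1 + K₀ : ℕ) : ℝ≥0∞))
    · have h := hsum (t - (1 + K₀)) (by exact_mod_cast (by omega : K₀ + 1 + (t - (1 + K₀)) ≤ t))
      calc ((t : ℕ∞) : ℝ≥0∞) = ((1 + K₀ : ℕ) : ℝ≥0∞) + ((t - (1 + K₀) : ℕ) : ℝ≥0∞) := by
            rw [← Nat.cast_add, Nat.add_sub_cancel' (by omega)]; simp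
        _ ≤ _ := by gcongr

omit hD in
-- The exponent is `30 = 7 + 23`: the potential dominates the stopping quantity up to `R ^ 7`, and
-- warm start loses `R ^ 23`.
theorem exists_start {r R : ℝ} (hr : 0 < r) (hr1 : r ≤ 1) (hR : 1 ≤ R) :
    ∃ K₀ : ℕ, (K₀ : ℝ) ≤ 30 * Real.log R / r + 1 ∧ R ^ 30 * (1 - r) ^ K₀ ≤ 1 := by
  have hlog : 0 ≤ Real.log R := Real.log_nonneg hR
  refine ⟨⌈30 * Real.log R / r⌉₊, (Nat.ceil_lt_add_one (by positivity)).le, ?_⟩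
  set K₀ := ⌈30 * Real.log R / r⌉₊
  have h1 : 30 * Real.log R ≤ r * K₀ := by
    have := Nat.le_ceil (30 * Real.log R / r)
    rw [div_le_iff₀ hr] at this
    linarith
  have h2 : (1 - r) ^ K₀ ≤ Real.exp (-(r * K₀)) := by
    calc (1 - r) ^ K₀ ≤ Real.exp (-r) ^ K₀ := by
          gcongr
          linarith [Real.add_one_le_exp (-r)]
      _ = Real.exp (-(r * K₀)) := by rw [← Real.exp_nat_mul]; congr 1; ring
  calc R ^ 30 * (1 - r) ^ K₀ ≤ Real.exp (30 * Real.log R) * Real.exp (-(r * K₀)) := by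
        have : Real.exp (30 * Real.log R) = R ^ 30 := by
          rw [show (30 : ℝ) * Real.log R = (30 : ℕ) * Real.log R by norm_num, Real.exp_nat_mul,
            Real.exp_log (by linarith)]
        rw [this]
        gcongr
    _ = Real.exp (30 * Real.log R - r * K₀) := by rw [← Real.exp_add]; congr 1
    _ ≤ 1 := Real.exp_le_one_iff.2 (by linarith)

end Run.Valid

end ECCatalyst

end

noncomputable section

namespace ECCatalyst

variable {d n m : ℕ} {S S₁ : Type*}

/-! ### Measurability -/

instance : MeasurableSpace (InnerState d n) :=
  MeasurableSpace.comap (fun s => (s.x, s.w, s.e, s.h)) inferInstance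

instance : MeasurableSpace (OuterState d n) :=
  MeasurableSpace.comap (fun o => (o.x, o.y, o.yPrev, o.e, o.h)) inferInstance

section States

variable {α : Type*} [MeasurableSpace α]

theorem measurable_innerState_iff {s : α → InnerState d n} :
    Measurable s ↔ Measurable (fun a => (s a).x) ∧ Measurable (fun a => (s a).w)
      ∧ Measurable (fun a => (s a).e) ∧ Measurable (fun a => (s a).h) := by
  rw [measurable_comap_iff]
  exact ⟨fun h => ⟨h.fst, h.snd.fst, h.snd.snd.fst, h.snd.snd.snd⟩,
    fun h => h.1.prodMk (h.2.1.prodMk (h.2.2.1.prodMk h.2.2.2))⟩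

theorem measurable_outerState_iff {o : α → OuterState d n} :
    Measurable o ↔ Measurable (fun a => (o a).x) ∧ Measurable (fun a => (o a).y)
      ∧ Measurable (fun a => (o a).yPrev) ∧ Measurable (fun a => (o a).e)
      ∧ Measurable (fun a => (o a).h) := by
  rw [measurable_comap_iff]
  exact ⟨fun h => ⟨h.fst, h.snd.fst, h.snd.snd.fst, h.snd.snd.snd.fst, h.snd.snd.snd.snd⟩,
    fun h => h.1.prodMk (h.2.1.prodMk (h.2.2.1.prodMk (h.2.2.2.1.prodMk h.2.2.2.2)))⟩

theorem measurable_mean {l : ℕ} {V : Type*} [NormedAddCommGroup V] [NormedSpace ℝ V]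
    [MeasurableSpace V] [BorelSpace V] [SecondCountableTopology V] {u : Fin l → α → V}
    (hu : ∀ i, Measurable (u i)) : Measurable fun a => mean fun i => u i a :=
  (Finset.measurable_fun_sum _ fun i _ => hu i).fun_const_smul _

end States

namespace Run.Valid

variable {D : Run d n m S S₁} {Λ c₁ c₂ c : ℝ} (hD : D.Valid Λ c₁ c₂ c)
include hD

theorem gradient_comp (y : Vec d) (τ : Fin n) (i : Fin m) (x : Vec d) :
    gradient (D.comp y τ i) x
      = gradient (D.f τ i) x + (gradient D.ψ x + D.kap • (x - y)) := by
  have := HasGradientAt.add ((hD.primal.smooth_comp τ i).hasGradientAt x)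
    (HasGradientAt.add (hD.primal.smooth_reg.hasGradientAt x)
      (hasGradientAt_half_normSq D.kap y x))
  rw [← this.gradient]
  congr 1
  ext z
  simp only [Run.comp, add_assoc]

/-- Proximal maps are nonexpansive. Here this serves measurability: the chosen minimizer enters the
potential and hence the stopping time. -/
theorem norm_argmin_sub_le (y y' : Vec d) :
    ‖argmin (D.G y) - argmin (D.G y')‖ ≤ ‖y - y'‖ := by
  set z := argmin (D.G y)
  set z' := argmin (D.G y')
  have hk := hD.kap_nonneg
  have hlam := hD.primal.lam_pos
  have h1 := hD.half_normSq_le_G y z'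
  have h2 := hD.half_normSq_le_G y' z
  have e1 : D.Gstar y = D.G y z := iInf_eq_argmin (hD.G_exists_min y)
  have e2 : D.Gstar y' = D.G y' z' := iInf_eq_argmin (hD.G_exists_min y')
  rw [e1, norm_sub_rev] at h1
  rw [e2] at h2
  change _ * ‖z - z'‖ ^ 2 ≤ _ at h1
  change _ * ‖z - z'‖ ^ 2 ≤ _ at h2
  have h3 : ‖z' - y‖ ^ 2 - ‖z - y‖ ^ 2 + (‖z - y'‖ ^ 2 - ‖z' - y'‖ ^ 2)
      = 2 * Inner.inner ℝ (z - z') (y - y') := by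
    simp only [norm_sub_sq_real, inner_sub_left, inner_sub_right]
    ring
  have h4 := real_inner_le_norm (z - z') (y - y')
  simp only [Run.G] at h1 h2
  have h5 : (D.lam + D.kap) * ‖z - z'‖ ^ 2 ≤ D.kap * (‖z - z'‖ * ‖y - y'‖) := by
    have : D.kap * Inner.inner ℝ (z - z') (y - y') ≤ D.kap * (‖z - z'‖ * ‖y - y'‖) := by gcongr
    nlinarith
  have h6 : D.kap * (‖z - z'‖ * ‖y - y'‖) ≤ (D.lam + D.kap) * (‖z - z'‖ * ‖y - y'‖) := by
    gcongr
    linarith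
  have h7 : ‖z - z'‖ * ‖z - z'‖ ≤ ‖z - z'‖ * ‖y - y'‖ := by
    rw [← sq]
    exact le_of_mul_le_mul_left (h5.trans h6) hD.μ_pos
  rcases (norm_nonneg (z - z')).eq_or_lt with h0 | h0
  · rw [← h0]; exact norm_nonneg _
  · exact le_of_mul_le_mul_left h7 h0

theorem continuous_argmin : Continuous fun y => argmin (D.G y) :=
  (LipschitzWith.of_dist_le_mul (K := 1) fun y y' => by
    simpa [dist_eq_norm] using hD.norm_argmin_sub_le y y').continuous

variable {α : Type*} [MeasurableSpace α]

theorem measurable_gradient_mean_comp {y x : α → Vec d} (hy : Measurable y) (hx : Measurable x)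
    (τ : Fin n) : Measurable fun a => gradient (mean (D.comp (y a) τ)) (x a) := by
  simp only [hD.gradient_mean_comp]
  exact ((hD.primal.smooth_local τ).continuous_gradient.measurable.comp hx).add
    ((hD.primal.smooth_reg.continuous_gradient.measurable.comp hx).add ((hx.sub hy).fun_const_smul _))

theorem measurable_gradient_comp {y x : α → Vec d} {i : α → Fin m} (hy : Measurable y)
    (hx : Measurable x) (hi : Measurable i) (τ : Fin n) :
    Measurable fun a => gradient (D.comp (y a) τ (i a)) (x a) := by
  simp only [hD.gradient_comp]
  have h : Measurable fun q : Fin m × Vec d => gradient (D.f τ q.1) q.2 :=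
    measurable_from_prod_countable_right fun i =>
      (hD.primal.smooth_comp τ i).continuous_gradient.measurable
  exact (h.comp (hi.prodMk hx)).add
    ((hD.primal.smooth_reg.continuous_gradient.measurable.comp hx).add ((hx.sub hy).fun_const_smul _))

theorem continuous_P : Continuous D.P := continuous_iff_continuousAt.2 fun x =>
  (hD.hasGradientAt_P x).continuousAt

theorem measurable_G {y x : α → Vec d} (hy : Measurable y) (hx : Measurable x) :
    Measurable fun a => D.G (y a) (x a) :=
  (hD.continuous_P.measurable.comp hx).add (((hx.sub hy).norm.pow_const 2).const_mul _)

theorem measurable_Gstar {y : α → Vec d} (hy : Measurable y) :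
    Measurable fun a => D.Gstar (y a) := by
  have : ∀ a, D.Gstar (y a) = D.G (y a) (argmin (D.G (y a))) := fun a =>
    iInf_eq_argmin (hD.G_exists_min (y a))
  simp only [this]
  exact hD.measurable_G hy (hD.continuous_argmin.measurable.comp hy)

theorem measurable_Φ₃ {y : α → Vec d} {s : α → InnerState d n} (hy : Measurable y)
    (hs : Measurable s) : Measurable fun a => D.Φ₃ (y a) (s a) := by
  obtain ⟨hx, hw, he, hh⟩ := measurable_innerState_iff.1 hs
  have he' := fun τ => (measurable_pi_apply τ).comp he
  have hh' := fun τ => (measurable_pi_apply τ).comp hh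
  unfold Run.Φ₃
  exact (((((hx.sub (measurable_mean he')).sub
    (hD.continuous_argmin.measurable.comp hy)).norm.pow_const 2).add
    ((Finset.measurable_fun_sum _ fun τ _ => (he' τ).norm.pow_const 2).const_mul _)).add
    ((Finset.measurable_fun_sum _ fun τ _ =>
      ((hh' τ).sub (hD.measurable_gradient_mean_comp hy hw τ)).norm.pow_const 2).const_mul _)).add
    (((hD.measurable_G hy hw).sub (hD.measurable_Gstar hy)).const_mul _)

variable [MeasurableSpace S] [MeasurableSpace S₁]
  (hQ : Measurable (Function.uncurry D.Q)) (hQ₁ : Measurable (Function.uncurry D.Q₁))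
include hQ hQ₁

theorem measurable_step {y : α → Vec d} {r : α → Sample n m S S₁} {s : α → InnerState d n}
    (hy : Measurable y) (hr : Measurable r) (hs : Measurable s) :
    Measurable fun a => ecLsvrgStep (D.comp (y a)) D.Q D.Q₁ D.η (r a) (s a) := by
  obtain ⟨hx, hw, he, hh⟩ := measurable_innerState_iff.1 hs
  have he' := fun τ => (measurable_pi_apply τ).comp he
  have hh' := fun τ => (measurable_pi_apply τ).comp hh
  have hi := fun τ => (measurable_pi_apply τ).comp hr.snd.snd.fst
  have hg : ∀ τ, Measurable fun a => gradient (D.comp (y a) τ ((r a).2.2.1 τ)) (s a).x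
      - gradient (D.comp (y a) τ ((r a).2.2.1 τ)) (s a).w
      + gradient (mean (D.comp (y a) τ)) (s a).w - (s a).h τ := fun τ =>
    (((hD.measurable_gradient_comp hy hx (hi τ) τ).sub
      (hD.measurable_gradient_comp hy hw (hi τ) τ)).add
      (hD.measurable_gradient_mean_comp hy hw τ)).sub (hh' τ)
  have hq : ∀ τ, Measurable fun a => D.Q ((r a).1 τ) (D.η • (gradient (D.comp (y a) τ
      ((r a).2.2.1 τ)) (s a).x - gradient (D.comp (y a) τ ((r a).2.2.1 τ)) (s a).w
      + gradient (mean (D.comp (y a) τ)) (s a).w - (s a).h τ) + (s a).e τ) := fun τ =>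
    hQ.comp (((measurable_pi_apply τ).comp hr.fst).prodMk (((hg τ).fun_const_smul _).add (he' τ)))
  have hq₁ : ∀ τ, Measurable fun a => D.Q₁ ((r a).2.1 τ)
      (gradient (mean (D.comp (y a) τ)) (s a).w - (s a).h τ) := fun τ =>
    hQ₁.comp (((measurable_pi_apply τ).comp hr.snd.fst).prodMk
      ((hD.measurable_gradient_mean_comp hy hw τ).sub (hh' τ)))
  rw [measurable_innerState_iff]
  refine ⟨hx.sub ((measurable_mean hq).add ((measurable_mean hh').fun_const_smul _)), ?_,
    measurable_pi_iff.2 fun τ => ((he' τ).add ((hg τ).fun_const_smul _)).sub (hq τ),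
    measurable_pi_iff.2 fun τ => (hh' τ).add (hq₁ τ)⟩
  exact Measurable.ite (hr.snd.snd.snd (measurableSet_singleton true)) hx hw

omit hD hQ hQ₁ [MeasurableSpace S] [MeasurableSpace S₁] in
theorem measurable_innerInit (k : ℕ) {o : α → OuterState d n} (ho : Measurable o) :
    Measurable fun a => D.innerInit k (o a) := by
  obtain ⟨hx, hy, hyp, he, hh⟩ := measurable_outerState_iff.1 ho
  rw [measurable_innerState_iff]
  refine ⟨hx, hx, ?_, ?_⟩
  · simp only [Run.innerInit]
    split_ifs
    · exact he
    · exact measurable_const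
  · simp only [Run.innerInit]
    split_ifs
    · exact measurable_pi_iff.2 fun τ =>
        ((measurable_pi_apply τ).comp hh).add ((hyp.sub hy).fun_const_smul _)
    · exact hh

theorem measurable_inner (k : ℕ) {o : α → OuterState d n} (ho : Measurable o)
    {r : ℕ → α → Sample n m S S₁} {K : ℕ} (hr : ∀ J < K, Measurable (r J)) :
    Measurable fun a => D.inner k (o a) (fun J => r J a) K := by
  induction K with
  | zero => exact measurable_innerInit k ho
  | succ K ih =>
    exact hD.measurable_step hQ hQ₁ (measurable_outerState_iff.1 ho).2.1 (hr K (by omega))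
      (ih fun J hJ => hr J (by omega))

theorem measurable_stopTime (k : ℕ) {o : α → OuterState d n} (ho : Measurable o)
    {r : ℕ → α → Sample n m S S₁} (hr : ∀ J, Measurable (r J)) :
    Measurable fun a => D.stopTime k (o a) (fun J => r J a) := by
  have hy := (measurable_outerState_iff.1 ho).2.1
  have hin := fun K => hD.measurable_inner hQ hQ₁ k ho (K := K) fun J _ => hr J
  have hlt : ∀ N : ℕ, MeasurableSet {a | D.stopTime k (o a) (fun J => r J a) < N} := by
    intro N
    have : {a | D.stopTime k (o a) (fun J => r J a) < N} = ⋃ K : ℕ, {a | (1 ≤ K ∧ K < N) ∧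
        D.Φ₃ (o a).y (D.inner k (o a) (fun J => r J a) K)
          + D.G (o a).y (D.inner k (o a) (fun J => r J a) K).x - D.Gstar (o a).y
          ≤ D.ε (k + 1)} := by
      ext a
      simp only [Run.stopTime, sInf_lt_iff, Set.mem_ofPred_eq, Set.mem_iUnion, Set.mem_image]
      constructor
      · rintro ⟨_, ⟨K, hK, rfl⟩, h⟩
        exact ⟨K, ⟨hK.1, by exact_mod_cast h⟩, hK.2⟩
      · rintro ⟨K, hK, h⟩
        exact ⟨K, ⟨K, ⟨hK.1, h⟩, rfl⟩, by exact_mod_cast hK.2⟩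
    rw [this]
    refine MeasurableSet.iUnion fun K => (MeasurableSet.const _).inter ?_
    exact measurableSet_le (((hD.measurable_Φ₃ hy (hin K)).add (hD.measurable_G hy
      (measurable_innerState_iff.1 (hin K)).1)).sub (hD.measurable_Gstar hy)) measurable_const
  rw [ENat.measurable_iff]
  intro N
  have : (fun a => D.stopTime k (o a) (fun J => r J a)) ⁻¹' {(N : ℕ∞)}
      = {a | D.stopTime k (o a) (fun J => r J a) < (N + 1 : ℕ)}
        \ {a | D.stopTime k (o a) (fun J => r J a) < N} := by
    ext a
    simp only [Set.mem_preimage, Set.mem_singleton_iff, Set.mem_sdiff, Set.mem_ofPred_eq, not_lt]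
    push_cast
    rw [ENat.lt_add_one_iff (ENat.natCast_ne_top N)]
    exact le_antisymm_iff
  rw [this]
  exact (hlt _).diff (hlt _)

theorem measurable_outer {ξ : ℕ → ℕ → α → Sample n m S S₁} {k : ℕ}
    (hξ : ∀ j < k, ∀ J, Measurable (ξ j J)) :
    Measurable fun a => D.outer (fun k K => ξ k K a) k := by
  induction k with
  | zero => exact measurable_const
  | succ k ih =>
    have ho := ih fun j hj => hξ j (by omega)
    have hr := hξ k (by omega)
    have hT := hD.measurable_stopTime hQ hQ₁ k ho hr
    have hs : Measurable fun a => D.inner k (D.outer (fun k K => ξ k K a) k) (fun J => ξ k J a)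
        (D.stopTime k (D.outer (fun k K => ξ k K a) k) (fun J => ξ k J a)).toNat := by
      -- The state at a random time is a jointly measurable function evaluated at the time; joint
      -- measurability is automatic because `ℕ` is countable.
      have h : Measurable fun q : ℕ × α =>
          D.inner k (D.outer (fun k K => ξ k K q.2) k) (fun J => ξ k J q.2) q.1 :=
        measurable_from_prod_countable_right fun K =>
          hD.measurable_inner hQ hQ₁ k ho fun J _ => hr J
      exact h.comp (((Measurable.of_discrete (f := ENat.toNat)).comp hT).prodMk measurable_id)
    obtain ⟨hx, hw, he, hh⟩ := measurable_innerState_iff.1 hs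
    obtain ⟨ox, oy, -⟩ := measurable_outerState_iff.1 ho
    rw [measurable_outerState_iff]
    exact ⟨hx, hx.add ((hx.sub ox).fun_const_smul _), oy, he, hh⟩

end Run.Valid

end ECCatalyst

end

noncomputable section

namespace ECCatalyst

variable {d n m : ℕ} {S S₁ : Type*}

/-! ### Expected number of inner iterations -/

namespace Run.Valid

variable {D : Run d n m S S₁} {Λ c₁ c₂ c : ℝ} (hD : D.Valid Λ c₁ c₂ c)
  [MeasurableSpace S] [MeasurableSpace S₁]
include hD

/-- Only earlier runs and earlier iterations of the current run need to be measurable. With the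
explicit `mα` this applies to the σ-algebra generated by the past alone. -/
theorem measurable_states (hQ : Measurable (Function.uncurry D.Q))
    (hQ₁ : Measurable (Function.uncurry D.Q₁)) {α : Type*} [mα : MeasurableSpace α]
    {ξ : ℕ → ℕ → α → Sample n m S S₁} {k K : ℕ}
    (hξ : ∀ j J, j < k ∨ (j = k ∧ J < K) → Measurable (ξ j J)) :
    Measurable fun a => (D.outer (fun k K => ξ k K a) k,
      D.inner k (D.outer (fun k K => ξ k K a) k) (fun J => ξ k J a) K) := by
  have ho := hD.measurable_outer hQ hQ₁ (k := k) fun j hj J => hξ j J (Or.inl hj)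
  exact ho.prodMk (hD.measurable_inner hQ hQ₁ k ho fun J hJ => hξ k J (Or.inr ⟨rfl, hJ⟩))

variable {μ : Measure S} {μ₁ : Measure S₁} [IsProbabilityMeasure μ] [IsProbabilityMeasure μ₁]
  (hQ : IsContractionCompressor μ D.δ D.Q) (hQ₁ : IsContractionCompressor μ₁ D.δ₁ D.Q₁)
include hQ hQ₁

theorem lintegral_Φ₃_step_le {r : ℝ} (hr : r = 1 / (rateConst Λ c₁ c * D.bound)) (y : Vec d)
    (s : InnerState d n) :
    ∫⁻ ω, ENNReal.ofReal (D.Φ₃ y (ecLsvrgStep (D.comp y) D.Q D.Q₁ D.η ω s))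
        ∂(sampleLaw n m μ μ₁ D.p)
      ≤ ENNReal.ofReal (1 - r) * ENNReal.ofReal (D.Φ₃ y s) := by
  obtain ⟨-, h0, h1, h2, h3, h4⟩ := hD.rate_le hr
  rw [← ENNReal.ofReal_mul (by linarith)]
  simp only [hD.Φ₃_eq, ηTilde_eq]
  exact (hD.subproblem y).lintegral_potential_step_le_mul hD.p_pos hD.p_le_one hQ hQ₁ hD.η_pos
    hD.stepsize.1 hD.stepsize.2 h1 h2 h3 h4 s

variable {Ω : Type*} [MeasurableSpace Ω] {Pr : Measure Ω} [IsProbabilityMeasure Pr]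
  {ξ : ℕ → ℕ → Ω → Sample n m S S₁} (hξ : ∀ k K, Measurable (ξ k K))
  (hlaw : ∀ k K, Measure.map (ξ k K) Pr = sampleLaw n m μ μ₁ D.p)
  (hind : iIndepFun (fun kK : ℕ × ℕ => ξ kK.1 kK.2) Pr)
include hξ hind

omit [IsProbabilityMeasure μ] [IsProbabilityMeasure μ₁] [IsProbabilityMeasure Pr] in
-- The state before iteration `K` of run `k` is measurable with respect to the samples that precede
-- `(k, K)`. The earlier runs contribute all their samples, since their stopping times are
-- unbounded, but `(k, K)` itself is not among them.
theorem indepFun_states (k K : ℕ) :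
    IndepFun (fun ω => (D.outer (fun k K => ξ k K ω) k,
      D.inner k (D.outer (fun k K => ξ k K ω) k) (fun J => ξ k J ω) K)) (ξ k K) Pr := by
  let past : Set (ℕ × ℕ) := {q | q.1 < k ∨ (q.1 = k ∧ q.2 < K)}
  let σ : ℕ × ℕ → MeasurableSpace Ω := fun q => MeasurableSpace.comap (ξ q.1 q.2) inferInstance
  have hdisj : Disjoint past {(k, K)} := by
    rw [Set.disjoint_singleton_right]
    simp [past]
  have hI := indep_iSup_of_disjoint (m := σ) (fun q => (hξ q.1 q.2).comap_le)
    ((iIndepFun_iff_iIndep _ _ _).1 hind) hdisj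
  rw [IndepFun_iff_Indep]
  refine indep_of_indep_of_le_left (indep_of_indep_of_le_right hI ?_) ?_
  · exact le_iSup₂_of_le (k, K) rfl le_rfl
  · refine measurable_iff_comap_le.1 ?_
    refine hD.measurable_states hQ.measurable hQ₁.measurable (mα := ⨆ q ∈ past, σ q)
      fun j J hj => ?_
    exact measurable_iff_comap_le.2 (le_iSup₂_of_le (f := fun q (_ : q ∈ past) => σ q) (j, J) hj le_rfl)

include hlaw

/-- By independence, the joint law of state and fresh sample is a product, so the one-step
contraction for fixed states integrates. -/
theorem lintegral_Φ₃_succ_le {r : ℝ} (hr : r = 1 / (rateConst Λ c₁ c * D.bound)) (k K : ℕ) :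
    ∫⁻ ω, ENNReal.ofReal (D.Φ₃ (D.outer (fun k K => ξ k K ω) k).y
        (D.inner k (D.outer (fun k K => ξ k K ω) k) (fun J => ξ k J ω) (K + 1))) ∂Pr
      ≤ ENNReal.ofReal (1 - r) * ∫⁻ ω, ENNReal.ofReal (D.Φ₃ (D.outer (fun k K => ξ k K ω) k).y
        (D.inner k (D.outer (fun k K => ξ k K ω) k) (fun J => ξ k J ω) K)) ∂Pr := by
  have hZ := hD.measurable_states hQ.measurable hQ₁.measurable (k := k) (K := K)
    fun j J _ => hξ j J
  have hI := hD.indepFun_states hQ hQ₁ hξ hind k K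
  set Z := fun ω => (D.outer (fun k K => ξ k K ω) k,
      D.inner k (D.outer (fun k K => ξ k K ω) k) (fun J => ξ k J ω) K) with hZdef
  have hmap := hI.map_prod_eq_prod_map_map hZ.aemeasurable (hξ k K).aemeasurable
  rw [hlaw] at hmap
  have := isProbabilityMeasure_sampleLaw (n := n) μ μ₁ hD.m_pos hD.p_pos.le hD.p_le_one
  have hg : Measurable fun q : (OuterState d n × InnerState d n) × Sample n m S S₁ =>
      ENNReal.ofReal (D.Φ₃ q.1.1.y (ecLsvrgStep (D.comp q.1.1.y) D.Q D.Q₁ D.η q.2 q.1.2)) := by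
    have hy : Measurable fun q : (OuterState d n × InnerState d n) × Sample n m S S₁ => q.1.1.y :=
      (measurable_outerState_iff.1 (measurable_fst.comp measurable_fst)).2.1
    exact (hD.measurable_Φ₃ hy (hD.measurable_step hQ.measurable hQ₁.measurable hy measurable_snd
      (measurable_snd.comp measurable_fst))).ennreal_ofReal
  have hf : Measurable fun z : OuterState d n × InnerState d n =>
      ENNReal.ofReal (D.Φ₃ z.1.y z.2) :=
    (hD.measurable_Φ₃ (measurable_outerState_iff.1 measurable_fst).2.1
      measurable_snd).ennreal_ofReal
  calc _ = ∫⁻ ω, (fun q : (OuterState d n × InnerState d n) × Sample n m S S₁ =>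
          ENNReal.ofReal (D.Φ₃ q.1.1.y (ecLsvrgStep (D.comp q.1.1.y) D.Q D.Q₁ D.η q.2 q.1.2)))
          (Z ω, ξ k K ω) ∂Pr := rfl
    _ = ∫⁻ z, ∫⁻ s, ENNReal.ofReal (D.Φ₃ z.1.y (ecLsvrgStep (D.comp z.1.y) D.Q D.Q₁ D.η s z.2))
          ∂(sampleLaw n m μ μ₁ D.p) ∂(Measure.map Z Pr) := by
      rw [← lintegral_map hg (hZ.prodMk (hξ k K)), hmap, lintegral_prod _ hg.aemeasurable]
    _ ≤ ∫⁻ z, ENNReal.ofReal (1 - r) * ENNReal.ofReal (D.Φ₃ z.1.y z.2) ∂(Measure.map Z Pr) :=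
      lintegral_mono fun z => hD.lintegral_Φ₃_step_le hQ hQ₁ hr z.1.y z.2
    _ = ENNReal.ofReal (1 - r) * ∫⁻ ω, ENNReal.ofReal (D.Φ₃ (Z ω).1.y (Z ω).2) ∂Pr := by
      rw [lintegral_const_mul _ hf, lintegral_map hf hZ]

theorem lintegral_Φ₃_le {r B : ℝ} (hr : r = 1 / (rateConst Λ c₁ c * D.bound)) (k : ℕ)
    (hB : ∀ᵐ ω ∂Pr, D.Φ₃ (D.outer (fun k K => ξ k K ω) k).y
      (D.innerInit k (D.outer (fun k K => ξ k K ω) k)) ≤ B) (K : ℕ) :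
    ∫⁻ ω, ENNReal.ofReal (D.Φ₃ (D.outer (fun k K => ξ k K ω) k).y
        (D.inner k (D.outer (fun k K => ξ k K ω) k) (fun J => ξ k J ω) K)) ∂Pr
      ≤ ENNReal.ofReal ((1 - r) ^ K * B) := by
  have h1 : 0 ≤ 1 - r := by linarith [(hD.rate_le hr).2.1]
  induction K with
  | zero =>
    calc _ ≤ ∫⁻ _, ENNReal.ofReal B ∂Pr :=
          lintegral_mono_ae (hB.mono fun ω h => ENNReal.ofReal_le_ofReal h)
      _ = ENNReal.ofReal ((1 - r) ^ 0 * B) := by simp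
  | succ K ih =>
    refine (hD.lintegral_Φ₃_succ_le hQ hQ₁ hξ hlaw hind hr k K).trans ?_
    calc _ ≤ ENNReal.ofReal (1 - r) * ENNReal.ofReal ((1 - r) ^ K * B) := by gcongr
      _ = ENNReal.ofReal ((1 - r) ^ (K + 1) * B) := by
        rw [← ENNReal.ofReal_mul h1]; congr 1; ring

omit hQ hQ₁ hlaw hind hξ [MeasurableSpace S] [MeasurableSpace S₁] in
theorem initErr_le (k : ℕ) : k = 0 →
    D.initErr ≤ (4 + |Λ| + 1 / c + 1 / c₁ + c₂) * D.logArg k * D.gap := by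
  intro hk
  have h := (hD.logArg_parts k).2.2.2.2.2.2.2.2.2.2.2
  have h2 := (hD.logArg_parts k).1
  have hg := hD.gap_pos'
  rw [if_pos hk, div_le_iff₀ hg] at h
  have h3 := hD.c_pos
  have h4 := hD.c₁_pos
  have h5 := hD.c₂_pos
  have hK : 1 ≤ 4 + |Λ| + 1 / c + 1 / c₁ + c₂ := by
    have : 0 < 1 / c := by positivity
    have : 0 < 1 / c₁ := by positivity
    have := abs_nonneg Λ
    linarith
  calc D.initErr ≤ D.logArg k * D.gap := h
    _ ≤ (4 + |Λ| + 1 / c + 1 / c₁ + c₂) * (D.logArg k * D.gap) :=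
      le_mul_of_one_le_left (by positivity) hK
    _ = _ := by ring

/-- After `K₀` iterations the expected potential has lost the factor `R ^ 30`; from there the
expected excess is a geometric series with sum `1 / r`. Finiteness of the earlier runs is needed for
the warm start bound. -/
theorem lintegral_T_le_of_ae (k : ℕ) (hfin : ∀ᵐ ω ∂Pr, ∀ j < k, D.T (fun k K => ξ k K ω) j ≠ ⊤) :
    ∫⁻ ω, (D.T (fun k K => ξ k K ω) k : ℝ≥0∞) ∂Pr
      ≤ ENNReal.ofReal (rateConst Λ c₁ c * (34 + 60 * Real.log (4 + |Λ| + 1 / c + 1 / c₁ + c₂))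
        * D.bound * Real.log (D.logArg k)) := by
  have hR := hD.sizeBound k
  have hinit := hD.initErr_le k
  obtain ⟨K₁, hK₁⟩ : ∃ K₁, K₁ = 4 + |Λ| + 1 / c + 1 / c₁ + c₂ := ⟨_, rfl⟩
  rw [← hK₁] at hR hinit ⊢
  obtain ⟨R, hRdef⟩ : ∃ R, R = K₁ * D.logArg k := ⟨_, rfl⟩
  rw [← hRdef] at hR hinit
  have hR8 := hR.le_R
  obtain ⟨r, hr⟩ : ∃ r, r = 1 / (rateConst Λ c₁ c * D.bound) := ⟨_, rfl⟩
  obtain ⟨hr0, hr1, -⟩ := hD.rate_le hr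
  obtain ⟨K₀, hK₀, hpow⟩ := exists_start hr0 (by linarith) (show 1 ≤ R by linarith)
  have h1r : 0 ≤ 1 - r := by linarith
  have hε : 0 < D.ε (k + 1) := by
    have := hD.gap_pos'
    have : 0 < 1 - D.ρ := by linarith [hD.ρ_lt_one]
    unfold Run.ε
    positivity
  have hΦ := hD.lintegral_Φ₃_le hQ hQ₁ hξ hlaw hind hr k
    (hfin.mono fun ω h => hD.warm_start_le hR h hinit)
  have ho := hD.measurable_outer hQ.measurable hQ₁.measurable (ξ := ξ) (k := k)
    fun j _ J => hξ j J
  have hmeas : ∀ K, Measurable fun ω => ENNReal.ofReal (R ^ 7 / D.ε (k + 1)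
      * D.Φ₃ (D.outer (fun k K => ξ k K ω) k).y
        (D.inner k (D.outer (fun k K => ξ k K ω) k) (fun J => ξ k J ω) K)) := fun K =>
    ((hD.measurable_Φ₃ (measurable_outerState_iff.1 ho).2.1 (hD.measurable_inner hQ.measurable
      hQ₁.measurable k ho fun J _ => hξ k J)).const_mul _).ennreal_ofReal
  have hterm : ∀ i, ∫⁻ ω, ENNReal.ofReal (R ^ 7 / D.ε (k + 1)
      * D.Φ₃ (D.outer (fun k K => ξ k K ω) k).y
        (D.inner k (D.outer (fun k K => ξ k K ω) k) (fun J => ξ k J ω) (K₀ + 1 + i))) ∂Pr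
      ≤ ENNReal.ofReal ((1 - r) ^ i) := by
    intro i
    simp only [ENNReal.ofReal_mul (show 0 ≤ R ^ 7 / D.ε (k + 1) by positivity)]
    rw [lintegral_const_mul' _ _ ENNReal.ofReal_ne_top]
    refine (mul_le_mul_right (hΦ (K₀ + 1 + i)) _).trans ?_
    rw [← ENNReal.ofReal_mul (by positivity)]
    refine ENNReal.ofReal_le_ofReal ?_
    calc R ^ 7 / D.ε (k + 1) * ((1 - r) ^ (K₀ + 1 + i) * (R ^ 23 * D.ε (k + 1)))
        = (R ^ 30 * (1 - r) ^ K₀) * (1 - r) * (1 - r) ^ i := by field_simp; ring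
      _ ≤ 1 * 1 * (1 - r) ^ i := by gcongr; linarith
      _ = (1 - r) ^ i := by ring
  have hlog2 : 1 / 2 ≤ Real.log (D.logArg k) := by
    have h := Real.log_le_log (by norm_num) (hD.logArg_parts k).1
    linarith [Real.log_two_gt_d9]
  have hK1 : 1 ≤ K₁ := by
    have h3 := hD.c_pos
    have h4 := hD.c₁_pos
    have h5 := hD.c₂_pos
    have : 0 < 1 / c := by positivity
    have : 0 < 1 / c₁ := by positivity
    have := abs_nonneg Λ
    linarith
  have hlogK : 0 ≤ Real.log K₁ := Real.log_nonneg hK1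
  calc ∫⁻ ω, (D.T (fun k K => ξ k K ω) k : ℝ≥0∞) ∂Pr
      ≤ ∫⁻ ω, ((1 + K₀ : ℕ) + ∑' i, ENNReal.ofReal (R ^ 7 / D.ε (k + 1)
        * D.Φ₃ (D.outer (fun k K => ξ k K ω) k).y
        (D.inner k (D.outer (fun k K => ξ k K ω) k) (fun J => ξ k J ω) (K₀ + 1 + i)))) ∂Pr :=
        lintegral_mono fun ω => hD.stopTime_le hR k _ _ K₀
    _ = (1 + K₀ : ℕ) + ∑' i, ∫⁻ ω, ENNReal.ofReal (R ^ 7 / D.ε (k + 1)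
        * D.Φ₃ (D.outer (fun k K => ξ k K ω) k).y
        (D.inner k (D.outer (fun k K => ξ k K ω) k) (fun J => ξ k J ω) (K₀ + 1 + i))) ∂Pr := by
      rw [lintegral_add_left measurable_const, lintegral_const, measure_univ, mul_one,
        lintegral_tsum fun i => (hmeas _).aemeasurable]
    _ ≤ (1 + K₀ : ℕ) + ∑' i, ENNReal.ofReal ((1 - r) ^ i) := by
      gcongr with i
      exact hterm i
    _ = ENNReal.ofReal (1 + K₀ + 1 / r) := by
      rw [← ENNReal.ofReal_tsum_of_nonneg (fun i => by positivity)
        (summable_geometric_of_lt_one h1r (by linarith)), tsum_geometric_of_lt_one h1r (by linarith),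
        ENNReal.ofReal_add (by positivity) (by positivity), sub_sub_cancel, one_div]
      congr 1
      rw [← ENNReal.ofReal_natCast]
      push_cast
      rfl
    _ ≤ _ := by
      refine ENNReal.ofReal_le_ofReal ?_
      have hKB : rateConst Λ c₁ c * D.bound = 1 / r := by rw [hr, one_div_one_div]
      have e : rateConst Λ c₁ c * (34 + 60 * Real.log K₁) * D.bound * Real.log (D.logArg k)
          = (34 + 60 * Real.log K₁) * Real.log (D.logArg k) * (1 / r) := by rw [← hKB]; ring
      rw [e]
      have hlogR : Real.log R = Real.log K₁ + Real.log (D.logArg k) := by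
        rw [hRdef, Real.log_mul (by linarith) (by linarith [(hD.logArg_parts k).1])]
      have h12 : 2 ≤ 1 / r := by rw [le_div_iff₀ hr0]; linarith
      have h3 : 30 * Real.log R / r = 30 * Real.log R * (1 / r) := by ring
      -- As `logArg ≥ 2`, its logarithm is at least `1/2`: the 2 is absorbed by 4 such logarithms,
      -- and `30 * log K₁` by `60 * log K₁` times one.
      have h4 : 2 + 30 * Real.log R ≤ (34 + 60 * Real.log K₁) * Real.log (D.logArg k) := by
        rw [hlogR]
        nlinarith
      have h5 : (2 + 30 * Real.log R) * (1 / r)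
          ≤ (34 + 60 * Real.log K₁) * Real.log (D.logArg k) * (1 / r) := by gcongr
      linarith

omit [IsProbabilityMeasure μ] [IsProbabilityMeasure μ₁] [IsProbabilityMeasure Pr] hlaw hind in
theorem measurable_T (k : ℕ) : Measurable fun ω => (D.T (fun k K => ξ k K ω) k : ℝ≥0∞) := by
  have ho := hD.measurable_outer hQ.measurable hQ₁.measurable (ξ := ξ) (k := k)
    fun j _ J => hξ j J
  exact (Measurable.of_discrete (f := fun t : ℕ∞ => (t : ℝ≥0∞))).comp
    (hD.measurable_stopTime hQ.measurable hQ₁.measurable k ho fun J => hξ k J)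

/-- Breaks the circularity: almost sure finiteness of the earlier runs bounds the expectation of the
next one, which is therefore finite almost surely as well. -/
theorem ae_T_ne_top (k : ℕ) : ∀ᵐ ω ∂Pr, ∀ j < k, D.T (fun k K => ξ k K ω) j ≠ ⊤ := by
  induction k with
  | zero => simp
  | succ k ih =>
    have h1 := hD.lintegral_T_le_of_ae hQ hQ₁ hξ hlaw hind k ih
    have h2 := ae_lt_top (hD.measurable_T hQ hQ₁ hξ k)
      (h1.trans_lt ENNReal.ofReal_lt_top).ne
    filter_upwards [ih, h2] with ω hω hk j hj
    rcases Nat.lt_succ_iff_lt_or_eq.1 hj with h | rfl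
    · exact hω j h
    · intro htop
      rw [htop] at hk
      simp at hk

theorem lintegral_T_le (k : ℕ) :
    ∫⁻ ω, (D.T (fun k K => ξ k K ω) k : ℝ≥0∞) ∂Pr
      ≤ ENNReal.ofReal (rateConst Λ c₁ c * (34 + 60 * Real.log (4 + |Λ| + 1 / c + 1 / c₁ + c₂))
        * D.bound * Real.log (D.logArg k)) :=
  hD.lintegral_T_le_of_ae hQ hQ₁ hξ hlaw hind k (hD.ae_T_ne_top hQ hQ₁ hξ hlaw hind k)

omit hQ hQ₁ hlaw hind hξ [MeasurableSpace S] [MeasurableSpace S₁] in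
theorem logArg_le (k : ℕ) : D.logArg k ≤ D.logArg 0 := by
  have h := hD.logArg_extra_nonneg 0
  rcases eq_or_ne k 0 with rfl | hk
  · exact le_rfl
  · simp only [Run.logArg, if_neg hk, ↓reduceIte] at h ⊢
    linarith

omit hQ hQ₁ hlaw hind hξ [MeasurableSpace S] [MeasurableSpace S₁] in
theorem rate_reaches {C ε : ℝ} (hC : 9 ≤ C) (hε : 0 < ε) {k : ℕ}
    (hk : max 0 (Real.log (C * D.gap / ((√D.q - D.ρ) ^ 2 * ε))) / D.ρ ≤ k) :
    9 / (√D.q - D.ρ) ^ 2 * D.gap * (1 - D.ρ) ^ k ≤ ε := by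
  have hg := hD.gap_pos'
  have hdiff : 0 < √D.q - D.ρ := sub_pos.2 hD.ρ_lt
  have hρ := hD.ρ_pos
  have hρ1 : 0 ≤ 1 - D.ρ := by linarith [hD.ρ_lt_one]
  set A := C * D.gap / ((√D.q - D.ρ) ^ 2 * ε) with hA
  have hA0 : 0 < A := by positivity
  have h1 : Real.log A ≤ D.ρ * k := by
    rw [div_le_iff₀ hρ] at hk
    linarith [le_max_right 0 (Real.log A)]
  have h2 : (1 - D.ρ) ^ k ≤ 1 / A := by
    calc (1 - D.ρ) ^ k ≤ Real.exp (-D.ρ) ^ k := by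
          gcongr
          linarith [Real.add_one_le_exp (-D.ρ)]
      _ = Real.exp (-(D.ρ * k)) := by rw [← Real.exp_nat_mul]; congr 1; ring
      _ ≤ Real.exp (-Real.log A) := Real.exp_le_exp.2 (by linarith)
      _ = 1 / A := by rw [Real.exp_neg, Real.exp_log hA0, one_div]
  calc 9 / (√D.q - D.ρ) ^ 2 * D.gap * (1 - D.ρ) ^ k
      ≤ C / (√D.q - D.ρ) ^ 2 * D.gap * (1 / A) := by gcongr
    _ = ε := by rw [hA]; field_simp

end Run.Valid

end ECCatalyst

end

/-! ### The main theorem -/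

theorem mainTheorem5 (Λ c₁ c₂ : ℝ) (hc₁ : 0 < c₁) (hc₂ : 0 < c₂) :
    ∃ c₀ > (0 : ℝ), ∀ c > (0 : ℝ), ∃ C > (0 : ℝ),
    ∀ (d n m : ℕ) (S S₁ : Type*) [MeasurableSpace S] [MeasurableSpace S₁]
      (μ : Measure S) (μ₁ : Measure S₁) [IsProbabilityMeasure μ] [IsProbabilityMeasure μ₁]
      (D : ECCatalyst.Run d n m S S₁)
      (Ω : Type*) [MeasurableSpace Ω] (Pr : Measure Ω) [IsProbabilityMeasure Pr]
      (ξ : ℕ → ℕ → Ω → ECCatalyst.Sample n m S S₁),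
      0 < n → 0 < m →
      D.PrimalAssumption →
      -- `ψ` is smooth, with condition number at most `Λ`
      D.ell ≤ Λ * D.lam →
      ECCatalyst.IsContractionCompressor μ D.δ D.Q →
      ECCatalyst.IsContractionCompressor μ₁ D.δ₁ D.Q₁ →
      0 ≤ D.kap → 0 < D.ρ → D.ρ < √D.q →
      -- the starting point is not already optimal
      (⨅ x, D.P x) < D.P D.x0 →
      -- `p = Θ(δ₁)`
      c₁ * D.δ₁ ≤ D.p → D.p ≤ c₂ * D.δ₁ → D.p ≤ 1 →
      -- the stepsize is of order `1 / stepScale`, with a small enough constant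
      c ≤ D.η * D.stepScale → D.η * D.stepScale ≤ c₀ →
      -- fresh independent randomness in every inner iteration of every outer iteration
      (∀ k K, Measurable (ξ k K)) →
      (∀ k K, Measure.map (ξ k K) Pr = ECCatalyst.sampleLaw n m μ μ₁ D.p) →
      iIndepFun (fun kK : ℕ × ℕ => ξ kK.1 kK.2) Pr →
      -- expected number of inner iterations in each outer iteration
      (∀ k, ∫⁻ ω, (D.T (fun k K => ξ k K ω) k : ℝ≥0∞) ∂Pr
          ≤ ENNReal.ofReal (C * D.bound * Real.log (D.logArg k))) ∧
      -- expected total communication needed for accuracy `ε`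
      (∀ rQ rQ₁ ε : ℝ, 0 ≤ rQ → 0 ≤ rQ₁ → 0 < ε →
        ∃ k : ℕ,
          (k : ℝ) ≤ 1 + max 0 (Real.log (C * D.gap / ((√D.q - D.ρ) ^ 2 * ε))) / D.ρ ∧
          (∀ᵐ ω ∂Pr, D.P (D.outer (fun k K => ξ k K ω) k).x - (⨅ x, D.P x) ≤ ε) ∧
          ∫⁻ ω, D.commCost rQ rQ₁ (fun k K => ξ k K ω) k ∂Pr
            ≤ ENNReal.ofReal
                ((rQ + rQ₁) * (C * D.bound * Real.log (D.logArg 0)) * k)) := by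
  refine ⟨1 / (128 * (1 + c₂)), by positivity, fun c hc => ?_⟩
  -- The 9 is the constant of the outer rate; the other argument is that of the expected run length.
  refine ⟨max 9 (ECCatalyst.rateConst Λ c₁ c
    * (34 + 60 * Real.log (4 + |Λ| + 1 / c + 1 / c₁ + c₂))), by positivity, ?_⟩
  intro d n m S S₁ _ _ μ μ₁ _ _ D Ω _ Pr _ ξ hn hm hprim hell hQ hQ₁ hkap hρ hρq hgap hp1 hp2 hp3
    hη1 hη2 hξ hlaw hind
  have hD : D.Valid Λ c₁ c₂ c := ⟨hn, hm, hprim, hell, hQ.pos, hQ.le_one, hQ₁.pos, hQ₁.le_one, hkap,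
    hρ, hρq, hgap, hc₁, hc₂, hc, hp1, hp2, hp3, hη1, hη2⟩
  set C := max 9 (ECCatalyst.rateConst Λ c₁ c
    * (34 + 60 * Real.log (4 + |Λ| + 1 / c + 1 / c₁ + c₂)))
  have hC : 9 ≤ C := le_max_left _ _
  have hB := hD.one_le_bound
  have hlog : ∀ k, 0 ≤ Real.log (D.logArg k) := fun k =>
    Real.log_nonneg (by linarith [(hD.logArg_parts k).1])
  have hT : ∀ k, ∫⁻ ω, (D.T (fun k K => ξ k K ω) k : ℝ≥0∞) ∂Pr
      ≤ ENNReal.ofReal (C * D.bound * Real.log (D.logArg k)) := by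
    intro k
    refine (hD.lintegral_T_le hQ hQ₁ hξ hlaw hind k).trans (ENNReal.ofReal_le_ofReal ?_)
    have := hlog k
    gcongr
    exact le_max_right _ _
  refine ⟨hT, fun rQ rQ₁ ε hrQ hrQ₁ hε => ?_⟩
  set t := max 0 (Real.log (C * D.gap / ((√D.q - D.ρ) ^ 2 * ε))) / D.ρ with ht
  have ht0 : 0 ≤ t := div_nonneg (le_max_left _ _) hρ.le
  refine ⟨⌈t⌉₊, by linarith [Nat.ceil_lt_add_one ht0], ?_, ?_⟩
  · filter_upwards [hD.ae_T_ne_top hQ hQ₁ hξ hlaw hind ⌈t⌉₊] with ω hω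
    rw [ECCatalyst.iInf_eq_argmin hD.P_exists_min]
    exact (hD.outer_rate hω).trans (hD.rate_reaches hC hε (Nat.le_ceil t))
  · have hr : 0 ≤ rQ + rQ₁ := add_nonneg hrQ hrQ₁
    unfold ECCatalyst.Run.commCost
    rw [lintegral_finsetSum _ fun j _ => (hD.measurable_T hQ hQ₁ hξ j).const_mul _]
    calc _ ≤ ∑ _j ∈ Finset.range ⌈t⌉₊, ENNReal.ofReal
          ((rQ + rQ₁) * (C * D.bound * Real.log (D.logArg 0))) := by
          refine Finset.sum_le_sum fun j _ => ?_
          rw [lintegral_const_mul' _ _ ENNReal.ofReal_ne_top, ENNReal.ofReal_mul hr]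
          gcongr
          refine (hT j).trans (ENNReal.ofReal_le_ofReal ?_)
          gcongr
          · linarith [(hD.logArg_parts j).1]
          · exact hD.logArg_le j
      _ = _ := by
        have := hlog 0
        rw [Finset.sum_const, Finset.card_range, nsmul_eq_mul, mul_comm,
          ENNReal.ofReal_mul (q := (⌈t⌉₊ : ℝ)) (by positivity), ENNReal.ofReal_natCast]
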